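/- Let $k$ be an algebraically closed field of characteristic $p>0$ and let $\mathcal G$ be a finite group scheme over $k$ with algebra of measures $k\mathcal G$ (a finite-dimensional cocommutative Hopf algebra; $\mathcal G$-modules are the same as $k\mathcal G$-modules). For a field extension $K/k$ put $K\mathcal G:=K\otimes_k k\mathcal G$, the algebra of measures of $\mathcal G_K$, $M_K:=K\otimes_k M$ and $\mathfrak A_{p,K}:=K[T]/(T^p)$. A *$\pi$-point* is a left flat homomorphism $\alpha_K:\mathfrak A_{p,K}\to K\mathcal G$ of $K$-algebras whose image is contained in $K\mathcal U$ for some abelian unipotent subgroup $\mathcal U\subseteq\mathcal G_K$. For a finite-dimensional $\mathcal G$-module $M$ and $1\le i\le p$ let $\alpha_{K,i}(M)$ be the multiplicity of the $i$-dimensional indecomposable $\mathfrak A_{p,K}$-module $[i]$ in the pull-back $\alpha_K^*(M_K)\cong\bigoplus_{i=1}^p\alpha_{K,i}(M)[i]$. Let $\Gamma_s(\mathcal G)$ be the stable Auslander–Reiten quiver of $k\mathcal G$: its vertices are the isomorphism classes of non-projective indecomposable finite-dimensional $\mathcal G$-modules; for the almost split sequence $\mathfrak E_Y: 0\to\tau_{\mathcal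 G}(Y)\to E\to Y\to 0$ terminating in $Y$, there is an arrow $X\to Y$ with valuation $(m,m)$ if $X$ occurs in $E$ with multiplicity $m>0$; the translation is $\tau_{\mathcal G}$. A *component* $\Theta$ is a connected component of this stable translation quiver (connected by arrows and by $\tau_{\mathcal G}$, so that $\tau_{\mathcal G}(\Theta)\subseteq\Theta$). A function $f:\Theta\to\mathbb N_0$ is *subadditive* if $$f(Y)+f(\tau_{\mathcal G}(Y))\ \ge\ \sum_{X\to Y} m_{X,Y}\,f(X)\qquad\text{for all }Y\in\Theta,$$ where $(m_{X,Y},m_{X,Y})$ is the valuation of $X\to Y$, and *additive* if equality holds for all $Y\in\Theta$. The component $\Theta$ is *$\alpha_K$-split* if the sequence $\alpha_K^*(\mathfrak E_M\otimes_k K)$ of $\mathfrak A_{p,K}$-modules splits for every $M\in\Theta$, and *regular* if for every $M\in\Theta$ the middle term of $\mathfrak E_M$ has no non-zero projective direct summand. **Theorem.** Let $\Theta\subseteq\Gamma_s(\mathcal G)$ be a component and let $\alpha_K$ be a $\pi$-point such that $\Theta$ is $\alpha_K$-split. Then: 1. For every $i\in\{1,\dots,p-1\}$ the map $\alpha_{K,i}:\Theta\to\mathbb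 N_0$, $M\mapsto\alpha_{K,i}(M)$, is an additive function with $\alpha_{K,i}\circ\tau_{\mathcal G}=\alpha_{K,i}$. 2. The map $\alpha_{K,<p}:\Theta\to\mathbb N_0$, $M\mapsto\dim_kM-p\,\alpha_{K,p}(M)$, is well defined (its values are non-negative), and it is an additive function with $\alpha_{K,<p}\circ\tau_{\mathcal G}=\alpha_{K,<p}$. 3. The map $\alpha_{K,p}:\Theta\to\mathbb N_0$, $M\mapsto\alpha_{K,p}(M)$, is subadditive, and it is additive if and only if $\Theta$ is regular. -/

import Mathlib

open scoped TensorProduct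

universe u v w

namespace FinGrpAR

/-! ## Direct summands, multiplicities, indecomposable modules -/

section Summands

variable (R : Type*) [Ring R]

/-- `X ∣ Y`: the module `X` is isomorphic to a direct summand of `Y`. -/
def IsSummand (X Y : Type*) [AddCommGroup X] [Module R X] [AddCommGroup Y] [Module R Y] : Prop :=
  ∃ (i : X →ₗ[R] Y) (r : Y →ₗ[R] X), r ∘ₗ i = LinearMap.id

/-- The multiplicity of `X` as a direct summand of `Y`: the largest `n` such that `X ^ n ∣ Y`.
For a nonzero module `X` and a module `Y` of finite length the set below is bounded, and for `X`
indecomposable this is the number of summands isomorphic to `X` in a Krull-Remak-Schmidt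
decomposition of `Y`. -/
noncomputable def summandMult (X Y : Type*) [AddCommGroup X] [Module R X] [AddCommGroup Y]
    [Module R Y] : ℕ :=
  sSup {n : ℕ | IsSummand R (Fin n → X) Y}

/-- `M` is nonzero and not the direct sum of two nonzero submodules. -/
def IsIndecomposable (M : Type*) [AddCommGroup M] [Module R M] : Prop :=
  Nontrivial M ∧ ∀ P Q : Submodule R M, IsCompl P Q → P = ⊥ ∨ Q = ⊥

theorem IsSummand.of_equiv {X Y Y' : Type*} [AddCommGroup X] [Module R X] [AddCommGroup Y]
    [Module R Y] [AddCommGroup Y'] [Module R Y'] (e : Y ≃ₗ[R] Y') (h : IsSummand R X Y) :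
    IsSummand R X Y' := by
  obtain ⟨i, r, hir⟩ := h
  refine ⟨e.toLinearMap ∘ₗ i, r ∘ₗ e.symm.toLinearMap, ?_⟩
  ext x
  simpa using LinearMap.congr_fun hir x

theorem summandMult_congr (X : Type*) {Y Y' : Type*} [AddCommGroup X] [Module R X]
    [AddCommGroup Y] [Module R Y] [AddCommGroup Y'] [Module R Y'] (e : Y ≃ₗ[R] Y') :
    summandMult R X Y = summandMult R X Y' := by
  unfold summandMult
  congr 1
  ext n
  exact ⟨IsSummand.of_equiv R e, IsSummand.of_equiv R e.symm⟩

end Summands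

/-! ## Finite-dimensional modules and almost split sequences -/

/-- A finite-dimensional module over the `k`-algebra `A`. If `A` is the algebra of measures of a
finite group scheme `𝒢`, these are the finite-dimensional `𝒢`-modules. -/
structure FDMod (k A : Type u) [Field k] [Ring A] [Algebra k A] where
  carrier : Type u
  [addCommGroup : AddCommGroup carrier]
  [moduleBase : Module k carrier]
  [module : Module A carrier]
  [isScalarTower : IsScalarTower k A carrier]
  [finite : Module.Finite k carrier]

namespace FDMod

variable {k A : Type u} [Field k] [Ring A] [Algebra k A]

instance : CoeSort (FDMod k A) (Type u) := ⟨FDMod.carrier⟩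

attribute [instance] FDMod.addCommGroup FDMod.moduleBase FDMod.module FDMod.isScalarTower
  FDMod.finite

end FDMod

section AlmostSplit

variable {k A : Type u} [Field k] [Ring A] [Algebra k A]

/-- `g : E → M` is right almost split in the category of finite-dimensional modules: it is not a
split epimorphism, and every `h : X → M` that is not a split epimorphism factors through `g`. -/
def IsRightAlmostSplit {E M : FDMod k A} (g : E →ₗ[A] M) : Prop :=
  (¬ ∃ s : M →ₗ[A] E, g ∘ₗ s = LinearMap.id) ∧
    ∀ (X : FDMod k A) (h : X →ₗ[A] M), (¬ ∃ s : M →ₗ[A] X, h ∘ₗ s = LinearMap.id) →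
      ∃ h' : X →ₗ[A] E, g ∘ₗ h' = h

/-- `f : N → E` is left almost split in the category of finite-dimensional modules: it is not a
split monomorphism, and every `h : N → Y` that is not a split monomorphism factors through `f`. -/
def IsLeftAlmostSplit {N E : FDMod k A} (f : N →ₗ[A] E) : Prop :=
  (¬ ∃ r : E →ₗ[A] N, r ∘ₗ f = LinearMap.id) ∧
    ∀ (Y : FDMod k A) (h : N →ₗ[A] Y), (¬ ∃ r : Y →ₗ[A] N, r ∘ₗ h = LinearMap.id) →
      ∃ h' : E →ₗ[A] Y, h' ∘ₗ f = h

/-- `0 ⟶ N ⟶ E ⟶ M ⟶ 0` is an almost split sequence. -/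
structure IsAlmostSplitSeq {N E M : FDMod k A} (f : N →ₗ[A] E) (g : E →ₗ[A] M) : Prop where
  injective : Function.Injective f
  exact : Function.Exact f g
  surjective : Function.Surjective g
  left : IsLeftAlmostSplit f
  right : IsRightAlmostSplit g

end AlmostSplit

/-! ## Valued translation quivers and (sub)additive functions -/

section Quiver

variable {V : Type*}

/-- The predecessors `y⁻` of `y`; there is an arrow `x → y` if both entries of `ν (x, y)` are
positive. -/
def preds (ν : V → V → ℕ × ℕ) (y : V) : Set V := {x | 0 < (ν x y).1 ∧ 0 < (ν x y).2}

/-- `f(y) + f(τ(y)) ≥ ∑_{x ∈ y⁻} f(x) pr₁(ν(x,y))` for every vertex `y`. -/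
def IsSubadditive (ν : V → V → ℕ × ℕ) (τ : V → V) (f : V → ℕ) : Prop :=
  ∀ y, ∑ᶠ x ∈ preds ν y, f x * (ν x y).1 ≤ f y + f (τ y)

/-- `f(y) + f(τ(y)) = ∑_{x ∈ y⁻} f(x) pr₁(ν(x,y))` for every vertex `y`. -/
def IsAdditive (ν : V → V → ℕ × ℕ) (τ : V → V) (f : V → ℕ) : Prop :=
  ∀ y, f y + f (τ y) = ∑ᶠ x ∈ preds ν y, f x * (ν x y).1

end Quiver

/-! ## The stable Auslander-Reiten quiver -/

section ARQuiver

variable (k A : Type u) [Field k] [Ring A] [Algebra k A]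

/-- The non-projective indecomposable finite-dimensional `A`-modules. -/
def StableInd : Type (u + 1) :=
  {M : FDMod k A // IsIndecomposable A M ∧ ¬ Module.Projective A M}

/-- Isomorphism of modules. -/
instance stableIndSetoid : Setoid (StableInd k A) where
  r M N := Nonempty (M.1 ≃ₗ[A] N.1)
  iseqv :=
    { refl := fun _ => ⟨LinearEquiv.refl _ _⟩
      symm := fun ⟨e⟩ => ⟨e.symm⟩
      trans := fun ⟨e⟩ ⟨e'⟩ => ⟨e.trans e'⟩ }

/-- The vertices of the stable Auslander-Reiten quiver: the isomorphism classes of non-projective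
indecomposable finite-dimensional modules. -/
def StableVertex : Type (u + 1) := Quotient (stableIndSetoid k A)

variable {k A}

/-- The vertex given by the isomorphism class of `M`. -/
def StableInd.cls (M : StableInd k A) : StableVertex k A := Quotient.mk _ M

/-- The valuation of the stable Auslander-Reiten quiver: `ν(x, y) = (m, m)`, where `m` is the
multiplicity of `x` in the middle term of the almost split sequence terminating in `y`. As that
sequence is unique up to isomorphism, the set below is independent of all choices. -/
noncomputable def arVal (x y : StableVertex k A) : ℕ × ℕ :=
  let m : ℕ := sSup {n : ℕ | ∃ (X Y : StableInd k A) (N E : FDMod k A) (f : N →ₗ[A] E)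
    (g : E →ₗ[A] Y.1), X.cls = x ∧ Y.cls = y ∧ IsAlmostSplitSeq f g ∧
      IsSummand A (Fin n → X.1) E}
  (m, m)

/-- `x` is the initial term of an almost split sequence terminating in `y`. -/
def IsARTranslate (x y : StableVertex k A) : Prop :=
  ∃ (X Y : StableInd k A) (E : FDMod k A) (f : X.1 →ₗ[A] E) (g : E →ₗ[A] Y.1),
    X.cls = x ∧ Y.cls = y ∧ IsAlmostSplitSeq f g

/-- The Auslander-Reiten translation: `τ(y)` is the initial term of the almost split sequence
terminating in `y`. -/
noncomputable def arTau (y : StableVertex k A) : StableVertex k A :=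
  @Classical.epsilon _ ⟨y⟩ fun x => IsARTranslate x y

/-- The relation generating the components: arrows, and the passage from `y` to `τ(y)`. -/
def ARStep (x y : StableVertex k A) : Prop := x ∈ preds arVal y ∨ x = arTau y

variable (k A) in
/-- The connected components of the stable Auslander-Reiten quiver, as a stable translation
quiver: the classes of the equivalence relation generated by `ARStep`. -/
def ARComponent : Type (u + 1) := Quot (ARStep (k := k) (A := A))

namespace ARComponent

variable (Θ : ARComponent k A)

/-- The vertices of a component. -/
def Vertex : Type (u + 1) := {x : StableVertex k A // Quot.mk ARStep x = Θ}

/-- The valuation of a component. -/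
noncomputable def val (x y : Θ.Vertex) : ℕ × ℕ := arVal x.1 y.1

/-- The translation of a component. -/
noncomputable def tau (y : Θ.Vertex) : Θ.Vertex :=
  ⟨arTau y.1, (Quot.sound (show ARStep (arTau y.1) y.1 from Or.inr rfl)).trans y.2⟩

/-- `M` represents a vertex of the component. -/
def Mem (M : StableInd k A) : Prop := Quot.mk ARStep M.cls = Θ

/-- A component is regular if the middle terms of the almost split sequences terminating in its
vertices have no nonzero projective summands. -/
def IsRegular : Prop :=
  ∀ (M : StableInd k A), Θ.Mem M → ∀ (N E : FDMod k A) (f : N →ₗ[A] E) (g : E →ₗ[A] M.1),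
    IsAlmostSplitSeq f g →
      ∀ P : FDMod k A, Module.Projective A P → IsSummand A P E → Subsingleton P

/-- The dimension of the modules belonging to a vertex. -/
noncomputable def dim (x : Θ.Vertex) : ℕ :=
  Quotient.lift (s := stableIndSetoid k A) (fun M : StableInd k A => Module.finrank k M.1)
    (fun _ _ h => Nonempty.elim h fun e => (e.restrictScalars k).finrank_eq) x.1

end ARComponent

end ARQuiver

/-! ## Pull-back and extension of scalars of modules -/

section Pullback

variable {R S : Type*} [Ring R] [Ring S]

/-- The `R`-module obtained from the `S`-module `N` by pull-back along `φ : R → S`. -/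
def Pullback (_φ : R →+* S) (N : Type*) : Type _ := N

variable (φ : R →+* S)

instance (N : Type*) [AddCommGroup N] : AddCommGroup (Pullback φ N) :=
  inferInstanceAs (AddCommGroup N)

instance (N : Type*) [AddCommGroup N] [Module S N] : Module R (Pullback φ N) :=
  Module.compHom N φ

/-- The pull-back of a linear map. -/
def Pullback.map {N N' : Type*} [AddCommGroup N] [Module S N] [AddCommGroup N'] [Module S N']
    (f : N →ₗ[S] N') : Pullback φ N →ₗ[R] Pullback φ N' where
  toFun := fun x => f (show N from x)
  map_add' := fun x y => f.map_add (show N from x) (show N from y)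
  map_smul' := fun r x => f.map_smul (φ r) (show N from x)

end Pullback

section ScalarExtension

variable {k A : Type u} [Field k] [Ring A] [Algebra k A]
variable (K : Type w) [Field K] [Algebra k K]

/-- The `K`-vector space `M_K = K ⊗ M`, to be viewed as a module over `K ⊗ A`. -/
def FDMod.Ext (M : FDMod k A) : Type (max w u) := K ⊗[k] M

noncomputable instance (M : FDMod k A) : AddCommGroup (M.Ext K) :=
  inferInstanceAs (AddCommGroup (K ⊗[k] M))

/-- The action of `K ⊗ A` on `K ⊗ M`, given by `(c ⊗ a) (d ⊗ m) = cd ⊗ am`. -/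
noncomputable def FDMod.extAction (M : FDMod k A) :
    K ⊗[k] A →ₐ[K] Module.End K (K ⊗[k] M) :=
  Algebra.TensorProduct.lift (Algebra.ofId K _)
    ((Module.End.baseChangeHom k K M).comp (Algebra.lsmul k k M))
    (fun c _ => Algebra.commutes c _)

noncomputable instance (M : FDMod k A) : Module (K ⊗[k] A) (M.Ext K) :=
  Module.compHom (K ⊗[k] M) (M.extAction K).toRingHom

theorem FDMod.ext_smul_tmul (M : FDMod k A) (c d : K) (a : A) (m : M) :
    ((c ⊗ₜ[k] a : K ⊗[k] A) • (show M.Ext K from d ⊗ₜ[k] m)) =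
      (show M.Ext K from (c * d) ⊗ₜ[k] (a • m)) := by
  change M.extAction K (c ⊗ₜ[k] a) (d ⊗ₜ[k] m) = _
  change c • (LinearMap.baseChange K _ (d ⊗ₜ[k] m)) = _
  rw [LinearMap.baseChange_tmul, TensorProduct.smul_tmul', smul_eq_mul]
  rfl

/-- The `K ⊗ A`-linear map `f_K = id ⊗ f : M_K → N_K` induced by `f : M → N`. -/
noncomputable def FDMod.extMap {M N : FDMod k A} (f : M →ₗ[A] N) :
    M.Ext K →ₗ[K ⊗[k] A] N.Ext K where
  toFun := fun x => (f.restrictScalars k).baseChange K (show K ⊗[k] M from x)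
  map_add' := fun x y => map_add _ (show K ⊗[k] M from x) (show K ⊗[k] M from y)
  map_smul' := fun r x => by
    have key : ∀ (r : K ⊗[k] A) (x : K ⊗[k] M),
        (f.restrictScalars k).baseChange K (M.extAction K r x) =
          N.extAction K r ((f.restrictScalars k).baseChange K x) := by
      intro r x
      induction r using TensorProduct.induction_on with
      | zero => simp
      | add r s hr hs => simp only [map_add, LinearMap.add_apply, hr, hs]
      | tmul c a =>
        induction x using TensorProduct.induction_on with
        | zero => simp
        | add x y hx hy => simp only [map_add, hx, hy]
        | tmul d m =>
          have h1 : M.extAction K (c ⊗ₜ[k] a) (d ⊗ₜ[k] m) = (c * d) ⊗ₜ[k] (a • m) :=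
            M.ext_smul_tmul K c d a m
          have h2 : N.extAction K (c ⊗ₜ[k] a) (d ⊗ₜ[k] f m) = (c * d) ⊗ₜ[k] (a • f m) :=
            N.ext_smul_tmul K c d a (f m)
          rw [h1, LinearMap.baseChange_tmul, LinearMap.baseChange_tmul,
            LinearMap.restrictScalars_apply, LinearMap.restrictScalars_apply, map_smul, h2]
    exact key r x

end ScalarExtension

/-! ## `π`-points -/

section PiPoints

/-- The truncated polynomial ring `𝔄_{p,K} = K[T] / (T ^ p)`. -/
abbrev TruncPoly (p : ℕ) (K : Type w) [Field K] : Type w :=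
  Polynomial K ⧸ Ideal.span {(Polynomial.X : Polynomial K) ^ p}

/-- The `𝔄_{p,K}`-module `[i] = 𝔄_{p,K} / (t ^ i)`, where `t` is the class of `T`. For
`1 ≤ i ≤ p` it is the indecomposable `𝔄_{p,K}`-module of dimension `i`. -/
abbrev JordanBlock (p : ℕ) (K : Type w) [Field K] (i : ℕ) : Type w :=
  TruncPoly p K ⧸ Ideal.span
    {(Ideal.Quotient.mk (Ideal.span {(Polynomial.X : Polynomial K) ^ p}) Polynomial.X) ^ i}

/-- `B` is a Hopf subalgebra of the Hopf algebra `C`. If `C = K𝒢` is the algebra of measures of a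
finite group scheme `𝒢` over `K`, these are the algebras of measures `K𝒰` of the (closed)
subgroups `𝒰` of `𝒢`. -/
structure IsHopfSubalgebra {K C : Type*} [Field K] [Ring C] [HopfAlgebra K C]
    (B : Subalgebra K C) : Prop where
  comul_mem : ∀ b ∈ B, Coalgebra.comul (R := K) b ∈
    LinearMap.range (TensorProduct.map B.val.toLinearMap B.val.toLinearMap)
  antipode_mem : ∀ b ∈ B, HopfAlgebra.antipode K b ∈ B

/-- The group scheme `𝒰` with algebra of measures `B = K𝒰 ⊆ C` is unipotent: every nonzero
finite-dimensional `𝒰`-module contains a nonzero fixed vector. -/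
def IsUnipotentSub {K : Type w} {C : Type v} [Field K] [Ring C] [HopfAlgebra K C]
    (B : Subalgebra K C) : Prop :=
  ∀ (V : Type w) [AddCommGroup V] [Module K V] [Module B V] [IsScalarTower K B V]
    [Module.Finite K V] [Nontrivial V],
    ∃ x : V, x ≠ 0 ∧ ∀ b : B, b • x = Coalgebra.counit (R := K) (b : C) • x

/-- A `π`-point of the finite group scheme over `k` with algebra of measures `A`, defined over the
extension field `K`: a left flat homomorphism `𝔄_{p,K} → K ⊗ A` of `K`-algebras whose image lies
in `K𝒰` for some abelian unipotent subgroup `𝒰` of `𝒢_K`. -/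
structure PiPoint (p : ℕ) (K : Type w) (k A : Type u) [Field k] [Ring A] [HopfAlgebra k A]
    [Field K] [Algebra k K] where
  toAlgHom : TruncPoly p K →ₐ[K] K ⊗[k] A
  flat : Module.Flat (TruncPoly p K) (Pullback toAlgHom.toRingHom (K ⊗[k] A))
  exists_subgroup : ∃ B : Subalgebra K (K ⊗[k] A), IsHopfSubalgebra B ∧
    (∀ x ∈ B, ∀ y ∈ B, x * y = y * x) ∧ IsUnipotentSub B ∧ toAlgHom.range ≤ B

namespace PiPoint

variable {p : ℕ} {K : Type w} {k A : Type u} [Field k] [Ring A] [HopfAlgebra k A]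
  [Field K] [Algebra k K] (α : PiPoint p K k A)

/-- The `𝔄_{p,K}`-module `α_K^*(M_K)`. -/
abbrev Pull (M : FDMod k A) : Type (max w u) := Pullback α.toAlgHom.toRingHom (M.Ext K)

/-- The `𝔄_{p,K}`-linear map `α_K^*(f_K)`. -/
noncomputable def pullMap {M N : FDMod k A} (f : M →ₗ[A] N) :
    α.Pull M →ₗ[TruncPoly p K] α.Pull N :=
  Pullback.map α.toAlgHom.toRingHom (FDMod.extMap K f)

/-- `α_{K,i}(M)`: the multiplicity of the Jordan block `[i]` in `α_K^*(M_K)`. -/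
noncomputable def jordanMult (i : ℕ) (M : FDMod k A) : ℕ :=
  summandMult (TruncPoly p K) (JordanBlock p K i) (α.Pull M)

theorem pullMap_id_comp {M N : FDMod k A} (f : M →ₗ[A] N) (g : N →ₗ[A] M)
    (h : g ∘ₗ f = LinearMap.id) : α.pullMap g ∘ₗ α.pullMap f = LinearMap.id := by
  ext x
  change (g.restrictScalars k).baseChange K
    ((f.restrictScalars k).baseChange K (show K ⊗[k] M from x)) = (show K ⊗[k] M from x)
  rw [← LinearMap.comp_apply, ← LinearMap.baseChange_comp]
  have : g.restrictScalars k ∘ₗ f.restrictScalars k = LinearMap.id := by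
    ext m
    exact LinearMap.congr_fun h m
  rw [this, LinearMap.baseChange_id, LinearMap.id_apply]

theorem jordanMult_congr (i : ℕ) {M N : FDMod k A} (e : M ≃ₗ[A] N) :
    α.jordanMult i M = α.jordanMult i N := by
  refine summandMult_congr _ _ (LinearEquiv.ofLinearMap (α.pullMap e.toLinearMap)
    (α.pullMap e.symm.toLinearMap) ?_ ?_)
  · exact α.pullMap_id_comp _ _ (by ext; simp)
  · exact α.pullMap_id_comp _ _ (by ext; simp)

/-- `α_{K,i}` as a function on the vertices of a component. -/
noncomputable def jordanMultOn (Θ : ARComponent k A) (i : ℕ) (x : Θ.Vertex) : ℕ :=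
  Quotient.lift (s := stableIndSetoid k A) (fun M : StableInd k A => α.jordanMult i M.1)
    (fun _ _ h => Nonempty.elim h fun e => α.jordanMult_congr i e) x.1

/-- `Θ` is `α_K`-split: for every `M` in `Θ`, the sequence `α_K^*(𝔈_M ⊗ K)` splits, where `𝔈_M` is
the almost split sequence terminating in `M`. -/
def IsSplitOn (Θ : ARComponent k A) : Prop :=
  ∀ M : StableInd k A, Θ.Mem M → ∀ (N E : FDMod k A) (f : N →ₗ[A] E) (g : E →ₗ[A] M.1),
    IsAlmostSplitSeq f g →
      ∃ s : α.Pull M.1 →ₗ[TruncPoly p K] α.Pull E, α.pullMap g ∘ₗ s = LinearMap.id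

end PiPoint

end PiPoints

end FinGrpAR

/-!
The theorem compares the two ends of an almost split sequence `0 ⟶ N ⟶ E ⟶ M ⟶ 0` after pull-back
along the `π`-point, and then counts Jordan blocks in the middle term.

*The two ends.* The algebra of measures `A` is a finite-dimensional Hopf algebra, hence a Frobenius
algebra; for cocommutative `A` a nonzero integral on `A` is a Frobenius form whose Nakayama
automorphism `σ` is the twist by a character `χ : A → k` (`exists_frobeniusForm`). For a Frobenius
algebra the almost split sequence terminating in `M` exists, and its initial term `N` is, up to
projective direct summands, the second syzygy of `M` twisted by `σ`
(`FrobeniusForm.exists_isRightAlmostSplit`, `FrobeniusForm.exists_equiv_prod_projective`). The image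
of a `π`-point lies in the algebra of measures of a unipotent subgroup, where `χ` is trivial and
which is therefore fixed by `id ⊗ σ` (`baseChange_characterTwist_eq_self`), so the pull-back does
not see the twist. Flatness of the `π`-point makes pull-backs of projective modules projective over
`K[T] / (T ^ p)`, so the pull-back of `N` is, up to projective summands, a second syzygy of that of
`M`. Over `K[T] / (T ^ p)` every module is its own second syzygy
(`IsTruncVar.nonempty_equiv_ker_diffVar`), and only `[p]` is projective among the Jordan blocks.
Hence `N` and `M` have the same number of blocks `[i]` for `i < p`, and the same value of
`dim - p α_p` (`PiPoint.jordanMult_initial_eq`).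

*The middle term.* As the pulled back sequence splits, `α_i(E) = α_i(M) + α_i(N)`. On the other
hand, multiplicities, like dimensions, are additive on direct sums by the Krull-Remak-Schmidt
theorem, so the value on `E` is the sum over the predecessors of the vertex of `M`, weighted by the
valuation, plus the value on a projective summand `P` of `E` (`exists_projective_summand_finsum`). On `P` the
functions `α_i`, `i < p`, and `dim - p α_p` vanish, while `p α_p(P) = dim P`. This gives additivity
for the former. The function `α_p` fails to be additive at a vertex by `α_p(P)`, which is zero if
and only if `P = 0`, that is, if and only if `E` has no nonzero projective summand.
-/

namespace FinGrpAR

/-! ### Direct summands and local endomorphism rings -/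

section Summands

variable {R : Type*} [Ring R]
variable {X : Type*} [AddCommGroup X] [Module R X]
variable {Y : Type*} [AddCommGroup Y] [Module R Y]
variable {Z : Type*} [AddCommGroup Z] [Module R Z]
variable {W : Type*} [AddCommGroup W] [Module R W]

theorem IsSummand.trans (h : IsSummand R X Y) (h' : IsSummand R Y Z) : IsSummand R X Z := by
  obtain ⟨i, r, hir⟩ := h
  obtain ⟨j, s, hjs⟩ := h'
  refine ⟨j ∘ₗ i, r ∘ₗ s, ?_⟩
  ext x
  have h1 := LinearMap.congr_fun hjs (i x)
  have h2 := LinearMap.congr_fun hir x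
  simp only [LinearMap.comp_apply, LinearMap.id_apply] at h1 h2 ⊢
  rw [h1, h2]

theorem _root_.LinearEquiv.isSummand (e : X ≃ₗ[R] Y) : IsSummand R X Y :=
  ⟨e.toLinearMap, e.symm.toLinearMap, by ext x; simp⟩

theorem IsSummand.prodMap (h : IsSummand R X Y) (h' : IsSummand R Z W) :
    IsSummand R (X × Z) (Y × W) := by
  obtain ⟨i, r, hir⟩ := h
  obtain ⟨j, s, hjs⟩ := h'
  refine ⟨i.prodMap j, r.prodMap s, ?_⟩
  rw [LinearMap.prodMap_comp, hir, hjs, LinearMap.prodMap_id]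

theorem isSummand_prod_left (h : IsSummand R X Y) : IsSummand R X (Y × Z) :=
  h.trans ⟨LinearMap.inl R Y Z, LinearMap.fst R Y Z, by ext; rfl⟩

/-- A retraction `r` of `i : X → Y` decomposes `Y` as `X × ker r`. -/
def splitEquiv (i : X →ₗ[R] Y) (r : Y →ₗ[R] X) (h : r ∘ₗ i = LinearMap.id) :
    Y ≃ₗ[R] X × LinearMap.ker r where
  toFun y := (r y, ⟨y - i (r y), by
    have := LinearMap.congr_fun h (r y)
    simp only [LinearMap.comp_apply, LinearMap.id_apply] at this
    simp [this]⟩)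
  map_add' x y := by ext <;> simp; abel
  map_smul' c x := by ext <;> simp [smul_sub]
  invFun z := i z.1 + z.2
  left_inv y := by simp
  right_inv z := by
    have := LinearMap.congr_fun h z.1
    simp only [LinearMap.comp_apply, LinearMap.id_apply] at this
    have h2 : r (z.2 : Y) = 0 := z.2.2
    ext <;> simp [this, h2]

theorem IsSummand.exists_equiv (h : IsSummand R X Y) :
    ∃ Z : Submodule R Y, Nonempty (Y ≃ₗ[R] X × Z) := by
  obtain ⟨i, r, hir⟩ := h
  exact ⟨_, ⟨splitEquiv i r hir⟩⟩

theorem projective_of_isSummand [Module.Projective R Y] (h : IsSummand R X Y) :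
    Module.Projective R X := by
  obtain ⟨i, r, hir⟩ := h
  exact Module.Projective.of_split i r hir

/-- One-sided inverses in a local ring are two-sided. -/
theorem isUnit_of_mul_eq_one_of_isLocalRing {S : Type*} [Ring S] [IsLocalRing S] {a b : S}
    (h : a * b = 1) : IsUnit a ∧ IsUnit b := by
  have hid : (b * a) * (b * a) = b * a := by
    rw [mul_assoc, ← mul_assoc a, h, one_mul]
  have hba : b * a = 1 := by
    rcases IsLocalRing.isUnit_or_isUnit_of_add_one (a := b * a) (b := 1 - b * a)
      (by abel) with hu | hu
    · exact hu.mul_left_cancel (by rw [hid, mul_one])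
    · have h0 : b * a = 0 := hu.mul_left_cancel (by rw [sub_mul, hid, one_mul, sub_self, mul_zero])
      exfalso
      have : (1 : S) = 0 := by
        calc (1 : S) = a * (b * a) * b := by rw [← mul_assoc, h, one_mul, h]
          _ = 0 := by rw [h0, mul_zero, zero_mul]
      exact one_ne_zero this
  exact ⟨⟨⟨a, b, h, hba⟩, rfl⟩, ⟨⟨b, a, hba, h⟩, rfl⟩⟩

theorem isSummand_of_isUnit_comp (i : X →ₗ[R] Y) (r : Y →ₗ[R] X)
    (h : IsUnit (r ∘ₗ i : Module.End R X)) : IsSummand R X Y := by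
  obtain ⟨u, hu⟩ := h
  refine ⟨i, (↑u⁻¹ : Module.End R X) ∘ₗ r, ?_⟩
  rw [LinearMap.comp_assoc, ← hu]
  exact u.inv_mul

theorem IsSummand.prod_or (hX : IsLocalRing (Module.End R X)) (h : IsSummand R X (Y × Z)) :
    IsSummand R X Y ∨ IsSummand R X Z := by
  obtain ⟨i, r, hir⟩ := h
  have h1 : ((r ∘ₗ LinearMap.inl R Y Z) ∘ₗ (LinearMap.fst R Y Z ∘ₗ i) : Module.End R X) +
      ((r ∘ₗ LinearMap.inr R Y Z) ∘ₗ (LinearMap.snd R Y Z ∘ₗ i)) = 1 := by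
    ext x
    have := LinearMap.congr_fun hir x
    simp only [LinearMap.comp_apply, LinearMap.id_apply] at this
    simp only [LinearMap.add_apply, LinearMap.comp_apply, LinearMap.inl_apply,
      LinearMap.inr_apply, LinearMap.fst_apply, LinearMap.snd_apply, Module.End.one_apply,
      ← map_add, Prod.mk_add_mk, add_zero, zero_add, this]
  rcases IsLocalRing.isUnit_or_isUnit_of_add_one h1 with h | h
  · exact Or.inl (isSummand_of_isUnit_comp _ _ h)
  · exact Or.inr (isSummand_of_isUnit_comp _ _ h)

/-- Cancellation when the diagonal block `X → X` of the isomorphism is invertible: the Schur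
complement is an isomorphism `Y → Z`. -/
theorem nonempty_equiv_of_isUnit_block (e : (X × Y) ≃ₗ[R] (X × Z))
    (h : IsUnit (LinearMap.fst R X Z ∘ₗ e.toLinearMap ∘ₗ LinearMap.inl R X Y : Module.End R X)) :
    Nonempty (Y ≃ₗ[R] Z) := by
  obtain ⟨u, hu⟩ := h
  set v : Module.End R X := ((u⁻¹ : (Module.End R X)ˣ) : Module.End R X) with hv
  have huv : ∀ x, (e (v x, 0)).1 = x := by
    intro x
    have := LinearMap.congr_fun u.mul_inv x
    rw [hu] at this
    simpa using this
  have hvu : ∀ x, v (e (x, 0)).1 = x := by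
    intro x
    have := LinearMap.congr_fun u.inv_mul x
    rw [hu] at this
    simpa using this
  -- The Schur complement sends `y` to the second entry of `e (-v b y, y)`, whose first entry is 0.
  have key1 : ∀ y, (e (-v (e (0, y)).1, y)).1 = 0 := by
    intro y
    have : ((-v (e (0, y)).1, y) : X × Y) = (0, y) - (v (e (0, y)).1, 0) := by ext <;> simp
    rw [this, map_sub, Prod.fst_sub, huv, sub_self]
  refine ⟨LinearEquiv.ofLinearMap
    (LinearMap.snd R X Z ∘ₗ e.toLinearMap ∘ₗ
      ((-(v ∘ₗ LinearMap.fst R X Z ∘ₗ e.toLinearMap ∘ₗ LinearMap.inr R X Y)).prod LinearMap.id))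
    (LinearMap.snd R X Y ∘ₗ e.symm.toLinearMap ∘ₗ LinearMap.inr R X Z) ?_ ?_⟩
  · ext z
    simp only [LinearMap.comp_apply, LinearMap.prod_apply, Function.prod_apply, LinearMap.neg_apply,
      LinearMap.snd_apply, LinearMap.fst_apply, LinearMap.inr_apply, LinearMap.id_apply,
      LinearEquiv.coe_coe]
    have hz : e (e.symm (0, z)) = (0, z) := e.apply_symm_apply _
    set x := (e.symm (0, z)).1
    set y := (e.symm (0, z)).2
    have hxy : e.symm (0, z) = (x, y) := rfl
    have h2 : (e (0, y)).1 = - (e (x, 0)).1 := by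
      have : ((0, y) : X × Y) = (x, y) - (x, 0) := by ext <;> simp
      rw [this, map_sub, ← hxy, hz]; simp
    rw [h2, map_neg, neg_neg, hvu, ← hxy, hz]
  · ext y
    simp only [LinearMap.comp_apply, LinearMap.prod_apply, Function.prod_apply, LinearMap.neg_apply,
      LinearMap.snd_apply, LinearMap.fst_apply, LinearMap.inr_apply, LinearMap.id_apply,
      LinearEquiv.coe_coe]
    have : ((0, (e (-v (e (0, y)).1, y)).2) : X × Z) = e (-v (e (0, y)).1, y) := by
      ext
      · exact (key1 y).symm
      · rfl
    rw [this, e.symm_apply_apply]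

/-- Cancellation of a module with local endomorphism ring. -/
theorem nonempty_equiv_of_prod_equiv (hX : IsLocalRing (Module.End R X))
    (e : (X × Y) ≃ₗ[R] (X × Z)) : Nonempty (Y ≃ₗ[R] Z) := by
  by_cases ha : IsUnit (LinearMap.fst R X Z ∘ₗ e.toLinearMap ∘ₗ LinearMap.inl R X Y :
    Module.End R X)
  · exact nonempty_equiv_of_isUnit_block e ha
  -- A shear of `X × Z` makes the diagonal block of `e` invertible.
  let β : Z →ₗ[R] X := LinearMap.fst R X Y ∘ₗ e.symm.toLinearMap ∘ₗ LinearMap.inr R X Z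
  let α : X →ₗ[R] X := LinearMap.fst R X Y ∘ₗ e.symm.toLinearMap ∘ₗ LinearMap.inl R X Z
  let a : Module.End R X := LinearMap.fst R X Z ∘ₗ e.toLinearMap ∘ₗ LinearMap.inl R X Y
  let c : X →ₗ[R] Z := LinearMap.snd R X Z ∘ₗ e.toLinearMap ∘ₗ LinearMap.inl R X Y
  have hsum : (α * a : Module.End R X) + β ∘ₗ c = 1 := by
    ext x
    have h1 : ((((e (x, 0)).1, 0) : X × Z) + (0, (e (x, 0)).2)) = e (x, 0) := by ext <;> simp
    change (e.symm ((e (x, 0)).1, 0)).1 + (e.symm (0, (e (x, 0)).2)).1 = x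
    rw [← Prod.fst_add, ← map_add, h1, e.symm_apply_apply]
  have hβc : IsUnit (β ∘ₗ c : Module.End R X) := by
    rcases IsLocalRing.isUnit_or_isUnit_of_add_one hsum with h | h
    · exfalso
      obtain ⟨u, hu⟩ := h
      have : (↑u⁻¹ * α) * a = 1 := by rw [mul_assoc, ← hu, Units.inv_mul]
      exact ha (isUnit_of_mul_eq_one_of_isLocalRing this).2
    · exact h
  have hunit : IsUnit (a + β ∘ₗ c : Module.End R X) := by
    have : IsUnit ((a + β ∘ₗ c) + (-a) : Module.End R X) := by
      rwa [add_neg_cancel_comm]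
    rcases IsLocalRing.isUnit_or_isUnit_of_isUnit_add this with h | h
    · exact h
    · exact absurd (IsUnit.neg_iff a |>.1 h) ha
  let s : (X × Z) ≃ₗ[R] (X × Z) := LinearEquiv.ofLinearMap
    ((LinearMap.fst R X Z + β ∘ₗ LinearMap.snd R X Z).prod (LinearMap.snd R X Z))
    ((LinearMap.fst R X Z - β ∘ₗ LinearMap.snd R X Z).prod (LinearMap.snd R X Z))
    (by ext <;> simp) (by ext <;> simp)
  exact nonempty_equiv_of_isUnit_block (e.trans s) hunit

theorem isSummand_fin_zero : IsSummand R (Fin 0 → X) Y :=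
  ⟨0, 0, LinearMap.ext fun _ => Subsingleton.elim _ _⟩

theorem IsSummand.cons {n : ℕ} (h : IsSummand R (Fin n → X) Y) :
    IsSummand R (Fin (n + 1) → X) (X × Y) :=
  (Fin.consLinearEquiv R fun _ => X).symm.isSummand.trans
    ((LinearEquiv.refl R X).isSummand.prodMap h)

/-- A power of a module with local endomorphism ring that divides `Y × Z` distributes over the two
factors. -/
theorem IsSummand.exists_add_eq (hX : IsLocalRing (Module.End R X)) :
    ∀ (n : ℕ) {Y : Type v} {Z : Type w} [AddCommGroup Y] [Module R Y] [AddCommGroup Z]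
      [Module R Z], IsSummand R (Fin n → X) (Y × Z) →
      ∃ a b, a + b = n ∧ IsSummand R (Fin a → X) Y ∧ IsSummand R (Fin b → X) Z := by
  intro n
  induction n with
  | zero => exact fun _ => ⟨0, 0, rfl, isSummand_fin_zero, isSummand_fin_zero⟩
  | succ n ih =>
    intro Y Z _ _ _ _ h
    have e0 : (Fin (n + 1) → X) ≃ₗ[R] X × (Fin n → X) := (Fin.consLinearEquiv R fun _ => X).symm
    have hX1 : IsSummand R X (Y × Z) :=
      (isSummand_prod_left (LinearEquiv.refl R X).isSummand).trans
        (e0.symm.isSummand.trans h)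
    obtain ⟨C, ⟨eC⟩⟩ := h.exists_equiv
    have eC' : (Y × Z) ≃ₗ[R] X × ((Fin n → X) × C) :=
      eC.trans ((e0.prodCongr (LinearEquiv.refl R C)).trans
        (LinearEquiv.prodAssoc R X (Fin n → X) C))
    rcases hX1.prod_or hX with hY | hZ
    · obtain ⟨Y', ⟨eY⟩⟩ := hY.exists_equiv
      obtain ⟨e⟩ := nonempty_equiv_of_prod_equiv hX
        (eC'.symm.trans ((eY.prodCongr (LinearEquiv.refl R Z)).trans
          (LinearEquiv.prodAssoc R X Y' Z)))
      obtain ⟨a, b, hab, ha, hb⟩ := ih (IsSummand.of_equiv R e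
        (isSummand_prod_left (LinearEquiv.refl R _).isSummand))
      exact ⟨a + 1, b, by omega, ha.cons.of_equiv R eY.symm, hb⟩
    · obtain ⟨Z', ⟨eZ⟩⟩ := hZ.exists_equiv
      obtain ⟨e⟩ := nonempty_equiv_of_prod_equiv hX
        (eC'.symm.trans (((LinearEquiv.refl R Y).prodCongr eZ).trans
          ((LinearEquiv.prodAssoc R Y X Z').symm.trans
            (((LinearEquiv.prodComm R Y X).prodCongr (LinearEquiv.refl R Z')).trans
              (LinearEquiv.prodAssoc R X Y Z')))))
      obtain ⟨a, b, hab, ha, hb⟩ := ih (IsSummand.of_equiv R e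
        (isSummand_prod_left (LinearEquiv.refl R _).isSummand))
      exact ⟨a, b + 1, by omega, ha, hb.cons.of_equiv R eZ.symm⟩

end Summands

/-! ### Multiplicities of modules that are finite-dimensional over a field -/

section Multiplicities

variable (F : Type*) [Field F] {R : Type*} [Ring R] [Algebra F R]
variable {X : Type*} [AddCommGroup X] [Module F X] [Module R X] [IsScalarTower F R X]
  [Module.Finite F X]
variable {Y : Type v} [AddCommGroup Y] [Module F Y] [Module R Y] [IsScalarTower F R Y]
  [Module.Finite F Y]
variable {Z : Type w} [AddCommGroup Z] [Module F Z] [Module R Z] [IsScalarTower F R Z]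
  [Module.Finite F Z]

include F in
/-- Fitting's lemma: an endomorphism of an indecomposable module is bijective or nilpotent. -/
theorem IsIndecomposable.isLocalRing_end (h : IsIndecomposable R X) :
    IsLocalRing (Module.End R X) := by
  have := h.1
  have : IsNoetherian R X := isNoetherian_of_tower F inferInstance
  have : IsArtinian R X := isArtinian_of_tower F inferInstance
  refine IsLocalRing.of_isUnit_or_isUnit_one_sub_self fun φ => ?_
  obtain ⟨n, hn⟩ := Filter.eventually_atTop.1 (LinearMap.eventually_isCompl_ker_pow_range_pow φ)
  have hc := hn (n + 1) (by omega)
  rcases h.2 _ _ hc with h0 | h0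
  · left
    have hinj : Function.Injective (φ ^ (n + 1)) := LinearMap.ker_eq_bot.1 h0
    have hinj' : Function.Injective φ := by
      rw [pow_succ, Module.End.mul_eq_comp] at hinj
      exact Function.Injective.of_comp hinj
    exact (Module.End.isUnit_iff φ).2
      ⟨hinj', IsArtinian.surjective_of_injective_endomorphism φ hinj'⟩
  · right
    exact IsNilpotent.isUnit_one_sub ⟨n + 1, LinearMap.range_eq_bot.1 h0⟩

omit [Module.Finite F X] in
theorem IsSummand.finrank_le (h : IsSummand R X Y) :
    Module.finrank F X ≤ Module.finrank F Y := by
  obtain ⟨i, r, hir⟩ := h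
  refine LinearMap.finrank_le_finrank_of_injective (f := i.restrictScalars F) ?_
  exact Function.LeftInverse.injective (g := r) fun x => LinearMap.congr_fun hir x

theorem IsSummand.mul_finrank_le {n : ℕ} (h : IsSummand R (Fin n → X) Y) :
    n * Module.finrank F X ≤ Module.finrank F Y := by
  have := IsSummand.finrank_le F h
  rwa [Module.finrank_pi_fintype, Finset.sum_const, Finset.card_univ, Fintype.card_fin,
    smul_eq_mul] at this

include F in
theorem bddAbove_isSummand [Nontrivial X] : BddAbove {n : ℕ | IsSummand R (Fin n → X) Y} := by
  refine ⟨Module.finrank F Y, fun n hn => ?_⟩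
  have h1 := IsSummand.mul_finrank_le F hn
  have h2 : 0 < Module.finrank F X := Module.finrank_pos
  nlinarith

include F in
theorem isSummand_summandMult [Nontrivial X] : IsSummand R (Fin (summandMult R X Y) → X) Y :=
  Nat.sSup_mem (s := {n : ℕ | IsSummand R (Fin n → X) Y}) ⟨0, isSummand_fin_zero⟩
    (bddAbove_isSummand F)

include F in
theorem le_summandMult [Nontrivial X] {n : ℕ} (h : IsSummand R (Fin n → X) Y) :
    n ≤ summandMult R X Y :=
  le_csSup (bddAbove_isSummand F) h

theorem summandMult_mul_finrank_le [Nontrivial X] :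
    summandMult R X Y * Module.finrank F X ≤ Module.finrank F Y :=
  IsSummand.mul_finrank_le F (isSummand_summandMult F)

include F in
theorem summandMult_prod (hX : IsIndecomposable R X) :
    summandMult R X (Y × Z) = summandMult R X Y + summandMult R X Z := by
  have := hX.1
  apply le_antisymm
  · obtain ⟨a, b, hab, ha, hb⟩ := IsSummand.exists_add_eq (hX.isLocalRing_end F) _
      (isSummand_summandMult F (R := R) (X := X) (Y := Y × Z))
    rw [← hab]
    exact add_le_add (le_summandMult F ha) (le_summandMult F hb)
  · apply le_summandMult F
    exact (((LinearEquiv.funCongrLeft R X finSumFinEquiv).trans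
      (LinearEquiv.sumArrowLequivProdArrow _ _ R X)).isSummand).trans
      ((isSummand_summandMult F).prodMap (isSummand_summandMult F))

include F in
theorem summandMult_pos_iff [Nontrivial X] : 0 < summandMult R X Y ↔ IsSummand R X Y := by
  have e1 : (Fin 1 → X) ≃ₗ[R] X := LinearEquiv.funUnique (Fin 1) R X
  constructor
  · intro h
    have h1 := isSummand_summandMult F (R := R) (X := X) (Y := Y)
    refine IsSummand.trans ?_ h1
    exact ⟨LinearMap.single R (fun _ => X) ⟨0, h⟩, LinearMap.proj ⟨0, h⟩, by ext; simp⟩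
  · intro h
    exact le_summandMult F (e1.isSummand.trans h)

include F in
theorem summandMult_le_of_isSummand [Nontrivial X] (h : IsSummand R Y Z) :
    summandMult R X Y ≤ summandMult R X Z :=
  le_summandMult F ((isSummand_summandMult F).trans h)

theorem isIndecomposable_of_isLocalRing_end {R : Type*} [Ring R] {X : Type*} [AddCommGroup X]
    [Module R X] (h : IsLocalRing (Module.End R X)) : IsIndecomposable R X := by
  constructor
  · by_contra hX
    rw [not_nontrivial_iff_subsingleton] at hX
    exact one_ne_zero (α := Module.End R X) (LinearMap.ext fun _ => Subsingleton.elim _ _)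
  · intro P Q hPQ
    have hsum : (P.subtype ∘ₗ P.projectionOnto Q hPQ : Module.End R X) +
        Q.subtype ∘ₗ Q.projectionOnto P hPQ.symm = 1 := by
      ext x
      simpa using Submodule.projection_add_projection_eq_self hPQ x
    rcases IsLocalRing.isUnit_or_isUnit_of_add_one hsum with h | h
    · right
      have := ((Module.End.isUnit_iff _).1 h).1
      rw [Submodule.eq_bot_iff]
      intro x hx
      apply this
      simp [Submodule.projectionOnto_apply_right hPQ ⟨x, hx⟩]
    · left
      have := ((Module.End.isUnit_iff _).1 h).1
      rw [Submodule.eq_bot_iff]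
      intro x hx
      apply this
      simp [Submodule.projectionOnto_apply_right hPQ.symm ⟨x, hx⟩]

/-- A direct summand of an indecomposable module is zero or the whole module. -/
theorem IsIndecomposable.nonempty_equiv_of_isSummand {R : Type*} [Ring R] {X Y : Type*}
    [AddCommGroup X] [Module R X] [AddCommGroup Y] [Module R Y] [Nontrivial X]
    (hY : IsIndecomposable R Y) (h : IsSummand R X Y) : Nonempty (X ≃ₗ[R] Y) := by
  obtain ⟨i, r, hir⟩ := h
  have hri : ∀ x, r (i x) = x := fun x => LinearMap.congr_fun hir x
  have hc : IsCompl (LinearMap.range i) (LinearMap.ker r) := by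
    rw [isCompl_iff, Submodule.disjoint_def, codisjoint_iff_le_sup]
    constructor
    · rintro _ ⟨x, rfl⟩ hx
      rw [LinearMap.mem_ker, hri] at hx
      rw [hx, map_zero]
    · intro y _
      exact Submodule.mem_sup.2 ⟨i (r y), ⟨r y, rfl⟩, y - i (r y), by simp [hri], by abel⟩
  rcases hY.2 _ _ hc with h0 | h0
  · exfalso
    obtain ⟨x, hx⟩ := exists_ne (0 : X)
    apply hx
    have : i x ∈ LinearMap.range i := ⟨x, rfl⟩
    rw [h0, Submodule.mem_bot] at this
    rw [← hri x, this, map_zero]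
  · refine ⟨LinearEquiv.ofBijective i ⟨Function.LeftInverse.injective hri, fun y => ⟨r y, ?_⟩⟩⟩
    have : y - i (r y) ∈ LinearMap.ker r := by simp [hri]
    rw [h0, Submodule.mem_bot, sub_eq_zero] at this
    exact this.symm

end Multiplicities

/-! ### Almost split sequences of finite-dimensional modules -/

section AlmostSplitTheory

variable {k A : Type u} [Field k] [Ring A] [Algebra k A]

/-- The bundled finite-dimensional module with underlying module `X`. -/
abbrev FDMod.of (k A : Type u) [Field k] [Ring A] [Algebra k A] (X : Type u) [AddCommGroup X]
    [Module k X] [Module A X] [IsScalarTower k A X] [Module.Finite k X] : FDMod k A := ⟨X⟩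

instance finite_submodule {k A : Type*} [Field k] [Ring A] [Algebra k A] (X : Type*)
    [AddCommGroup X] [Module k X] [Module A X] [IsScalarTower k A X] [Module.Finite k X]
    (S : Submodule A X) : Module.Finite k S :=
  Module.Finite.of_injective (S.subtype.restrictScalars k) S.injective_subtype

instance finite_quotient {k A : Type*} [Field k] [Ring A] [Algebra k A] (X : Type*)
    [AddCommGroup X] [Module k X] [Module A X] [IsScalarTower k A X] [Module.Finite k X]
    (S : Submodule A X) : Module.Finite k (X ⧸ S) :=
  Module.Finite.of_surjective (S.mkQ.restrictScalars k) S.mkQ_surjective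

/-- An injective endomorphism of a finite-dimensional module is surjective. -/
theorem FDMod.surjective_of_injective (E : FDMod k A) (φ : E →ₗ[A] E)
    (h : Function.Injective φ) : Function.Surjective φ :=
  LinearMap.surjective_of_injective (f := φ.restrictScalars k) h

theorem FDMod.injective_of_surjective (E : FDMod k A) (φ : E →ₗ[A] E)
    (h : Function.Surjective φ) : Function.Injective φ :=
  LinearMap.injective_iff_surjective (f := φ.restrictScalars k) |>.2 h

theorem exists_free_surjective (k A : Type*) [Field k] [Ring A] [Algebra k A] (M : Type*)
    [AddCommGroup M] [Module k M] [Module A M] [IsScalarTower k A M] [Module.Finite k M] :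
    ∃ (n : ℕ) (π : (Fin n → A) →ₗ[A] M), Function.Surjective π := by
  have : Module.Finite A M := Module.Finite.of_restrictScalars_finite k A M
  exact Module.Finite.exists_fin' A M

theorem exists_free_presentation (k A : Type*) [Field k] [Ring A] [Algebra k A] (M : Type*)
    [AddCommGroup M] [Module k M] [Module A M] [IsScalarTower k A M] [Module.Finite k M]
    [Module.Finite k A] :
    ∃ (n m : ℕ) (π : (Fin n → A) →ₗ[A] M) (d : (Fin m → A) →ₗ[A] (Fin n → A)),
      Function.Surjective π ∧ Function.Exact d π := by
  obtain ⟨n, π, hπ⟩ := exists_free_surjective k A M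
  obtain ⟨m, d, hd⟩ := exists_free_surjective k A (LinearMap.ker π)
  refine ⟨n, m, π, (LinearMap.ker π).subtype ∘ₗ d, hπ, fun x => ⟨fun hx => ?_, ?_⟩⟩
  · obtain ⟨y, hy⟩ := hd ⟨x, hx⟩
    exact ⟨y, congrArg Subtype.val hy⟩
  · rintro ⟨y, rfl⟩
    exact (d y).2

/-- A right almost split map onto a non-projective module is surjective. -/
theorem IsRightAlmostSplit.surjective [Module.Finite k A] {E M : FDMod k A} {g : E →ₗ[A] M}
    (hg : IsRightAlmostSplit g) (hM : ¬ Module.Projective A M) : Function.Surjective g := by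
  obtain ⟨n, π, hπ⟩ := exists_free_surjective k A M
  obtain ⟨h', hh'⟩ := hg.2 (FDMod.of k A (Fin n → A)) π fun ⟨s, hs⟩ =>
    hM (Module.Projective.of_split s π hs)
  intro m
  obtain ⟨x, rfl⟩ := hπ m
  exact ⟨h' x, LinearMap.congr_fun hh' x⟩

/-- Among the right almost split maps onto `M` there is one, `g`, such that all endomorphisms `φ`
with `g φ = g` are bijective: take a source of minimal dimension. -/
theorem exists_minimal_isRightAlmostSplit {E' M : FDMod k A} (g' : E' →ₗ[A] M)
    (hg' : IsRightAlmostSplit g') :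
    ∃ (E : FDMod k A) (g : E →ₗ[A] M), IsRightAlmostSplit g ∧
      ∀ φ : E →ₗ[A] E, g ∘ₗ φ = g → Function.Bijective φ := by
  classical
  have hex : ∃ d : ℕ, ∃ (E : FDMod k A) (g : E →ₗ[A] M), IsRightAlmostSplit g ∧
      Module.finrank k E = d := ⟨_, E', g', hg', rfl⟩
  obtain ⟨E, g, hg, hd⟩ := Nat.find_spec hex
  refine ⟨E, g, hg, fun φ hφ => ?_⟩
  have hs : Function.Surjective φ := by
    -- `g` restricted to the image of `φ` is still right almost split.
    have hr : IsRightAlmostSplit (E := FDMod.of k A (LinearMap.range φ)) (M := M)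
        (g ∘ₗ (LinearMap.range φ).subtype) := by
      refine ⟨fun ⟨s, hs⟩ => hg.1 ⟨(LinearMap.range φ).subtype ∘ₗ s, hs⟩, fun X h hh => ?_⟩
      obtain ⟨h', hh'⟩ := hg.2 X h hh
      refine ⟨φ.rangeRestrict ∘ₗ h', ?_⟩
      ext x
      have h1 := LinearMap.congr_fun hφ (h' x)
      have h2 := LinearMap.congr_fun hh' x
      exact h1.trans h2
    have hle := Nat.find_min' hex ⟨_, _, hr, rfl⟩
    rw [← hd] at hle
    have htop : LinearMap.range (φ.restrictScalars k) = ⊤ := by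
      apply Submodule.eq_top_of_finrank_eq
      exact le_antisymm (Submodule.finrank_le _) hle
    exact (LinearMap.range_eq_top (f := φ.restrictScalars k)).1 htop
  exact ⟨E.injective_of_surjective φ hs, hs⟩

/-- The kernel of a minimal right almost split epimorphism is left almost split. -/
theorem isAlmostSplitSeq_of_minimal {E M : FDMod k A} (g : E →ₗ[A] M)
    (hg : IsRightAlmostSplit g) (hs : Function.Surjective g)
    (hmin : ∀ φ : E →ₗ[A] E, g ∘ₗ φ = g → Function.Bijective φ) :
    IsAlmostSplitSeq (N := FDMod.of k A (LinearMap.ker g)) (LinearMap.ker g).subtype g where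
  injective := Subtype.val_injective
  exact := LinearMap.exact_subtype_ker_map g
  surjective := hs
  right := hg
  left := by
    constructor
    · rintro ⟨r, hr⟩
      -- A retraction of the kernel gives a section of `g`.
      have hrx : ∀ x : LinearMap.ker g, r x = x := fun x => LinearMap.congr_fun hr x
      let q : E →ₗ[A] E := LinearMap.id - (LinearMap.ker g).subtype ∘ₗ r
      have hq : LinearMap.ker g ≤ LinearMap.ker q := by
        intro x hx
        have := hrx ⟨x, hx⟩
        simp only [LinearMap.mem_ker, q, LinearMap.sub_apply, LinearMap.id_apply,
          LinearMap.comp_apply, Submodule.subtype_apply]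
        rw [this, sub_self]
      refine hg.1 ⟨((LinearMap.ker g).liftQ q hq) ∘ₗ
        (g.quotKerEquivOfSurjective hs).symm.toLinearMap, ?_⟩
      ext m
      obtain ⟨x, rfl⟩ := hs m
      have h1 : (g.quotKerEquivOfSurjective hs).symm (g x) = (LinearMap.ker g).mkQ x := by
        rw [LinearEquiv.symm_apply_eq]; rfl
      simp only [LinearMap.comp_apply, LinearEquiv.coe_coe, h1, LinearMap.id_apply]
      change g (x - (r x : E)) = g x
      rw [map_sub, (r x).2, sub_zero]
    · intro Y h hh
      -- The pushout of the sequence along `h`; if it does not split, minimality makes `h` a split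
      -- monomorphism.
      let D : Submodule A (Y × E) :=
        LinearMap.range (h.prod (-(LinearMap.ker g).subtype))
      have hD : D ≤ LinearMap.ker (g ∘ₗ LinearMap.snd A Y E) := by
        rintro _ ⟨x, rfl⟩
        have : g (x : E) = 0 := x.2
        simp [this]
      let q : ((Y × E) ⧸ D) →ₗ[A] M := D.liftQ (g ∘ₗ LinearMap.snd A Y E) hD
      let jY : Y →ₗ[A] ((Y × E) ⧸ D) := D.mkQ ∘ₗ LinearMap.inl A Y E
      let jE : E →ₗ[A] ((Y × E) ⧸ D) := D.mkQ ∘ₗ LinearMap.inr A Y E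
      have hj : ∀ x : LinearMap.ker g, jE x = jY (h x) := by
        intro x
        symm
        refine (Submodule.Quotient.eq D).2 ⟨x, ?_⟩
        ext <;> simp
      have hjY : ∀ z : (Y × E) ⧸ D, q z = 0 → ∃ y, jY y = z := by
        intro z hz
        obtain ⟨⟨y, e⟩, rfl⟩ := D.mkQ_surjective z
        have he : g e = 0 := hz
        refine ⟨y + h ⟨e, he⟩, ?_⟩
        rw [map_add, ← hj]
        change D.mkQ (y, 0) + D.mkQ (0, e) = _
        rw [← map_add]; simp
      have hjYinj : Function.Injective jY := by
        rw [injective_iff_map_eq_zero]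
        intro y hy
        obtain ⟨x, hx⟩ := (Submodule.Quotient.mk_eq_zero D).1 hy
        have h1 := congrArg Prod.fst hx
        have h2 := congrArg Prod.snd hx
        simp only [LinearMap.prod_apply, Function.prod_apply, LinearMap.neg_apply,
          Submodule.subtype_apply, neg_eq_zero, LinearMap.inl_apply, ZeroMemClass.coe_eq_zero]
          at h1 h2
        rw [← h1, h2, map_zero]
      by_cases hq : ∃ s : M →ₗ[A] ((Y × E) ⧸ D), q ∘ₗ s = LinearMap.id
      · obtain ⟨s, hqs⟩ := hq
        let t : E →ₗ[A] ((Y × E) ⧸ D) := jE - s ∘ₗ g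
        have ht : ∀ x, t x ∈ LinearMap.range jY := by
          intro x
          obtain ⟨y, hy⟩ := hjY (t x) (by
            have := LinearMap.congr_fun hqs (g x)
            simp only [LinearMap.comp_apply, LinearMap.id_apply] at this
            have h3 : q (jE x) = g x := rfl
            simp only [t, LinearMap.sub_apply, LinearMap.comp_apply, map_sub, this, h3, sub_self])
          exact ⟨y, hy⟩
        refine ⟨(LinearEquiv.ofInjective jY hjYinj).symm.toLinearMap ∘ₗ t.codRestrict _ ht, ?_⟩
        ext x
        simp only [LinearMap.comp_apply, LinearEquiv.coe_coe]
        rw [LinearEquiv.symm_apply_eq]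
        ext
        change jE x - s (g x) = jY (h x)
        have : g (x : E) = 0 := x.2
        rw [this, map_zero, sub_zero, hj]
      · exfalso
        obtain ⟨v, hv⟩ := hg.2 (FDMod.of k A ((Y × E) ⧸ D)) q hq
        have hφ : Function.Bijective (v ∘ₗ jE) := hmin _ (by
          rw [← LinearMap.comp_assoc, hv]
          ext x; rfl)
        have hv' : ∀ z, g (v z) = q z := fun z => LinearMap.congr_fun hv z
        let r : Y →ₗ[A] LinearMap.ker g := (v ∘ₗ jY).codRestrict _ (fun y => by
          rw [LinearMap.mem_ker, LinearMap.comp_apply, hv']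
          exact map_zero g)
        have hrinj : Function.Injective (r ∘ₗ h) := by
          intro x y hxy
          have h1 : v (jY (h x)) = v (jY (h y)) := congrArg Subtype.val hxy
          rw [← hj, ← hj] at h1
          exact Subtype.ext (hφ.1 h1)
        have hrsurj := FDMod.surjective_of_injective (FDMod.of k A (LinearMap.ker g)) _ hrinj
        let e := LinearEquiv.ofBijective (r ∘ₗ h) ⟨hrinj, hrsurj⟩
        refine hh ⟨e.symm.toLinearMap ∘ₗ r, ?_⟩
        ext x
        have : e.symm (e x) = x := e.symm_apply_apply x
        exact congrArg Subtype.val this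

/-- A right almost split map onto a non-projective module yields an almost split sequence. -/
theorem exists_isAlmostSplitSeq [Module.Finite k A] {E' M : FDMod k A} (g' : E' →ₗ[A] M)
    (hg' : IsRightAlmostSplit g') (hM : ¬ Module.Projective A M) :
    ∃ (N E : FDMod k A) (f : N →ₗ[A] E) (g : E →ₗ[A] M), IsAlmostSplitSeq f g := by
  obtain ⟨E, g, hg, hmin⟩ := exists_minimal_isRightAlmostSplit g' hg'
  exact ⟨_, _, _, _, isAlmostSplitSeq_of_minimal g hg (hg.surjective hM) hmin⟩

namespace IsAlmostSplitSeq

variable {N E M N' E' M' : FDMod k A} {f : N →ₗ[A] E} {g : E →ₗ[A] M} {f' : N' →ₗ[A] E'}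
  {g' : E' →ₗ[A] M'}

theorem not_split (h : IsAlmostSplitSeq f g) : ¬ ∃ s : M →ₗ[A] E, g ∘ₗ s = LinearMap.id :=
  h.right.1

/-- The surjection of an almost split sequence is right minimal. -/
theorem bijective_of_comp_eq (h : IsAlmostSplitSeq f g) (φ : E →ₗ[A] E) (hφ : g ∘ₗ φ = g) :
    Function.Bijective φ := by
  have hφ' : ∀ x, g (φ x) = g x := fun x => LinearMap.congr_fun hφ x
  have hgf : ∀ x, g (f x) = 0 := fun x => (h.exact (f x)).2 ⟨x, rfl⟩
  let e : N ≃ₗ[A] LinearMap.range f := LinearEquiv.ofInjective f h.injective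
  have hmem : ∀ x, φ (f x) ∈ LinearMap.range f := fun x => by
    obtain ⟨y, hy⟩ := (h.exact (φ (f x))).1 (by rw [hφ', hgf])
    exact ⟨y, hy⟩
  let ψ : N →ₗ[A] N := e.symm.toLinearMap ∘ₗ (φ ∘ₗ f).codRestrict _ hmem
  have hψ : ∀ x, f (ψ x) = φ (f x) := by
    intro x
    have : e (ψ x) = ⟨φ (f x), hmem x⟩ := e.apply_symm_apply _
    exact congrArg Subtype.val this
  by_cases hs : ∃ r : N →ₗ[A] N, r ∘ₗ ψ = LinearMap.id
  · obtain ⟨r, hr⟩ := hs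
    have hψinj : Function.Injective ψ :=
      Function.LeftInverse.injective (g := r) fun x => LinearMap.congr_fun hr x
    have hinj : Function.Injective φ := by
      rw [injective_iff_map_eq_zero]
      intro x hx
      obtain ⟨n, rfl⟩ := (h.exact x).1 (by rw [← hφ', hx, map_zero])
      rw [← hψ] at hx
      have h1 : ψ n = 0 := h.injective (by rw [hx, map_zero])
      rw [hψinj (h1.trans (map_zero ψ).symm), map_zero]
    exact ⟨hinj, E.surjective_of_injective φ hinj⟩
  · -- Otherwise `ψ` extends to `E`, and `g` would be a split epimorphism.
    exfalso
    obtain ⟨χ, hχ⟩ := h.left.2 N ψ hs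
    have hχ' : ∀ x, χ (f x) = ψ x := fun x => LinearMap.congr_fun hχ x
    let q : E →ₗ[A] E := φ - f ∘ₗ χ
    have hq : LinearMap.ker g ≤ LinearMap.ker q := by
      intro x hx
      obtain ⟨n, rfl⟩ := (h.exact x).1 hx
      simp only [LinearMap.mem_ker, q, LinearMap.sub_apply, LinearMap.comp_apply, hχ', hψ, sub_self]
    refine h.not_split ⟨((LinearMap.ker g).liftQ q hq) ∘ₗ
      (g.quotKerEquivOfSurjective h.surjective).symm.toLinearMap, ?_⟩
    ext m
    obtain ⟨x, rfl⟩ := h.surjective m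
    have h1 : (g.quotKerEquivOfSurjective h.surjective).symm (g x) = (LinearMap.ker g).mkQ x := by
      rw [LinearEquiv.symm_apply_eq]; rfl
    simp only [LinearMap.comp_apply, LinearEquiv.coe_coe, h1, LinearMap.id_apply]
    change g (φ x - f (χ x)) = g x
    rw [map_sub, hgf, sub_zero, hφ']

/-- The kernel term of an almost split sequence is isomorphic to the kernel of its surjection. -/
noncomputable def kerEquiv (h : IsAlmostSplitSeq f g) : N ≃ₗ[A] LinearMap.ker g :=
  LinearEquiv.ofBijective
    (f.codRestrict (LinearMap.ker g) fun x => (h.exact (f x)).2 ⟨x, rfl⟩)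
    ⟨fun _ _ hxy => h.injective (congrArg Subtype.val hxy), fun y => by
      obtain ⟨x, hx⟩ := (h.exact y).1 y.2
      exact ⟨x, Subtype.ext hx⟩⟩

/-- Every right almost split map onto `M` has the initial term of the almost split sequence
terminating in `M` as a direct summand of its kernel. -/
theorem isSummand_ker {E' : FDMod k A} (h : IsAlmostSplitSeq f g) (g' : E' →ₗ[A] M)
    (hg' : IsRightAlmostSplit g') : IsSummand A N (LinearMap.ker g') := by
  obtain ⟨u, hu⟩ := hg'.2 E g h.not_split
  obtain ⟨v, hv⟩ := h.right.2 E' g' hg'.1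
  have hu' : ∀ x, g' (u x) = g x := fun x => LinearMap.congr_fun hu x
  have hv' : ∀ x, g (v x) = g' x := fun x => LinearMap.congr_fun hv x
  have hvu := h.bijective_of_comp_eq (v ∘ₗ u) (by ext x; simp [hu', hv'])
  let u0 : LinearMap.ker g →ₗ[A] LinearMap.ker g' :=
    (u ∘ₗ (LinearMap.ker g).subtype).codRestrict _ fun x => by
      have : g (x : E) = 0 := x.2
      simp [hu', this]
  let v0 : LinearMap.ker g' →ₗ[A] LinearMap.ker g :=
    (v ∘ₗ (LinearMap.ker g').subtype).codRestrict _ fun x => by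
      have : g' (x : E') = 0 := x.2
      simp [hv', this]
  have hinj : Function.Injective (v0 ∘ₗ u0) := fun x y hxy =>
    Subtype.ext (hvu.1 (congrArg Subtype.val hxy))
  have hsurj := FDMod.surjective_of_injective (FDMod.of k A (LinearMap.ker g)) _ hinj
  refine h.kerEquiv.isSummand.trans (isSummand_of_isUnit_comp u0 v0 ?_)
  exact (Module.End.isUnit_iff _).2 ⟨hinj, hsurj⟩

/-- Uniqueness of almost split sequences. -/
theorem nonempty_equiv (h : IsAlmostSplitSeq f g) (h' : IsAlmostSplitSeq f' g') (e : M ≃ₗ[A] M') :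
    Nonempty (E ≃ₗ[A] E') ∧ Nonempty (N ≃ₗ[A] N') := by
  obtain ⟨u, hu⟩ := h'.right.2 E (e.toLinearMap ∘ₗ g) fun ⟨s, hs⟩ =>
    h.not_split ⟨s ∘ₗ e.toLinearMap, by
      ext x
      have := LinearMap.congr_fun hs (e x)
      simpa using this⟩
  obtain ⟨v, hv⟩ := h.right.2 E' (e.symm.toLinearMap ∘ₗ g') fun ⟨s, hs⟩ =>
    h'.not_split ⟨s ∘ₗ e.symm.toLinearMap, by
      ext x
      have := LinearMap.congr_fun hs (e.symm x)
      simpa using this⟩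
  have hu' : ∀ x, g' (u x) = e (g x) := fun x => LinearMap.congr_fun hu x
  have hv' : ∀ x, g (v x) = e.symm (g' x) := fun x => LinearMap.congr_fun hv x
  have hvu := h.bijective_of_comp_eq (v ∘ₗ u) (by ext x; simp [hu', hv'])
  have huv := h'.bijective_of_comp_eq (u ∘ₗ v) (by ext x; simp [hu', hv'])
  have hub : Function.Bijective u :=
    ⟨Function.Injective.of_comp (f := v) hvu.1, Function.Surjective.of_comp (g := v) huv.2⟩
  let U : E ≃ₗ[A] E' := LinearEquiv.ofBijective u hub
  refine ⟨⟨U⟩, ⟨h.kerEquiv.trans ((U.ofSubmodules _ _ ?_).trans h'.kerEquiv.symm)⟩⟩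
  ext y
  constructor
  · rintro ⟨x, hx, rfl⟩
    have hx' : g x = 0 := hx
    change g' (u x) = 0
    rw [hu', hx', map_zero]
  · intro hy
    obtain ⟨x, rfl⟩ := hub.2 y
    refine ⟨x, ?_, rfl⟩
    have hy' : g' (u x) = 0 := hy
    rw [hu'] at hy'
    exact e.map_eq_zero_iff.1 hy'

theorem isIndecomposable (h : IsAlmostSplitSeq f g) : IsIndecomposable A N := by
  constructor
  · by_contra hN
    rw [not_nontrivial_iff_subsingleton] at hN
    exact h.left.1 ⟨0, LinearMap.ext fun _ => Subsingleton.elim _ _⟩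
  · intro P Q hPQ
    -- If both summands were proper, the two projections would extend along `f`, and so would `id`.
    have key : ∀ (P Q : Submodule A N) (hPQ : IsCompl P Q), Q ≠ ⊥ →
        ∃ χ : E →ₗ[A] P, χ ∘ₗ f = P.projectionOnto Q hPQ := by
      intro P Q hPQ hQ
      refine h.left.2 (FDMod.of k A P) (P.projectionOnto Q hPQ) fun ⟨r, hr⟩ => hQ ?_
      rw [Submodule.eq_bot_iff]
      intro x hx
      have h1 := LinearMap.congr_fun hr x
      simp only [LinearMap.comp_apply, LinearMap.id_apply,
        Submodule.projectionOnto_apply_right hPQ ⟨x, hx⟩, map_zero] at h1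
      exact h1.symm
    by_contra! hne
    obtain ⟨χ, hχ⟩ := key P Q hPQ hne.2
    obtain ⟨χ', hχ'⟩ := key Q P hPQ.symm hne.1
    refine h.left.1 ⟨P.subtype ∘ₗ χ + Q.subtype ∘ₗ χ', ?_⟩
    ext x
    have h1 := LinearMap.congr_fun hχ x
    have h2 := LinearMap.congr_fun hχ' x
    simp only [LinearMap.comp_apply] at h1 h2
    simp only [LinearMap.add_apply, LinearMap.comp_apply, h1, h2, LinearMap.id_apply]
    exact Submodule.projection_add_projection_eq_self hPQ x

end IsAlmostSplitSeq

end AlmostSplitTheory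

/-! ### Decomposition of a module into indecomposables, counted by vertices of the quiver -/

section Decomposition

variable {k A : Type u} [Field k] [Ring A] [Algebra k A]

theorem StableInd.cls_eq_iff {M N : StableInd k A} :
    M.cls = N.cls ↔ Nonempty (M.1 ≃ₗ[A] N.1) :=
  Quotient.eq (r := stableIndSetoid k A)

/-- The multiplicity with which a vertex of the stable Auslander-Reiten quiver occurs in `E`. -/
noncomputable def vertexMult (x : StableVertex k A) (E : FDMod k A) : ℕ :=
  summandMult A (Quotient.out x : StableInd k A).1 E

theorem StableInd.cls_out (x : StableVertex k A) : (Quotient.out x : StableInd k A).cls = x :=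
  Quotient.out_eq x

theorem isSummand_fin_congr {X X' Y : Type*} [AddCommGroup X] [Module A X] [AddCommGroup X']
    [Module A X'] [AddCommGroup Y] [Module A Y] (e : X ≃ₗ[A] X') (n : ℕ) :
    IsSummand A (Fin n → X) Y ↔ IsSummand A (Fin n → X') Y :=
  ⟨(LinearEquiv.piCongrRight fun _ => e.symm).isSummand.trans,
    (LinearEquiv.piCongrRight fun _ => e).isSummand.trans⟩

theorem vertexMult_cls (X : StableInd k A) (E : FDMod k A) :
    vertexMult X.cls E = summandMult A X.1 E := by
  obtain ⟨e⟩ := StableInd.cls_eq_iff.1 (StableInd.cls_out X.cls)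
  unfold vertexMult summandMult
  congr 1
  ext n
  exact isSummand_fin_congr e n

instance (X : StableInd k A) : Nontrivial X.1 := X.2.1.1

theorem vertexMult_pos_iff (X : StableInd k A) (E : FDMod k A) :
    0 < vertexMult X.cls E ↔ IsSummand A X.1 E := by
  rw [vertexMult_cls, summandMult_pos_iff k]

theorem vertexMult_congr (x : StableVertex k A) {E E' : FDMod k A} (e : E ≃ₗ[A] E') :
    vertexMult x E = vertexMult x E' :=
  summandMult_congr _ _ e

theorem vertexMult_prod (x : StableVertex k A) (E E' : FDMod k A) :
    vertexMult x (FDMod.of k A (E × E')) = vertexMult x E + vertexMult x E' :=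
  summandMult_prod k (Quotient.out x : StableInd k A).2.1

theorem vertexMult_eq_zero_of_projective (x : StableVertex k A) {P : FDMod k A}
    (hP : Module.Projective A P) : vertexMult x P = 0 := by
  by_contra h
  rw [← StableInd.cls_out x] at h
  exact (Quotient.out x : StableInd k A).2.2
    (projective_of_isSummand ((vertexMult_pos_iff _ _).1 (Nat.pos_of_ne_zero h)))

theorem vertexMult_of_isIndecomposable [DecidableEq (StableVertex k A)] (x : StableVertex k A)
    (E : StableInd k A) : vertexMult x E.1 = if x = E.cls then 1 else 0 := by
  split_ifs with hx
  · subst hx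
    rw [vertexMult_cls]
    apply le_antisymm
    · have h1 := summandMult_mul_finrank_le k (R := A) (X := E.1) (Y := E.1)
      have h2 : 0 < Module.finrank k E.1 := Module.finrank_pos
      nlinarith
    · exact (summandMult_pos_iff k).2 (LinearEquiv.refl A _).isSummand
  · by_contra h
    obtain ⟨X, rfl⟩ : ∃ X : StableInd k A, X.cls = x := ⟨_, StableInd.cls_out x⟩
    have := (vertexMult_pos_iff _ _).1 (Nat.pos_of_ne_zero h)
    exact hx (StableInd.cls_eq_iff.2 (E.2.1.nonempty_equiv_of_isSummand this))

/-- A function on modules that is additive on direct sums. -/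
def IsSumAdditive (a : FDMod k A → ℕ) : Prop :=
  ∀ X Y Z : FDMod k A, Nonempty (Z ≃ₗ[A] X × Y) → a Z = a X + a Y

theorem IsSumAdditive.eq_zero {a : FDMod k A → ℕ} (ha : IsSumAdditive a) (E : FDMod k A)
    [Subsingleton E] : a E = 0 := by
  have := ha E E E ⟨LinearEquiv.ofLinearMap (LinearMap.inl A E E) (LinearMap.fst A E E)
    (LinearMap.ext fun _ => Subsingleton.elim _ _) (LinearMap.ext fun _ => Subsingleton.elim _ _)⟩
  omega

theorem IsSumAdditive.congr {a : FDMod k A → ℕ} (ha : IsSumAdditive a) {E E' : FDMod k A}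
    (e : E ≃ₗ[A] E') : a E = a E' := by
  have h1 := ha E' (FDMod.of k A PUnit) E ⟨LinearEquiv.ofLinearMap
    ((LinearMap.inl A E' PUnit.{u + 1}) ∘ₗ e.toLinearMap)
    (e.symm.toLinearMap ∘ₗ LinearMap.fst A E' PUnit.{u + 1})
    (by ext <;> simp) (by ext; simp)⟩
  rw [h1, ha.eq_zero (FDMod.of k A PUnit), add_zero]

/-- The Krull-Remak-Schmidt decomposition: every `E` has a projective direct summand `P` such that
each function that is additive on direct sums takes on `E` the value on `P` plus its values on the
non-projective indecomposable summands, counted with multiplicity. -/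
theorem exists_projective_summand_finsum (E : FDMod k A) :
    ∃ P : FDMod k A, Module.Projective A P ∧ IsSummand A P E ∧
      {x : StableVertex k A | 0 < vertexMult x E}.Finite ∧
      ∀ (a : FDMod k A → ℕ) (F : StableVertex k A → ℕ), IsSumAdditive a →
        (∀ M : StableInd k A, F M.cls = a M.1) → a E = a P + ∑ᶠ x, F x * vertexMult x E := by
  classical
  induction hd : Module.finrank k E using Nat.strong_induction_on generalizing E with
  | _ d ih =>
  by_cases hproj : Module.Projective A E
  · refine ⟨E, hproj, (LinearEquiv.refl A E).isSummand, ?_, fun a F _ _ => ?_⟩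
    · simp [vertexMult_eq_zero_of_projective _ hproj]
    · simp [vertexMult_eq_zero_of_projective _ hproj]
  by_cases hind : IsIndecomposable A E
  · let X : StableInd k A := ⟨E, hind, hproj⟩
    have hX : ∀ x, vertexMult x E = if x = X.cls then 1 else 0 := fun x =>
      vertexMult_of_isIndecomposable x X
    refine ⟨FDMod.of k A PUnit, inferInstance, ⟨0, 0, LinearMap.ext fun _ => rfl⟩, ?_,
      fun a F ha hF => ?_⟩
    · refine (Set.finite_singleton X.cls).subset fun x hx => ?_
      by_contra hne
      simp only [Set.mem_ofPred_eq, hX, Set.mem_singleton_iff] at hx hne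
      simp [hne] at hx
    · rw [ha.eq_zero (FDMod.of k A PUnit), finsum_eq_single _ X.cls, hX, hF]
      · simp [X]
      · intro x hx
        simp [hX, hx]
  have hnt : Nontrivial E := by
    by_contra h
    rw [not_nontrivial_iff_subsingleton] at h
    exact hproj inferInstance
  have hPQ : ∃ P Q : Submodule A E, IsCompl P Q ∧ P ≠ ⊥ ∧ Q ≠ ⊥ := by
    by_contra! h
    exact hind ⟨hnt, fun P Q hPQ => or_iff_not_imp_left.2 (h P Q hPQ)⟩
  obtain ⟨P, Q, hPQ, hP, hQ⟩ := hPQ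
  have e : E ≃ₗ[A] P × Q := (Submodule.prodEquivOfIsCompl P Q hPQ).symm
  have hdim : Module.finrank k E = Module.finrank k P + Module.finrank k Q := by
    rw [(e.restrictScalars k).finrank_eq, Module.finrank_prod]
  have := Submodule.nontrivial_iff_ne_bot.2 hP
  have := Submodule.nontrivial_iff_ne_bot.2 hQ
  have hP0 : 0 < Module.finrank k P := Module.finrank_pos
  have hQ0 : 0 < Module.finrank k Q := Module.finrank_pos
  obtain ⟨P1, hP1, hs1, hf1, h1⟩ := ih (Module.finrank k P) (by omega) (FDMod.of k A P) rfl
  obtain ⟨P2, hP2, hs2, hf2, h2⟩ := ih (Module.finrank k Q) (by omega) (FDMod.of k A Q) rfl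
  have hmult : ∀ x, vertexMult x E = vertexMult x (FDMod.of k A P) +
      vertexMult x (FDMod.of k A Q) := fun x => by
    rw [← vertexMult_prod]
    exact vertexMult_congr x (E' := FDMod.of k A (P × Q)) e
  refine ⟨FDMod.of k A (P1 × P2), inferInstance, (hs1.prodMap hs2).of_equiv A e.symm, ?_,
    fun a F ha hF => ?_⟩
  · refine (hf1.union hf2).subset fun x hx => ?_
    simp only [Set.mem_ofPred_eq, hmult, Set.mem_union] at hx ⊢
    omega
  · rw [ha (FDMod.of k A P) (FDMod.of k A Q) E ⟨e⟩, h1 a F ha hF, h2 a F ha hF,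
      ha P1 P2 (FDMod.of k A (P1 × P2)) ⟨LinearEquiv.refl A _⟩]
    simp only [hmult, mul_add]
    rw [finsum_add_distrib]
    · ring
    · exact hf1.subset fun x hx => Nat.pos_of_ne_zero (right_ne_zero_of_mul hx)
    · exact hf2.subset fun x hx => Nat.pos_of_ne_zero (right_ne_zero_of_mul hx)

end Decomposition

/-! ### Frobenius forms: self-injectivity and the twisted second syzygy -/

/-- A Frobenius form on the finite-dimensional algebra `A`, together with an automorphism
`nakayama` that measures its failure to be symmetric. (This is the inverse of the automorphism `ν`
determined by `form (a * b) = form (b * ν a)`.) -/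
structure FrobeniusForm (k A : Type*) [Field k] [Ring A] [Algebra k A] where
  form : A →ₗ[k] k
  nakayama : A ≃ₐ[k] A
  form_nakayama_mul : ∀ a b, form (nakayama a * b) = form (b * a)
  nondegenerate : ∀ b, (∀ a, form (a * b) = 0) → b = 0

/-- The module `N` with the action of `A` twisted by the automorphism `σ`. -/
def FDMod.twist {k A : Type u} [Field k] [Ring A] [Algebra k A] (σ : A ≃ₐ[k] A) (N : FDMod k A) :
    FDMod k A :=
  letI : Module k (Pullback (σ : A →+* A) N) := inferInstanceAs (Module k N)
  { carrier := Pullback (σ : A →+* A) N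
    finite := inferInstanceAs (Module.Finite k N)
    isScalarTower := ⟨fun c a x => by
      change (σ (c • a)) • (show N from x) = c • (σ a • (show N from x))
      rw [map_smul, smul_assoc]⟩ }

section Twist

variable {k A : Type u} [Field k] [Ring A] [Algebra k A] (σ : A ≃ₐ[k] A)

/-- The identity map from a module to its twist. -/
def FDMod.toTwist (N : FDMod k A) : N ≃ₗ[k] N.twist σ where
  toFun x := x
  invFun x := x
  map_add' _ _ := rfl
  map_smul' _ _ := rfl
  left_inv _ := rfl
  right_inv _ := rfl

theorem FDMod.smul_toTwist (N : FDMod k A) (a : A) (x : N) :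
    a • N.toTwist σ x = N.toTwist σ (σ a • x) := rfl

theorem FDMod.toTwist_symm_smul (N : FDMod k A) (a : A) (x : N.twist σ) :
    (N.toTwist σ).symm (a • x) = σ a • (N.toTwist σ).symm x := rfl

/-- The twist of a linear map. -/
def FDMod.twistMap {N N' : FDMod k A} (f : N →ₗ[A] N') : N.twist σ →ₗ[A] N'.twist σ where
  toFun x := N'.toTwist σ (f ((N.toTwist σ).symm x))
  map_add' x y := by simp
  map_smul' a x := by
    rw [FDMod.toTwist_symm_smul, map_smul, RingHom.id_apply, FDMod.smul_toTwist]

@[simp]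
theorem FDMod.twistMap_toTwist {N N' : FDMod k A} (f : N →ₗ[A] N') (x : N) :
    FDMod.twistMap σ f (N.toTwist σ x) = N'.toTwist σ (f x) := rfl

/-- A linear map between twists, viewed as a linear map between the original modules. -/
def FDMod.untwistMap {N N' : FDMod k A} (f : N.twist σ →ₗ[A] N'.twist σ) : N →ₗ[A] N' where
  toFun x := (N'.toTwist σ).symm (f (N.toTwist σ x))
  map_add' x y := by simp
  map_smul' a x := by
    have h : N.toTwist σ (a • x) = σ.symm a • N.toTwist σ x := by
      rw [FDMod.smul_toTwist, σ.apply_symm_apply]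
    rw [h, map_smul, FDMod.toTwist_symm_smul, σ.apply_symm_apply, RingHom.id_apply]

theorem projective_twist_free [Module.Finite k A] (m : ℕ) :
    Module.Projective A ((FDMod.of k A (Fin m → A)).twist σ) := by
  let e : (Fin m → A) ≃ₗ[A] (FDMod.of k A (Fin m → A)).twist σ :=
    { toFun := fun y => (FDMod.of k A (Fin m → A)).toTwist σ fun j => σ (y j)
      invFun := fun y => fun j => σ.symm ((FDMod.of k A (Fin m → A)).toTwist σ |>.symm y j)
      map_add' := fun x y => by
        rw [← map_add]; congr 1; ext j; simp
      map_smul' := fun a x => by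
        rw [RingHom.id_apply, FDMod.smul_toTwist]; congr 1; ext j; simp
      left_inv := fun x => by ext j; simp
      right_inv := fun x => by simp }
  exact Module.Projective.of_equiv e

end Twist

namespace FrobeniusForm

section Dual

variable {k A : Type*} [Field k] [Ring A] [Algebra k A] (F : FrobeniusForm k A)

theorem nondegenerate_left (b : A) (h : ∀ a, F.form (b * a) = 0) : b = 0 := by
  refine F.nondegenerate b fun a => ?_
  obtain ⟨a, rfl⟩ := F.nakayama.surjective a
  rw [F.form_nakayama_mul, h]

theorem ext_right {b c : A} (h : ∀ a, F.form (a * b) = F.form (a * c)) : b = c :=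
  sub_eq_zero.1 (F.nondegenerate _ fun a => by rw [mul_sub, map_sub, h, sub_self])

theorem ext_left {b c : A} (h : ∀ a, F.form (b * a) = F.form (c * a)) : b = c :=
  sub_eq_zero.1 (F.nondegenerate_left _ fun a => by rw [sub_mul, map_sub, h, sub_self])

theorem hom_ext {X : Type*} [AddCommGroup X] [Module A X] {u v : X →ₗ[A] A}
    (h : ∀ x, F.form (u x) = F.form (v x)) : u = v := by
  ext x
  refine F.ext_right fun a => ?_
  have := h (a • x)
  simpa using this

variable [Module.Finite k A]

/-- The isomorphism `b ↦ form (- * b)` between `A` and its dual. -/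
noncomputable def rightDual : A ≃ₗ[k] Module.Dual k A :=
  LinearMap.linearEquivOfInjective ((LinearMap.mul k A).flip.compr₂ F.form)
    ((injective_iff_map_eq_zero _).2 fun b hb =>
      F.nondegenerate b fun a => LinearMap.congr_fun hb a)
    (Subspace.dual_finrank_eq).symm

/-- The isomorphism `b ↦ form (b * -)` between `A` and its dual. -/
noncomputable def leftDual : A ≃ₗ[k] Module.Dual k A :=
  LinearMap.linearEquivOfInjective ((LinearMap.mul k A).compr₂ F.form)
    ((injective_iff_map_eq_zero _).2 fun b hb =>
      F.nondegenerate_left b fun a => LinearMap.congr_fun hb a)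
    (Subspace.dual_finrank_eq).symm

theorem form_mul_rightDual_symm (ℓ : Module.Dual k A) (a : A) :
    F.form (a * F.rightDual.symm ℓ) = ℓ a :=
  LinearMap.congr_fun (F.rightDual.apply_symm_apply ℓ) a

theorem form_leftDual_symm_mul (ℓ : Module.Dual k A) (a : A) :
    F.form (F.leftDual.symm ℓ * a) = ℓ a :=
  LinearMap.congr_fun (F.leftDual.apply_symm_apply ℓ) a

variable {X : Type*} [AddCommGroup X] [Module k X] [Module A X] [IsScalarTower k A X]
variable {Y : Type*} [AddCommGroup Y] [Module k Y] [Module A Y] [IsScalarTower k A Y]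

/-- The `A`-linear map `X → A` that corresponds to the functional `ℓ`. -/
noncomputable def homOfFunctional (ℓ : X →ₗ[k] k) : X →ₗ[A] A where
  toFun x := F.rightDual.symm (ℓ ∘ₗ (LinearMap.toSpanSingleton A X x).restrictScalars k)
  map_add' x y := F.ext_right fun a => by
    simp [mul_add, form_mul_rightDual_symm]
  map_smul' b x := F.ext_right fun a => by
    simp only [form_mul_rightDual_symm, RingHom.id_apply, smul_eq_mul, ← mul_assoc]
    simp [mul_smul]

theorem form_homOfFunctional (ℓ : X →ₗ[k] k) (x : X) : F.form (F.homOfFunctional ℓ x) = ℓ x := by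
  have := F.form_mul_rightDual_symm
    (ℓ ∘ₗ (LinearMap.toSpanSingleton A X x).restrictScalars k) 1
  simpa [homOfFunctional] using this

include F in
/-- Free modules over an algebra with a Frobenius form are injective. -/
theorem exists_extension {n : ℕ} (i : X →ₗ[A] Y) (hi : Function.Injective i)
    (h : X →ₗ[A] (Fin n → A)) : ∃ h' : Y →ₗ[A] (Fin n → A), h' ∘ₗ i = h := by
  have key : ∀ h : X →ₗ[A] A, ∃ h' : Y →ₗ[A] A, h' ∘ₗ i = h := by
    intro h
    obtain ⟨ℓ, hℓ⟩ := LinearMap.dualMap_surjective_of_injective (f := i.restrictScalars k) hi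
      (F.form ∘ₗ h.restrictScalars k)
    refine ⟨F.homOfFunctional ℓ, F.hom_ext fun x => ?_⟩
    rw [LinearMap.comp_apply, form_homOfFunctional]
    exact LinearMap.congr_fun hℓ x
  choose h' hh' using fun j => key (LinearMap.proj j ∘ₗ h)
  refine ⟨LinearMap.pi h', ?_⟩
  ext x j
  exact LinearMap.congr_fun (hh' j) x

include F in
/-- Projective modules over an algebra with a Frobenius form are injective. -/
theorem exists_retraction [Module.Finite k X] [Module.Projective A X] (f : X →ₗ[A] Y)
    (hf : Function.Injective f) : ∃ r : Y →ₗ[A] X, r ∘ₗ f = LinearMap.id := by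
  obtain ⟨n, π, hπ⟩ := exists_free_surjective k A X
  obtain ⟨s, hs⟩ := Module.projective_lifting_property π LinearMap.id hπ
  obtain ⟨h, hh⟩ := F.exists_extension f hf s
  refine ⟨π ∘ₗ h, ?_⟩
  rw [LinearMap.comp_assoc, hh, hs]

end Dual

section Presentation

variable {k A : Type u} [Field k] [Ring A] [Algebra k A] [Module.Finite k A]
  (F : FrobeniusForm k A)

include F in
/-- The initial term of an almost split sequence is not projective. -/
theorem not_projective_of_isAlmostSplitSeq {N E M : FDMod k A} {f : N →ₗ[A] E}
    {g : E →ₗ[A] M} (h : IsAlmostSplitSeq f g) : ¬ Module.Projective A N := fun _ =>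
  h.left.1 (F.exists_retraction f h.injective)

/-- A functional `ℓ` on `X ^ n` gives an `A`-linear map from `X` to the twist of `A ^ n`. -/
noncomputable def homTwist {n : ℕ} {X : FDMod k A} (ℓ : (Fin n → X) →ₗ[k] k) :
    X →ₗ[A] (FDMod.of k A (Fin n → A)).twist F.nakayama where
  toFun x := (FDMod.of k A (Fin n → A)).toTwist F.nakayama fun j =>
    F.leftDual.symm (ℓ ∘ₗ LinearMap.single k (fun _ => (X : Type u)) j ∘ₗ
      (LinearMap.toSpanSingleton A X x).restrictScalars k)
  map_add' x y := by
    rw [← map_add]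
    congr 1
    ext j
    refine F.ext_left fun a => ?_
    simp [add_mul, form_leftDual_symm_mul, Pi.single_add]
  map_smul' b x := by
    rw [RingHom.id_apply, FDMod.smul_toTwist]
    congr 1
    ext j
    refine F.ext_left fun a => ?_
    simp only [Pi.smul_apply, smul_eq_mul, mul_assoc]
    rw [F.form_nakayama_mul, mul_assoc]
    simp [form_leftDual_symm_mul, mul_smul]

theorem form_homTwist {n : ℕ} {X : FDMod k A} (ℓ : (Fin n → X) →ₗ[k] k) (x : X) (j : Fin n) :
    F.form (((FDMod.of k A (Fin n → A)).toTwist F.nakayama).symm (F.homTwist ℓ x) j) =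
      ℓ (Pi.single j x) := by
  have := F.form_leftDual_symm_mul (ℓ ∘ₗ LinearMap.single k (fun _ => (X : Type u)) j ∘ₗ
      (LinearMap.toSpanSingleton A X x).restrictScalars k) 1
  rw [mul_one] at this
  simpa [homTwist] using this

theorem form_mul_twist {n : ℕ} {X : FDMod k A}
    (u : X →ₗ[A] (FDMod.of k A (Fin n → A)).twist F.nakayama) (x : X) (j : Fin n) (a : A) :
    F.form (((FDMod.of k A (Fin n → A)).toTwist F.nakayama).symm (u x) j * a) =
      F.form (((FDMod.of k A (Fin n → A)).toTwist F.nakayama).symm (u (a • x)) j) := by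
  rw [map_smul, FDMod.toTwist_symm_smul, ← F.form_nakayama_mul]
  rfl

theorem homTwist_ext {n : ℕ} {X : FDMod k A}
    {u v : X →ₗ[A] (FDMod.of k A (Fin n → A)).twist F.nakayama}
    (h : ∀ x j, F.form (((FDMod.of k A (Fin n → A)).toTwist F.nakayama).symm (u x) j) =
      F.form (((FDMod.of k A (Fin n → A)).toTwist F.nakayama).symm (v x) j)) : u = v := by
  ext x
  apply ((FDMod.of k A (Fin n → A)).toTwist F.nakayama).symm.injective
  ext j
  refine F.ext_left fun a => ?_
  rw [F.form_mul_twist, F.form_mul_twist, h]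

variable {m n : ℕ} (d : (Fin m → A) →ₗ[A] (Fin n → A))

/-- Composition with the twist of `d : A ^ m → A ^ n` is dual to multiplication by the matrix of
`d`. -/
theorem form_twistMap {X : FDMod k A}
    (u : X →ₗ[A] (FDMod.of k A (Fin m → A)).twist F.nakayama) (x : X) (j : Fin n) :
    F.form (((FDMod.of k A (Fin n → A)).toTwist F.nakayama).symm
        (FDMod.twistMap (N := FDMod.of k A (Fin m → A)) (N' := FDMod.of k A (Fin n → A))
          F.nakayama d (u x)) j) =
      ∑ i, F.form (((FDMod.of k A (Fin m → A)).toTwist F.nakayama).symm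
        (u (d (Pi.single i 1) j • x)) i) := by
  obtain ⟨y, hy⟩ := ((FDMod.of k A (Fin m → A)).toTwist F.nakayama).surjective (u x)
  have h1 : d y j = ∑ i, y i * d (Pi.single i 1) j := by
    conv_lhs => rw [← Finset.univ_sum_single y]
    rw [map_sum, Finset.sum_apply]
    refine Finset.sum_congr rfl fun i _ => ?_
    have : (Pi.single i (y i) : Fin m → A) = y i • Pi.single i 1 := by
      rw [← Pi.single_smul, smul_eq_mul, mul_one]
    rw [this, map_smul, Pi.smul_apply, smul_eq_mul]
  simp_rw [← F.form_mul_twist, ← hy]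
  rw [FDMod.twistMap_toTwist, LinearEquiv.symm_apply_apply, h1, map_sum]
  simp

/-- The existence theorem for right almost split maps. A functional on `End M` that vanishes on the
non-units but not at the identity extends to `M ^ n`, hence defines a map `ψ` from `M` to the twist
of `A ^ n`; the pullback of `ψ` and the twist of `d : A ^ m → A ^ n` is right almost split. -/
theorem exists_isRightAlmostSplit {M : FDMod k A} (hM : IsIndecomposable A M)
    (π : (Fin n → A) →ₗ[A] M) (hπ : Function.Surjective π) (hd : Function.Exact d π) :
    ∃ (E : FDMod k A) (g : E →ₗ[A] M), IsRightAlmostSplit g ∧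
      Nonempty (LinearMap.ker g ≃ₗ[A]
        (FDMod.of k A (LinearMap.ker d)).twist F.nakayama) := by
  have hloc := hM.isLocalRing_end k
  have hunit : ∀ φ : Module.End A M, φ ∈ nonunits (Module.End A M) → ∀ c : k,
      c • φ ∈ nonunits (Module.End A M) := by
    intro φ hφ c hc
    apply hφ
    by_cases h0 : c = 0
    · subst h0
      rw [zero_smul, isUnit_zero_iff] at hc
      exact absurd hc zero_ne_one
    · have : φ = (c⁻¹ • (1 : Module.End A M)) * (c • φ) := by
        rw [smul_mul_assoc, one_mul, smul_smul, inv_mul_cancel₀ h0, one_smul]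
      rw [this]
      refine IsUnit.mul ?_ hc
      exact ⟨⟨c⁻¹ • 1, c • 1, by simp [smul_smul, h0], by simp [smul_smul, h0]⟩, rfl⟩
  let S : Submodule k (Module.End A M) :=
    { IsLocalRing.nonunitsAddSubmonoid (Module.End A M) with
      smul_mem' := fun c φ hφ => hunit φ hφ c }
  obtain ⟨θ, hθ1, hθ⟩ := Submodule.exists_le_ker_of_notMem (p := S)
    (v := (1 : Module.End A M)) (fun h => h isUnit_one)
  -- The functional extends along `End M → M ^ n`, `φ ↦ (φ (π e_j))_j`.
  let Φ : Module.End A M →ₗ[k] (Fin n → M) :=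
    { toFun := fun φ j => φ (π (Pi.single j 1))
      map_add' := fun _ _ => rfl
      map_smul' := fun _ _ => rfl }
  have hΦ : Function.Injective Φ := by
    intro φ φ' h
    have h1 : φ ∘ₗ π = φ' ∘ₗ π := by
      refine LinearMap.pi_ext' fun j => LinearMap.ext_ring ?_
      exact congrFun h j
    ext x
    obtain ⟨y, rfl⟩ := hπ x
    exact LinearMap.congr_fun h1 y
  obtain ⟨Θ, hΘ⟩ := LinearMap.dualMap_surjective_of_injective hΦ θ
  have hΘ' : ∀ φ, Θ (Φ φ) = θ φ := fun φ => LinearMap.congr_fun hΘ φ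
  let ψ := F.homTwist Θ
  let F1 := FDMod.of k A (Fin m → A)
  let F0 := FDMod.of k A (Fin n → A)
  let d' : F1.twist F.nakayama →ₗ[A] F0.twist F.nakayama :=
    FDMod.twistMap (N := F1) (N' := F0) F.nakayama d
  let E : Submodule A (M × F1.twist F.nakayama) :=
    LinearMap.ker (ψ ∘ₗ LinearMap.fst A M (F1.twist F.nakayama) -
      d' ∘ₗ LinearMap.snd A M (F1.twist F.nakayama))
  let g : E →ₗ[A] M := LinearMap.fst A M (F1.twist F.nakayama) ∘ₗ E.subtype
  have hE : ∀ x : E, ψ (x : M × F1.twist F.nakayama).1 = d' (x : M × F1.twist F.nakayama).2 :=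
    fun x => sub_eq_zero.1 x.2
  have hdsum : ∀ (X : Type u) [AddCommGroup X] [Module A X] (x : (Fin n → A) →ₗ[A] X)
      (y : Fin n → A), ∑ j, y j • x (Pi.single j 1) = x y := by
    intro X _ _ x y
    conv_rhs => rw [← Finset.univ_sum_single y]
    rw [map_sum]
    refine Finset.sum_congr rfl fun j _ => ?_
    rw [← map_smul, ← Pi.single_smul, smul_eq_mul, mul_one]
  refine ⟨FDMod.of k A E, g, ⟨?_, ?_⟩, ?_⟩
  · -- A section of `g` amounts to a lift `χ` of `ψ` along `d'`, which would force `θ 1 = 0`.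
    rintro ⟨s, hs⟩
    let χ : M →ₗ[A] F1.twist F.nakayama := LinearMap.snd A M _ ∘ₗ E.subtype ∘ₗ s
    have hχ : ∀ x, d' (χ x) = ψ x := by
      intro x
      have h1 := hE (s x)
      have h2 : ((s x : E) : M × F1.twist F.nakayama).1 = x := LinearMap.congr_fun hs x
      rw [h2] at h1
      exact h1.symm
    apply hθ1
    rw [← hΘ']
    have h1 : Φ 1 = ∑ j, Pi.single j (π (Pi.single j 1)) := (Finset.univ_sum_single (Φ 1)).symm
    rw [h1, map_sum]
    simp_rw [← F.form_homTwist Θ]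
    change ∑ j, F.form ((F0.toTwist F.nakayama).symm (ψ _) j) = 0
    simp_rw [← hχ]
    refine (Finset.sum_congr rfl fun j _ => F.form_twistMap d χ _ j).trans ?_
    rw [Finset.sum_comm]
    refine Finset.sum_eq_zero fun i _ => ?_
    have h2 : ∑ j, d (Pi.single i 1) j • π (Pi.single j 1) = 0 := by
      rw [hdsum M π]
      exact (hd _).2 ⟨_, rfl⟩
    calc _ = F.form ((F1.toTwist F.nakayama).symm
          (χ (∑ j, d (Pi.single i 1) j • π (Pi.single j 1))) i) := by
            rw [map_sum, map_sum, Finset.sum_apply, map_sum]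
      _ = 0 := by rw [h2, map_zero, map_zero]; exact map_zero _
  · intro X h hh
    -- The functional on `X ^ n` that corresponds to `ψ ∘ h` vanishes on `Hom (M, X)`, the kernel
    -- of `X ^ n → X ^ m`.
    let T : (Fin n → X) →ₗ[k] (Fin m → X) :=
      { toFun := fun x i => ∑ j, d (Pi.single i 1) j • x j
        map_add' := fun x y => by ext i; simp [Finset.sum_add_distrib]
        map_smul' := fun c x => by
          ext i
          simp only [Pi.smul_apply, RingHom.id_apply, Finset.smul_sum]
          exact Finset.sum_congr rfl fun j _ => smul_comm _ _ _ }
    let Ψ : (Fin n → X) →ₗ[k] k := Θ ∘ₗ LinearMap.compLeft (h.restrictScalars k) (Fin n)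
    have hker : Ψ ∈ (LinearMap.ker T).dualAnnihilator := by
      rw [Submodule.mem_dualAnnihilator]
      intro x hx
      let ξ : (Fin n → A) →ₗ[A] X := Fintype.linearCombination A x
      have hξ : ∀ j, ξ (Pi.single j 1) = x j := fun j => by
        simp [ξ, Fintype.linearCombination_apply_single]
      have hξd : LinearMap.ker π ≤ LinearMap.ker ξ := by
        intro y hy
        obtain ⟨z, rfl⟩ := (hd y).1 hy
        have h0 : ξ ∘ₗ d = 0 := by
          refine LinearMap.pi_ext' fun i => LinearMap.ext_ring ?_
          have := congrFun hx i
          simp only [LinearMap.comp_apply, LinearMap.single_apply]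
          rw [← hdsum X ξ]
          simp only [hξ]
          exact this
        exact LinearMap.congr_fun h0 z
      let φ : M →ₗ[A] X := (LinearMap.ker π).liftQ ξ hξd ∘ₗ
        (π.quotKerEquivOfSurjective hπ).symm.toLinearMap
      have hφ : ∀ y, φ (π y) = ξ y := by
        intro y
        have h1 : (π.quotKerEquivOfSurjective hπ).symm (π y) = (LinearMap.ker π).mkQ y := by
          rw [LinearEquiv.symm_apply_eq]; rfl
        simp only [φ, LinearMap.comp_apply, LinearEquiv.coe_coe, h1]
        rfl
      have hΨ : Ψ x = θ (h ∘ₗ φ) := by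
        rw [← hΘ']
        change Θ _ = Θ _
        congr 1
        ext j
        change h (x j) = h (φ (π (Pi.single j 1)))
        rw [hφ, hξ]
      rw [hΨ]
      refine hθ fun hu => hh ?_
      obtain ⟨u, hu⟩ := hu
      refine ⟨φ ∘ₗ (↑u⁻¹ : Module.End A M), ?_⟩
      rw [← LinearMap.comp_assoc, ← hu]
      exact u.mul_inv
    rw [← LinearMap.range_dualMap_eq_dualAnnihilator_ker] at hker
    obtain ⟨ξ, hξ⟩ := hker
    have hξ' : ∀ x, ξ (T x) = Ψ x := fun x => LinearMap.congr_fun hξ x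
    let χ := F.homTwist ξ
    have hχ : d' ∘ₗ χ = ψ ∘ₗ h := by
      refine F.homTwist_ext fun x j => ?_
      refine (F.form_twistMap d χ x j).trans ?_
      simp only [χ, LinearMap.comp_apply, ψ, F.form_homTwist]
      rw [← map_sum]
      have h1 : ∑ i, (Pi.single i (d (Pi.single i 1) j • x) : Fin m → X) = T (Pi.single j x) := by
        rw [Finset.univ_sum_single fun i => d (Pi.single i 1) j • x]
        ext i
        change _ = ∑ j', d (Pi.single i 1) j' • (Pi.single j x : Fin n → X) j'
        rw [Finset.sum_eq_single j]
        · simp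
        · intro j' _ hj'
          simp [Pi.single_eq_of_ne hj']
        · simp
      rw [h1, hξ']
      change Θ _ = Θ _
      congr 1
      ext j'
      change h ((Pi.single j x : Fin n → X) j') = (Pi.single j (h x) : Fin n → M) j'
      by_cases hj : j' = j
      · subst hj; simp
      · simp [Pi.single_eq_of_ne hj]
    refine ⟨(h.prod χ).codRestrict E fun x => ?_, rfl⟩
    exact sub_eq_zero.2 (LinearMap.congr_fun hχ x).symm
  · -- The kernel of a pullback projection is the kernel of the opposite map, here `d'`.
    let L := FDMod.of k A (LinearMap.ker d)
    have hfst : ∀ x : LinearMap.ker g, ((x : E) : M × F1.twist F.nakayama).1 = 0 := fun x => x.2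
    have hdker : ∀ x : LinearMap.ker g,
        (F1.toTwist F.nakayama).symm ((x : E) : M × F1.twist F.nakayama).2 ∈ LinearMap.ker d := by
      intro x
      have h1 := hE x
      rw [hfst, map_zero] at h1
      exact h1.symm
    let e : LinearMap.ker g →ₗ[A] L.twist F.nakayama :=
      { toFun := fun x => L.toTwist F.nakayama ⟨_, hdker x⟩
        map_add' := fun x y => rfl
        map_smul' := fun a x => rfl }
    refine ⟨LinearEquiv.ofBijective e ⟨?_, ?_⟩⟩
    · intro x y hxy
      have h1 : ((x : E) : M × F1.twist F.nakayama).2 = ((y : E) : M × F1.twist F.nakayama).2 :=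
        congrArg Subtype.val hxy
      exact Subtype.ext (Subtype.ext (Prod.ext ((hfst x).trans (hfst y).symm) h1))
    · intro z
      obtain ⟨z, rfl⟩ := (L.toTwist F.nakayama).surjective z
      refine ⟨⟨⟨(0, F1.toTwist F.nakayama z), ?_⟩, rfl⟩, rfl⟩
      refine sub_eq_zero.2 ?_
      have h1 : d (z : Fin m → A) = 0 := z.2
      change ψ 0 = F0.toTwist F.nakayama (d z)
      rw [map_zero, h1, map_zero]

include F in
/-- An idempotent endomorphism of the second syzygy of an indecomposable module `M`, or its
complement, factors through a free module: it extends to the presentation of `M` and hence induces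
an endomorphism of `M`, and one of the two endomorphisms so obtained is nilpotent. -/
theorem exists_factorization_of_idempotent {M : FDMod k A} (hM : IsIndecomposable A M)
    (hproj : ¬ Module.Projective A M)
    (π : (Fin n → A) →ₗ[A] M) (hπ : Function.Surjective π) (hd : Function.Exact d π)
    (e : Module.End A (LinearMap.ker d)) (he : e * e = e) :
    (∃ (u : LinearMap.ker d →ₗ[A] (Fin m → A)) (v : (Fin m → A) →ₗ[A] LinearMap.ker d),
      v ∘ₗ u = e) ∨
    ∃ (u : LinearMap.ker d →ₗ[A] (Fin m → A)) (v : (Fin m → A) →ₗ[A] LinearMap.ker d),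
      v ∘ₗ u = 1 - e := by
  have := hM.1
  have hnoe : IsNoetherian A M := isNoetherian_of_tower k inferInstance
  have hart : IsArtinian A M := isArtinian_of_tower k inferInstance
  have hexact : ∀ y, π (d y) = 0 := fun y => (hd _).2 ⟨y, rfl⟩
  -- As free modules are injective, `e` extends to `A ^ m`, and from there to `A ^ n`.
  obtain ⟨e1, he1⟩ := F.exists_extension (LinearMap.ker d).subtype
    Subtype.val_injective ((LinearMap.ker d).subtype ∘ₗ e)
  have he1' : ∀ y : LinearMap.ker d, e1 y = e y := fun y => LinearMap.congr_fun he1 y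
  have hde1 : LinearMap.ker d ≤ LinearMap.ker (d ∘ₗ e1) := by
    intro y hy
    rw [LinearMap.mem_ker, LinearMap.comp_apply, he1' ⟨y, hy⟩]
    exact (e ⟨y, hy⟩).2
  obtain ⟨e0, he0⟩ := F.exists_extension
    ((LinearMap.ker d).liftQ d le_rfl)
    (LinearMap.ker_eq_bot.1 (Submodule.ker_liftQ_eq_bot _ _ _ le_rfl))
    ((LinearMap.ker d).liftQ (d ∘ₗ e1) hde1)
  have he0' : ∀ y, e0 (d y) = d (e1 y) := fun y => LinearMap.congr_fun he0 (Submodule.Quotient.mk y)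
  have hπe0 : LinearMap.ker π ≤ LinearMap.ker (π ∘ₗ e0) := by
    intro x hx
    obtain ⟨y, rfl⟩ := (hd x).1 hx
    rw [LinearMap.mem_ker, LinearMap.comp_apply, he0', hexact]
  let φ : Module.End A M := (LinearMap.ker π).liftQ (π ∘ₗ e0) hπe0 ∘ₗ
    (π.quotKerEquivOfSurjective hπ).symm.toLinearMap
  have hφ : ∀ x, φ (π x) = π (e0 x) := by
    intro x
    have h1 : (π.quotKerEquivOfSurjective hπ).symm (π x) = (LinearMap.ker π).mkQ x := by
      rw [LinearEquiv.symm_apply_eq]; rfl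
    simp only [φ, LinearMap.comp_apply, LinearEquiv.coe_coe, h1]
    rfl
  have key : ∀ (e : Module.End A (LinearMap.ker d)) (e1 : Module.End A (Fin m → A))
      (e0 : Module.End A (Fin n → A)) (φ : Module.End A M), e * e = e →
      (∀ y : LinearMap.ker d, e1 y = e y) → (∀ y, e0 (d y) = d (e1 y)) →
      (∀ x, φ (π x) = π (e0 x)) → IsNilpotent φ →
      ∃ (u : LinearMap.ker d →ₗ[A] (Fin m → A)) (v : (Fin m → A) →ₗ[A] LinearMap.ker d),
        v ∘ₗ u = e := by
    intro e e1 e0 φ he he1 he0 hφ ⟨r, hr⟩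
    have hp1 : ∀ (r : ℕ) (y : LinearMap.ker d), (e1 ^ r) y = (e ^ r) y := by
      intro r
      induction r with
      | zero => intro y; rfl
      | succ r ih => intro y; rw [pow_succ, pow_succ, Module.End.mul_apply, he1, ih]; rfl
    have hp0 : ∀ (r : ℕ) y, (e0 ^ r) (d y) = d ((e1 ^ r) y) := by
      intro r
      induction r with
      | zero => intro y; rfl
      | succ r ih =>
        intro y; rw [pow_succ, pow_succ, Module.End.mul_apply, he0, ih]; rfl
    have hpφ : ∀ (r : ℕ) x, (φ ^ r) (π x) = π ((e0 ^ r) x) := by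
      intro r
      induction r with
      | zero => intro y; rfl
      | succ r ih => intro y; rw [pow_succ, pow_succ, Module.End.mul_apply, hφ, ih]; rfl
    have her : ∀ r : ℕ, e ^ (r + 1) = e := fun r => IsIdempotentElem.pow_succ_eq r he
    -- As `φ` is nilpotent, a power of `e0` lifts along `d`: this is a null homotopy.
    have hr' : φ ^ (r + 1) = 0 := by rw [pow_succ, hr, zero_mul]
    have hmem : ∀ x, (e0 ^ (r + 1)) x ∈ LinearMap.range d := by
      intro x
      refine (hd _).1 ?_
      rw [← hpφ, hr', LinearMap.zero_apply]
    obtain ⟨s, hs⟩ := Module.projective_lifting_property d.rangeRestrict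
      ((e0 ^ (r + 1)).codRestrict _ hmem) d.surjective_rangeRestrict
    have hs' : ∀ x, d (s x) = (e0 ^ (r + 1)) x := fun x =>
      congrArg Subtype.val (LinearMap.congr_fun hs x)
    refine ⟨(LinearMap.ker d).subtype, (e1 ^ (r + 1) - s ∘ₗ d).codRestrict _ fun y => ?_, ?_⟩
    · rw [LinearMap.mem_ker, LinearMap.sub_apply, map_sub, LinearMap.comp_apply, hs', hp0, sub_self]
    · ext1 y
      apply Subtype.ext
      have h1 : d (y : Fin m → A) = 0 := y.2
      change (e1 ^ (r + 1)) y - s (d y) = e y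
      rw [h1, map_zero, sub_zero, hp1, her]
  have hloc := hM.isLocalRing_end k
  have hnil : ∀ φ : Module.End A M, ¬ IsUnit φ → IsNilpotent φ := by
    intro φ hφ
    obtain ⟨r, hr⟩ := Filter.eventually_atTop.1 (LinearMap.eventually_isCompl_ker_pow_range_pow φ)
    have hc := hr (r + 1) (by omega)
    rcases hM.2 _ _ hc with h0 | h0
    · exfalso
      have hinj : Function.Injective (φ ^ (r + 1)) := LinearMap.ker_eq_bot.1 h0
      rw [pow_succ, Module.End.mul_eq_comp] at hinj
      have hinj' : Function.Injective φ := Function.Injective.of_comp hinj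
      exact hφ ((Module.End.isUnit_iff φ).2 ⟨hinj', M.surjective_of_injective φ hinj'⟩)
    · exact ⟨r + 1, LinearMap.range_eq_bot.1 h0⟩
  by_cases hu : IsUnit φ
  · right
    refine key (1 - e) (1 - e1) (1 - e0) (1 - φ) ?_ ?_ ?_ ?_ (hnil _ fun h => ?_)
    · ext1 y
      have h1 : e (e y) = e y := LinearMap.congr_fun he y
      change y - e y - e (y - e y) = y - e y
      rw [map_sub, h1, sub_self, sub_zero]
    · intro y; simp [he1']
    · intro y; simp [he0']
    · intro y; simp [hφ]
    -- The chain map `e1 ^ 2 - e1` vanishes on the syzygy, so `φ ^ 2 - φ` factors through `A ^ n`.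
    have hw0 : LinearMap.ker d ≤ LinearMap.ker (e1 * e1 - e1) := by
      intro y hy
      have h1 := congrArg Subtype.val (LinearMap.congr_fun he ⟨y, hy⟩)
      rw [LinearMap.mem_ker, LinearMap.sub_apply, Module.End.mul_apply, he1' ⟨y, hy⟩, he1',
        sub_eq_zero]
      exact h1
    obtain ⟨w, hw⟩ := F.exists_extension ((LinearMap.ker d).liftQ d le_rfl)
      (LinearMap.ker_eq_bot.1 (Submodule.ker_liftQ_eq_bot _ _ _ le_rfl))
      ((LinearMap.ker d).liftQ (e1 * e1 - e1) hw0)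
    have hw' : ∀ y, w (d y) = e1 (e1 y) - e1 y := fun y =>
      LinearMap.congr_fun hw (Submodule.Quotient.mk y)
    have ht0 : LinearMap.ker π ≤ LinearMap.ker (e0 * e0 - e0 - d ∘ₗ w) := by
      intro x hx
      obtain ⟨y, rfl⟩ := (hd x).1 hx
      simp only [LinearMap.mem_ker, LinearMap.sub_apply, Module.End.mul_apply,
        LinearMap.comp_apply, hw', he0', map_sub, sub_self]
    let t : M →ₗ[A] (Fin n → A) := (LinearMap.ker π).liftQ _ ht0 ∘ₗ
      (π.quotKerEquivOfSurjective hπ).symm.toLinearMap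
    have ht : ∀ x, t (π x) = e0 (e0 x) - e0 x - d (w x) := by
      intro x
      have h1 : (π.quotKerEquivOfSurjective hπ).symm (π x) = (LinearMap.ker π).mkQ x := by
        rw [LinearEquiv.symm_apply_eq]; rfl
      simp only [t, LinearMap.comp_apply, LinearEquiv.coe_coe, h1]
      rfl
    have hπt : π ∘ₗ t = φ * (φ - 1) := by
      ext x
      obtain ⟨x, rfl⟩ := hπ x
      simp only [LinearMap.comp_apply, ht, map_sub, hexact, sub_zero, Module.End.mul_apply,
        LinearMap.sub_apply, Module.End.one_apply, hφ]
    have hu' : IsUnit (π ∘ₗ t : Module.End A M) := by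
      rw [hπt]
      refine hu.mul ?_
      rw [← neg_sub]
      exact h.neg
    exact hproj (projective_of_isSummand (isSummand_of_isUnit_comp t π hu'))
  · left
    exact key e e1 e0 φ he he1' he0' hφ (hnil φ hu)

/-- The Auslander-Reiten formula: up to projective summands, the initial term of the almost split
sequence terminating in `M` is the twisted second syzygy of `M`. -/
theorem exists_equiv_prod_projective {M N E : FDMod k A} (hM : IsIndecomposable A M)
    (hproj : ¬ Module.Projective A M) {f : N →ₗ[A] E} {g : E →ₗ[A] M} (hfg : IsAlmostSplitSeq f g)
    (π : (Fin n → A) →ₗ[A] M) (hπ : Function.Surjective π) (hd : Function.Exact d π) :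
    ∃ Z : FDMod k A, Module.Projective A Z ∧
      Nonempty ((FDMod.of k A (LinearMap.ker d)).twist F.nakayama ≃ₗ[A] N × Z) := by
  obtain ⟨E', g', hg', ⟨e⟩⟩ := F.exists_isRightAlmostSplit d hM π hπ hd
  obtain ⟨i, r, hir⟩ := (hfg.isSummand_ker g' hg').of_equiv A e
  have hri : ∀ x, r (i x) = x := fun x => LinearMap.congr_fun hir x
  refine ⟨FDMod.of k A (LinearMap.ker r), ?_, ⟨splitEquiv i r hir⟩⟩
  let L := FDMod.of k A (LinearMap.ker d)
  let F1 := FDMod.of k A (Fin m → A)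
  have hF1 : Module.Projective A (F1.twist F.nakayama) := projective_twist_free F.nakayama m
  let e : Module.End A (LinearMap.ker d) :=
    FDMod.untwistMap (N := L) (N' := L) F.nakayama (i ∘ₗ r)
  have he' : ∀ x, L.toTwist F.nakayama (e x) = i (r (L.toTwist F.nakayama x)) := fun x => rfl
  have he : e * e = e := by
    ext1 x
    apply (L.toTwist F.nakayama).injective
    rw [Module.End.mul_apply, he', he', hri]
  rcases F.exists_factorization_of_idempotent d hM hproj π hπ hd e he with
    ⟨u, v, huv⟩ | ⟨u, v, huv⟩
  · exfalso
    refine F.not_projective_of_isAlmostSplitSeq hfg (projective_of_isSummand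
      (Y := F1.twist F.nakayama)
      ⟨FDMod.twistMap (N := L) (N' := F1) F.nakayama u ∘ₗ i,
        r ∘ₗ FDMod.twistMap (N := F1) (N' := L) F.nakayama v, ?_⟩)
    ext x
    obtain ⟨y, hy⟩ := (L.toTwist F.nakayama).surjective (i x)
    have h1 : v (u y) = e y := LinearMap.congr_fun huv y
    simp only [LinearMap.comp_apply, ← hy, LinearMap.id_apply]
    rw [FDMod.twistMap_toTwist, FDMod.twistMap_toTwist, h1, he', hri, hy, hri]
  · let q : L.twist F.nakayama →ₗ[A] LinearMap.ker r :=
      (LinearMap.id - i ∘ₗ r).codRestrict _ fun x => by simp [hri]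
    refine projective_of_isSummand (Y := F1.twist F.nakayama)
      ⟨FDMod.twistMap (N := L) (N' := F1) F.nakayama u ∘ₗ (LinearMap.ker r).subtype,
        q ∘ₗ FDMod.twistMap (N := F1) (N' := L) F.nakayama v, ?_⟩
    ext x
    obtain ⟨y, hy⟩ := (L.toTwist F.nakayama).surjective (x : L.twist F.nakayama)
    have hx : r (x : L.twist F.nakayama) = 0 := x.2
    have h1 : v (u y) = (1 - e) y := LinearMap.congr_fun huv y
    have h2 : L.toTwist F.nakayama ((1 - e) y) = x := by
      rw [LinearMap.sub_apply, map_sub, he', hy, hx, map_zero, sub_zero, Module.End.one_apply, hy]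
    simp only [LinearMap.comp_apply, Submodule.subtype_apply, ← hy, LinearMap.id_apply]
    rw [FDMod.twistMap_toTwist, FDMod.twistMap_toTwist, h1, h2, hy]
    change (x : L.twist F.nakayama) - i (r x) = x
    rw [hx, map_zero, sub_zero]

end Presentation

end FrobeniusForm

/-! ### Integrals and the Frobenius form of a cocommutative Hopf algebra -/

section HopfIntegral

open Coalgebra HopfAlgebra WithConv

variable {k A : Type*} [Field k] [Ring A] [HopfAlgebra k A]

/-- The map `x ⊗ y ↦ φ y • x`. -/
noncomputable def sliceRight (φ : A →ₗ[k] k) : A ⊗[k] A →ₗ[k] A :=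
  (TensorProduct.rid k A).toLinearMap ∘ₗ φ.lTensor A

/-- The map `x ⊗ y ↦ φ x • y`. -/
noncomputable def sliceLeft (φ : A →ₗ[k] k) : A ⊗[k] A →ₗ[k] A :=
  (TensorProduct.lid k A).toLinearMap ∘ₗ φ.rTensor A

@[simp]
theorem sliceRight_tmul (φ : A →ₗ[k] k) (x y : A) : sliceRight φ (x ⊗ₜ[k] y) = φ y • x := by
  simp [sliceRight]

@[simp]
theorem sliceLeft_tmul (φ : A →ₗ[k] k) (x y : A) : sliceLeft φ (x ⊗ₜ[k] y) = φ x • y := by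
  simp [sliceLeft]

theorem sliceRight_tmul_one_mul (φ : A →ₗ[k] k) (x : A) (w : A ⊗[k] A) :
    sliceRight φ ((x ⊗ₜ[k] 1) * w) = x * sliceRight φ w := by
  induction w with
  | zero => simp
  | add a b ha hb => rw [mul_add, map_add, ha, hb, map_add, mul_add]
  | tmul a b => simp

theorem sliceRight_mul_tmul_one (φ : A →ₗ[k] k) (x : A) (w : A ⊗[k] A) :
    sliceRight φ (w * (x ⊗ₜ[k] 1)) = sliceRight φ w * x := by
  induction w with
  | zero => simp
  | add a b ha hb => rw [add_mul, map_add, ha, hb, map_add, add_mul]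
  | tmul a b => simp

theorem sliceRight_one_tmul_mul (φ : A →ₗ[k] k) (x : A) (w : A ⊗[k] A) :
    sliceRight φ ((1 ⊗ₜ[k] x) * w) = sliceRight (φ ∘ₗ LinearMap.mulLeft k x) w := by
  induction w with
  | zero => simp
  | add a b ha hb => rw [mul_add, map_add, ha, hb, map_add]
  | tmul a b => simp

theorem sliceRight_mul_one_tmul (φ : A →ₗ[k] k) (x : A) (w : A ⊗[k] A) :
    sliceRight φ (w * (1 ⊗ₜ[k] x)) = sliceRight (φ ∘ₗ LinearMap.mulRight k x) w := by
  induction w with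
  | zero => simp
  | add a b ha hb => rw [add_mul, map_add, ha, hb, map_add]
  | tmul a b => simp

theorem sliceRight_counit_comul (a : A) : sliceRight (counit (R := k)) (comul a) = a := by
  simp [sliceRight]

theorem sliceLeft_counit_comul (a : A) : sliceLeft (counit (R := k)) (comul a) = a := by
  simp [sliceLeft]

/-- The Sweedler identity `S(a₁) a₂ ⊗ a₃ = 1 ⊗ a`. -/
theorem mul_antipode_tmul_one_comul (a : A) :
    LinearMap.mul' k (A ⊗[k] A) (TensorProduct.map
      ((Algebra.TensorProduct.includeLeft (R := k) (S := k) (A := A) (B := A)).toLinearMap ∘ₗ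
        antipode k) comul (comul a)) = 1 ⊗ₜ[k] a := by
  let iL := (Algebra.TensorProduct.includeLeft (R := k) (S := k) (A := A) (B := A))
  let iR := (Algebra.TensorProduct.includeRight (R := k) (A := A) (B := A))
  have h1 : toConv (comul (R := k) (A := A)) = toConv iL.toLinearMap * toConv iR.toLinearMap := by
    ext x
    rw [(ℛ k x).convMul_apply]
    simp [iL, iR, (ℛ k x).eq]
  have h2 : toConv (iL.toLinearMap ∘ₗ antipode k) * toConv iL.toLinearMap = 1 := by
    ext x
    rw [(ℛ k x).convMul_apply]
    simp only [LinearMap.comp_apply, AlgHom.toLinearMap_apply, ← map_mul, ← map_sum,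
      sum_antipode_mul_eq_algebraMap_counit, LinearMap.convOne_apply, AlgHom.commutes]
  have h3 : toConv (iL.toLinearMap ∘ₗ antipode k) * toConv (comul (R := k) (A := A)) =
      toConv iR.toLinearMap := by rw [h1, ← mul_assoc, h2, one_mul]
  exact congrArg (fun f => f a) h3

/-- The Sweedler identity `a₁ ⊗ a₂ S(a₃) = a ⊗ 1`. -/
theorem mul_comul_one_tmul_antipode (a : A) :
    LinearMap.mul' k (A ⊗[k] A) (TensorProduct.map comul
      ((Algebra.TensorProduct.includeRight (R := k) (A := A) (B := A)).toLinearMap ∘ₗ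
        antipode k) (comul a)) = a ⊗ₜ[k] 1 := by
  let iL := (Algebra.TensorProduct.includeLeft (R := k) (S := k) (A := A) (B := A))
  let iR := (Algebra.TensorProduct.includeRight (R := k) (A := A) (B := A))
  have h1 : toConv (comul (R := k) (A := A)) = toConv iL.toLinearMap * toConv iR.toLinearMap := by
    ext x
    rw [(ℛ k x).convMul_apply]
    simp [iL, iR, (ℛ k x).eq]
  have h2 : toConv iR.toLinearMap * toConv (iR.toLinearMap ∘ₗ antipode k) = 1 := by
    ext x
    rw [(ℛ k x).convMul_apply]
    simp only [LinearMap.comp_apply, AlgHom.toLinearMap_apply, ← map_mul, ← map_sum,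
      sum_mul_antipode_eq_algebraMap_counit, LinearMap.convOne_apply, AlgHom.commutes]
  have h3 : toConv (comul (R := k) (A := A)) * toConv (iR.toLinearMap ∘ₗ antipode k) =
      toConv iL.toLinearMap := by rw [h1, mul_assoc, h2, mul_one]
  exact congrArg (fun f => f a) h3

/-- The antipode of a cocommutative Hopf algebra is an involution. -/
theorem antipode_antipode_of_isCocomm [IsCocomm k A] (a : A) :
    antipode k (antipode k a) = a := by
  have h1 : toConv (antipode k ∘ₗ antipode k) * toConv (antipode k (A := A)) = 1 := by
    ext x
    have hx : (LinearMap.mul' k A (TensorProduct.map LinearMap.id (antipode k)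
        (TensorProduct.comm k A A (comul x)))) = algebraMap k A (counit x) := by
      rw [comm_comul]
      exact mul_antipode_lTensor_comul_apply x
    rw [← (ℛ k x).eq] at hx
    rw [(ℛ k x).convMul_apply]
    simp only [map_sum, TensorProduct.comm_tmul, TensorProduct.map_tmul, LinearMap.mul'_apply,
      LinearMap.id_apply] at hx
    simp only [LinearMap.comp_apply, ← antipode_mul_antidistrib, ← map_sum, hx,
      LinearMap.convOne_apply]
    rw [Algebra.algebraMap_eq_smul_one, map_smul, antipode_one]
  have h2 : toConv (antipode k ∘ₗ antipode k) = toConv (LinearMap.id (R := k) (M := A)) :=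
    left_inv_eq_right_inv h1 LinearMap.antipode_mul_id
  exact congrArg (fun f => f a) h2

section Integral

variable {lam : A →ₗ[k] k} (hlam : ∀ a, sliceRight lam (comul a) = lam a • 1)

include hlam

/-- For an integral `lam`, `b₁ lam(a b₂) = S(a₁) lam(a₂ b)`. -/
theorem sliceRight_one_tmul_mul_comul (a b : A) :
    sliceRight lam ((1 ⊗ₜ[k] a) * comul b) =
      sliceRight (lam ∘ₗ LinearMap.mulRight k b) ((antipode k).rTensor A (comul a)) := by
  have key : ∀ w : A ⊗[k] A, sliceRight lam (LinearMap.mul' k (A ⊗[k] A) (TensorProduct.map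
      ((Algebra.TensorProduct.includeLeft (R := k) (S := k) (A := A) (B := A)).toLinearMap ∘ₗ
        antipode k) comul w) * comul b) =
      sliceRight (lam ∘ₗ LinearMap.mulRight k b) ((antipode k).rTensor A w) := by
    intro w
    induction w with
    | zero => simp
    | add x y hx hy => simp only [map_add, add_mul, hx, hy]
    | tmul x y =>
      simp only [TensorProduct.map_tmul, LinearMap.mul'_apply, LinearMap.comp_apply,
        AlgHom.toLinearMap_apply, Algebra.TensorProduct.includeLeft_apply, mul_assoc,
        ← Bialgebra.comul_mul, sliceRight_tmul_one_mul, hlam, LinearMap.rTensor_tmul,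
        sliceRight_tmul, LinearMap.mulRight_apply, mul_smul_comm, mul_one]
  rw [← key, mul_antipode_tmul_one_comul]

/-- For an integral `lam` on a cocommutative Hopf algebra, `a₁ lam(a₂ b) = lam(a b₁) S(b₂)`. -/
theorem sliceRight_comul_mul_one_tmul [IsCocomm k A] (a b : A) :
    sliceRight lam (comul a * (1 ⊗ₜ[k] b)) =
      antipode k (sliceLeft (lam ∘ₗ LinearMap.mulLeft k a) (comul b)) := by
  have key : ∀ w : A ⊗[k] A, sliceRight lam (comul a * Algebra.TensorProduct.comm k A A
      (LinearMap.mul' k (A ⊗[k] A) (TensorProduct.map comul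
        ((Algebra.TensorProduct.includeRight (R := k) (A := A) (B := A)).toLinearMap ∘ₗ
          antipode k) w))) =
      antipode k (sliceLeft (lam ∘ₗ LinearMap.mulLeft k a) w) := by
    intro w
    induction w with
    | zero => simp
    | add x y hx hy => simp only [map_add, mul_add, hx, hy]
    | tmul x y =>
      have hx : Algebra.TensorProduct.comm k A A (comul x) = comul x := comm_comul k x
      simp only [TensorProduct.map_tmul, LinearMap.mul'_apply, LinearMap.comp_apply,
        AlgHom.toLinearMap_apply, Algebra.TensorProduct.includeRight_apply, map_mul, hx,
        Algebra.TensorProduct.comm_tmul, ← mul_assoc, ← Bialgebra.comul_mul,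
        sliceRight_mul_tmul_one, hlam, sliceLeft_tmul, LinearMap.mulLeft_apply, map_smul,
        smul_mul_assoc, one_mul]
  rw [← key, mul_comul_one_tmul_antipode, Algebra.TensorProduct.comm_tmul]

/-- A nonzero integral is nondegenerate. The elements `b` with `lam (a * b) = 0` for all `a` form a
left ideal and a left coideal `J`; since `S(b₁) b₂ = ε(b)`, the counit vanishes on `J`, and
`b = b₁ ε(b₂)` does, too. -/
theorem eq_zero_of_integral_mul_eq_zero [Module.Finite k A] (h0 : lam ≠ 0) (b : A)
    (hb : ∀ a, lam (a * b) = 0) : b = 0 := by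
  have hslice : ∀ b, (∀ a, lam (a * b) = 0) → ∀ a,
      sliceRight (lam ∘ₗ LinearMap.mulLeft k a) (comul b) = 0 := by
    intro b hb a
    rw [← sliceRight_one_tmul_mul, sliceRight_one_tmul_mul_comul hlam]
    have : lam ∘ₗ LinearMap.mulRight k b = 0 := by
      ext x
      simpa using hb x
    rw [this]
    simp [sliceRight]
  let e := Module.finBasis k A
  -- Applying `lam (c * -)` to `S(b₁) b₂ = ε(b)` gives `lam c * ε(b) = 0`.
  have hcounit : ∀ b, (∀ a, lam (a * b) = 0) → counit (R := k) b = 0 := by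
    intro b hb
    have hh : ∀ (h : A →ₗ[k] A), lam (LinearMap.mul' k A (h.rTensor A (comul b))) = 0 := by
      intro h
      have hw : ∀ w : A ⊗[k] A, lam (LinearMap.mul' k A (h.rTensor A w)) =
          ∑ j, e.coord j (sliceRight (lam ∘ₗ LinearMap.mulLeft k (h (e j))) w) := by
        intro w
        induction w with
        | zero => simp
        | add x y hx hy => simp only [map_add, hx, hy, Finset.sum_add_distrib]
        | tmul x y =>
          simp only [LinearMap.rTensor_tmul, LinearMap.mul'_apply, sliceRight_tmul,
            LinearMap.comp_apply, LinearMap.mulLeft_apply, map_smul, smul_eq_mul]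
          conv_lhs => rw [← e.sum_repr x]
          simp only [map_sum, map_smul, Finset.sum_mul, smul_mul_assoc, smul_eq_mul]
          exact Finset.sum_congr rfl fun j _ => mul_comm _ _
      rw [hw]
      simp [hslice b hb]
    obtain ⟨c, hc⟩ : ∃ c, lam c ≠ 0 := by
      by_contra! h
      exact h0 (LinearMap.ext h)
    have h1 := hh (LinearMap.mulLeft k c ∘ₗ antipode k)
    have h2 : ∀ w : A ⊗[k] A, LinearMap.mul' k A
        ((LinearMap.mulLeft k c ∘ₗ antipode k).rTensor A w) =
        c * LinearMap.mul' k A ((antipode k).rTensor A w) := by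
      intro w
      induction w with
      | zero => simp
      | add x y hx hy => simp only [map_add, hx, hy, mul_add]
      | tmul x y => simp [mul_assoc]
    rw [h2, mul_antipode_rTensor_comul_apply, Algebra.algebraMap_eq_smul_one, mul_smul_comm,
      mul_one, map_smul, smul_eq_mul] at h1
    exact (mul_eq_zero.1 h1).resolve_right hc
  refine (Module.forall_dual_apply_eq_zero_iff k b).1 fun f => ?_
  have h1 : ∀ a, lam (a * sliceLeft f (comul b)) = 0 := by
    intro a
    have hw : ∀ w : A ⊗[k] A, lam (a * sliceLeft f w) =
        f (sliceRight (lam ∘ₗ LinearMap.mulLeft k a) w) := by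
      intro w
      induction w with
      | zero => simp
      | add x y hx hy => simp only [map_add, mul_add, hx, hy]
      | tmul x y => simp [mul_comm]
    rw [hw, hslice b hb, map_zero]
  have h2 := hcounit _ h1
  have hw : ∀ w : A ⊗[k] A, counit (R := k) (sliceLeft f w) =
      f (sliceRight (counit (R := k)) w) := by
    intro w
    induction w with
    | zero => simp
    | add x y hx hy => simp only [map_add, hx, hy]
    | tmul x y => simp [mul_comm]
  rwa [hw, sliceRight_counit_comul] at h2

end Integral

variable (k A) in
/-- A finite-dimensional cocommutative Hopf algebra has a nonzero integral: the dual is a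
commutative Artinian ring, so its maximal ideal `ker (f ↦ f 1)` is an associated prime. -/
theorem exists_integral [IsCocomm k A] [Module.Finite k A] :
    ∃ lam : A →ₗ[k] k, lam ≠ 0 ∧ ∀ a, sliceRight lam (comul a) = lam a • 1 := by
  let D := WithConv (A →ₗ[k] k)
  have hD : Module.Finite k D := Module.Finite.equiv (WithConv.linearEquiv k (A →ₗ[k] k)).symm
  have hart : IsArtinianRing D := IsArtinianRing.of_finite k D
  let ev : D →+* k :=
    { toFun := fun f => f 1
      map_one' := by simp
      map_zero' := rfl
      map_add' := fun _ _ => rfl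
      map_mul' := fun f g => by
        rw [LinearMap.convMul_apply, Bialgebra.comul_one, Algebra.TensorProduct.one_def]
        simp }
  have hsurj : Function.Surjective ev := fun c => ⟨c • (1 : D), by
    change c • ((1 : D) 1) = c
    simp⟩
  have hmax : (RingHom.ker ev).IsMaximal := RingHom.ker_isMaximal_of_surjective ev hsurj
  have hass : RingHom.ker ev ∈ associatedPrimes D D := by
    apply Module.associatedPrimes.minimalPrimes_annihilator_subset_associatedPrimes
    refine Ring.KrullDimLE.mem_minimalPrimes_iff.2 ⟨hmax.isPrime, fun f hf => ?_⟩
    have h1 : f = 0 := by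
      have := Module.mem_annihilator.1 hf 1
      rwa [smul_eq_mul, mul_one] at this
    rw [h1]
    exact Submodule.zero_mem _
  obtain ⟨lam, hlam⟩ := (isAssociatedPrime_iff.1 hass).2
  have hmem : ∀ f : D, ev f = 0 ↔ f * lam = 0 := fun f => by
    rw [← RingHom.mem_ker, hlam, Submodule.mem_colon_singleton, Submodule.mem_bot, smul_eq_mul]
  have hmul : ∀ f : D, f * lam = f 1 • lam := by
    intro f
    have h1 := (hmem (f - f 1 • (1 : D))).1 (by
      change f 1 - f 1 • ((1 : D) 1) = 0
      simp)
    rwa [sub_mul, smul_mul_assoc, one_mul, sub_eq_zero] at h1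
  refine ⟨lam.ofConv, fun h => ?_, fun a => ?_⟩
  · have h0 : lam = 0 := WithConv.ofConv_injective h
    have h1 := (hmem 1).2 (by rw [h0, mul_zero])
    rw [map_one] at h1
    exact one_ne_zero h1
  · rw [← sub_eq_zero]
    refine (Module.forall_dual_apply_eq_zero_iff k _).1 fun f => ?_
    have h1 : (toConv f * lam) a = f 1 • lam a := congrArg (fun g : D => g a) (hmul (toConv f))
    have hw : ∀ w : A ⊗[k] A, f (sliceRight lam.ofConv w) =
        LinearMap.mul' k k (TensorProduct.map f lam.ofConv w) := by
      intro w
      induction w with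
      | zero => simp
      | add x y hx hy => simp only [map_add, hx, hy]
      | tmul x y => simp [mul_comm]
    rw [map_sub, hw, map_smul, sub_eq_zero]
    rw [LinearMap.convMul_apply] at h1
    rw [smul_eq_mul, mul_comm] at h1 ⊢
    exact h1.trans (mul_comm _ _)

/-- The algebra endomorphism `a ↦ χ(a₁) a₂` given by a character `χ`. -/
noncomputable def characterTwist (χ : A →ₐ[k] k) : A →ₐ[k] A :=
  (Algebra.TensorProduct.lid k A).toAlgHom.comp
    ((Algebra.TensorProduct.map χ (AlgHom.id k A)).comp (Bialgebra.comulAlgHom k A))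

theorem characterTwist_apply (χ : A →ₐ[k] k) (a : A) :
    characterTwist χ a = sliceLeft χ.toLinearMap (comul a) := rfl

variable (k A) in
/-- A finite-dimensional cocommutative Hopf algebra has a Frobenius form, an integral `lam`, whose
Nakayama automorphism is the twist by the modular character. If `Lam` is the element with
`lam (b * Lam) = ε b`, this is the character `χ` with `Lam * a = χ a • Lam`. -/
theorem exists_frobeniusForm [IsCocomm k A] [Module.Finite k A] :
    ∃ (F : FrobeniusForm k A) (χ : A →ₐ[k] k), ∀ a, F.nakayama a = characterTwist χ a := by
  obtain ⟨lam, h0, hlam⟩ := exists_integral k A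
  have hnd := eq_zero_of_integral_mul_eq_zero hlam h0
  have hfin : Module.finrank k A = Module.finrank k (Module.Dual k A) :=
    Subspace.dual_finrank_eq.symm
  have hex : ∀ f : Module.Dual k A, ∃ b, ∀ a, lam (a * b) = f a := by
    intro f
    obtain ⟨b, hb⟩ := (LinearMap.injective_iff_surjective_of_finrank_eq_finrank hfin).1
      ((injective_iff_map_eq_zero ((LinearMap.mul k A).flip.compr₂ lam)).2 fun b hb =>
        hnd b fun a => LinearMap.congr_fun hb a) f
    exact ⟨b, fun a => LinearMap.congr_fun hb a⟩
  have hnd' : ∀ b, (∀ a, lam (b * a) = 0) → b = 0 := by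
    intro b hb
    refine (Module.forall_dual_apply_eq_zero_iff k b).1 fun f => ?_
    obtain ⟨a, ha⟩ := hex f
    rw [← ha, hb]
  have hex' : ∀ f : Module.Dual k A, ∃ b, ∀ a, lam (b * a) = f a := by
    intro f
    obtain ⟨b, hb⟩ := (LinearMap.injective_iff_surjective_of_finrank_eq_finrank hfin).1
      ((injective_iff_map_eq_zero ((LinearMap.mul k A).compr₂ lam)).2 fun b hb =>
        hnd' b fun a => LinearMap.congr_fun hb a) f
    exact ⟨b, fun a => LinearMap.congr_fun hb a⟩
  obtain ⟨Lam, hLam⟩ := hex (counit (R := k))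
  have hleft : ∀ a, a * Lam = counit (R := k) a • Lam := by
    intro a
    rw [← sub_eq_zero]
    refine hnd _ fun b => ?_
    rw [mul_sub, map_sub, ← mul_assoc, hLam, mul_smul_comm, map_smul, hLam, Bialgebra.counit_mul,
      smul_eq_mul, mul_comm, sub_self]
  have hright : ∀ a, Lam * a = lam (Lam * a) • Lam := by
    intro a
    rw [← sub_eq_zero]
    refine hnd _ fun b => ?_
    rw [mul_sub, map_sub, ← mul_assoc, hleft, mul_smul_comm, map_smul, hLam, smul_mul_assoc,
      map_smul, smul_eq_mul, smul_eq_mul, mul_comm, sub_self]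
  have hone : lam Lam = 1 := by simpa using hLam 1
  let χ : A →ₐ[k] k := AlgHom.ofLinearMap (lam ∘ₗ LinearMap.mulLeft k Lam) (by simpa using hone)
    (fun x y => by
      simp only [LinearMap.comp_apply, LinearMap.mulLeft_apply]
      rw [← mul_assoc, hright x, smul_mul_assoc, map_smul, map_smul, smul_eq_mul, hone,
        smul_eq_mul, mul_one])
  have hχ : χ.toLinearMap = lam ∘ₗ LinearMap.mulLeft k Lam := rfl
  have hsliceS : ∀ a, sliceRight (lam ∘ₗ LinearMap.mulLeft k a) (comul Lam) = antipode k a := by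
    intro a
    rw [← sliceRight_one_tmul_mul, sliceRight_one_tmul_mul_comul hlam]
    have h1 : lam ∘ₗ LinearMap.mulRight k Lam = counit (R := k) := LinearMap.ext fun b => hLam b
    have h2 : ∀ w : A ⊗[k] A, sliceRight (counit (R := k)) ((antipode k).rTensor A w) =
        antipode k (sliceRight (counit (R := k)) w) := by
      intro w
      induction w with
      | zero => simp
      | add x y hx hy => simp only [map_add, hx, hy]
      | tmul x y => simp
    rw [h1, h2, sliceRight_counit_comul]
  -- The map `f ↦ Lam₁ f(Lam₂)` is injective, since `Lam₁ lam(a Lam₂) = S(a)`.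
  have hinj : ∀ f : A →ₗ[k] k, sliceRight f (comul Lam) = 0 → f = 0 := by
    intro f hf
    obtain ⟨b, hb⟩ := hex' f
    have h1 : f = lam ∘ₗ LinearMap.mulLeft k b := LinearMap.ext fun a => (hb a).symm
    rw [h1, hsliceS] at hf
    have h2 : b = 0 := by rw [← antipode_antipode_of_isCocomm (k := k) b, hf, map_zero]
    rw [h1, h2]
    ext a
    simp
  have hsub : ∀ (f g : A →ₗ[k] k) (w : A ⊗[k] A),
      sliceRight (f - g) w = sliceRight f w - sliceRight g w := by
    intro f g w
    simp [sliceRight, LinearMap.lTensor_sub]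
  have hnak : ∀ a b, lam (characterTwist χ a * b) = lam (b * a) := by
    intro a b
    have h1 : lam ∘ₗ LinearMap.mulLeft k (characterTwist χ a) - lam ∘ₗ LinearMap.mulRight k a =
        0 := by
      apply hinj
      rw [hsub, hsliceS, ← sliceRight_mul_one_tmul, sliceRight_comul_mul_one_tmul hlam, ← hχ,
        characterTwist_apply, sub_self]
    exact sub_eq_zero.1 (LinearMap.congr_fun h1 b)
  have hbij : Function.Bijective (characterTwist χ) := by
    have hi : Function.Injective (characterTwist χ).toLinearMap := by
      rw [injective_iff_map_eq_zero]
      intro a ha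
      refine hnd a fun b => ?_
      have ha' : characterTwist χ a = 0 := ha
      rw [← hnak, ha', zero_mul, map_zero]
    exact ⟨hi, LinearMap.surjective_of_injective hi⟩
  exact ⟨⟨lam, AlgEquiv.ofBijective _ hbij, hnak, hnd⟩, χ, fun _ => rfl⟩

end HopfIntegral

/-! ### Characters are trivial on unipotent subgroups -/

section Unipotent

open Coalgebra

variable {k : Type u} {A : Type v} [Field k] [Ring A] [HopfAlgebra k A]
variable {K : Type w} [Field K] [Algebra k K]

/-- The extension of a character to a field extension. -/
noncomputable def extCharacter (K : Type w) [Field K] [Algebra k K] (χ : A →ₐ[k] k) :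
    K ⊗[k] A →ₐ[K] K :=
  Algebra.TensorProduct.lift (Algebra.ofId K K) ((Algebra.ofId k K).comp χ)
    fun _ _ => mul_comm _ _

theorem baseChange_characterTwist (χ : A →ₐ[k] k) (x : K ⊗[k] A) :
    Algebra.TensorProduct.map (AlgHom.id K K) (characterTwist χ) x =
      sliceLeft (extCharacter K χ).toLinearMap (comul x) := by
  induction x with
  | zero => simp
  | add x y hx hy => simp only [map_add, hx, hy]
  | tmul c a =>
    rw [Algebra.TensorProduct.map_tmul, characterTwist_apply, TensorProduct.comul_tmul,
      CommSemiring.comul_apply]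
    generalize comul (R := k) a = z
    induction z with
    | zero => simp
    | add x y hx hy => simp only [map_add, TensorProduct.tmul_add, hx, hy]
    | tmul x y =>
      simp [extCharacter, Algebra.ofId_apply, Algebra.smul_def]
      rw [← Algebra.smul_def, ← Algebra.smul_def, TensorProduct.tmul_smul,
        TensorProduct.smul_tmul']

/-- A character restricts to the counit on the algebra of measures of a unipotent subgroup. -/
theorem IsUnipotentSub.character_eq_counit {C : Type v} [Ring C] [HopfAlgebra K C]
    {B : Subalgebra K C} (hB : IsUnipotentSub B) (χ : C →ₐ[K] K) (b : C) (hb : b ∈ B) :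
    χ b = counit (R := K) b := by
  let _ : Module B K := Module.compHom K ((χ.comp B.val) : B →+* K)
  have hsmul : ∀ (b : B) (x : K), b • x = χ b * x := fun _ _ => rfl
  have : IsScalarTower K B K := ⟨fun c b x => by
    rw [hsmul, hsmul, Subalgebra.coe_smul, map_smul, smul_mul_assoc]⟩
  obtain ⟨x, hx, h⟩ := hB K
  have := h ⟨b, hb⟩
  rw [hsmul, smul_eq_mul] at this
  exact mul_right_cancel₀ hx this

/-- The twist by a character is the identity on the algebras of measures of unipotent subgroups. -/
theorem baseChange_characterTwist_eq_self (χ : A →ₐ[k] k) {B : Subalgebra K (K ⊗[k] A)}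
    (hB : IsHopfSubalgebra B) (hu : IsUnipotentSub B) (b : K ⊗[k] A) (hb : b ∈ B) :
    Algebra.TensorProduct.map (AlgHom.id K K) (characterTwist χ) b = b := by
  rw [baseChange_characterTwist]
  have h1 : ∀ w : B ⊗[K] B, sliceLeft (extCharacter K χ).toLinearMap
      (TensorProduct.map B.val.toLinearMap B.val.toLinearMap w) =
      sliceLeft (counit (R := K)) (TensorProduct.map B.val.toLinearMap B.val.toLinearMap w) := by
    intro w
    induction w with
    | zero => simp
    | add x y hx hy => simp only [map_add, hx, hy]
    | tmul x y =>
      simp [hu.character_eq_counit (extCharacter K χ) _ x.2]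
  obtain ⟨w, hw⟩ := hB.comul_mem b hb
  rw [← hw, h1, hw, sliceLeft_counit_comul]

end Unipotent

/-! ### Syzygies -/

section Syzygies

variable {R : Type*} [Ring R]

/-- Schanuel's lemma for direct summands: if `Y` is a direct summand of `Z`, a syzygy of `Y` is, up
to a projective module, a direct summand of any syzygy of `Z`. -/
theorem isSummand_ker_prod {Y Z P Q : Type*} [AddCommGroup Y] [Module R Y] [AddCommGroup Z]
    [Module R Z] [AddCommGroup P] [Module R P] [AddCommGroup Q] [Module R Q]
    [Module.Projective R P] [Module.Projective R Q] (f : P →ₗ[R] Y) (hf : Function.Surjective f)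
    (g : Q →ₗ[R] Z) (hg : Function.Surjective g) (h : IsSummand R Y Z) :
    IsSummand R (LinearMap.ker f) (LinearMap.ker g × P) := by
  obtain ⟨i, r, hir⟩ := h
  have hri : ∀ x, r (i x) = x := fun x => LinearMap.congr_fun hir x
  obtain ⟨a, ha⟩ := Module.projective_lifting_property g (i ∘ₗ f) hg
  obtain ⟨b, hb⟩ := Module.projective_lifting_property f (r ∘ₗ g) hf
  have ha' : ∀ x, g (a x) = i (f x) := fun x => LinearMap.congr_fun ha x
  have hb' : ∀ x, f (b x) = r (g x) := fun x => LinearMap.congr_fun hb x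
  let a0 : LinearMap.ker f →ₗ[R] LinearMap.ker g :=
    (a ∘ₗ (LinearMap.ker f).subtype).codRestrict _ fun x => by
      have : f (x : P) = 0 := x.2
      simp [ha', this]
  let b0 : LinearMap.ker g →ₗ[R] LinearMap.ker f :=
    (b ∘ₗ (LinearMap.ker g).subtype).codRestrict _ fun x => by
      have : g (x : Q) = 0 := x.2
      simp [hb', this]
  let c : P →ₗ[R] LinearMap.ker f := (LinearMap.id - b ∘ₗ a).codRestrict _ fun x => by
    simp [ha', hb', hri]
  refine ⟨a0.prod (LinearMap.ker f).subtype, b0.coprod c, ?_⟩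
  ext x
  change b (a x) + ((x : P) - b (a x)) = x
  abel

/-- Second syzygies of the same module are direct summands of each other, up to a projective
module. -/
theorem isSummand_secondSyzygy {V L L' G₀ G₁ H₀ H₁ : Type*} [AddCommGroup V] [Module R V]
    [AddCommGroup L] [Module R L] [AddCommGroup L'] [Module R L'] [AddCommGroup G₀] [Module R G₀]
    [AddCommGroup G₁] [Module R G₁] [AddCommGroup H₀] [Module R H₀] [AddCommGroup H₁] [Module R H₁]
    [Module.Projective R G₀] [Module.Projective R G₁] [Module.Projective R H₀]
    [Module.Projective R H₁] (π : G₀ →ₗ[R] V) (hπ : Function.Surjective π) (d : G₁ →ₗ[R] G₀)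
    (hd : Function.Exact d π) (e : L ≃ₗ[R] LinearMap.ker d) (π' : H₀ →ₗ[R] V)
    (hπ' : Function.Surjective π') (d' : H₁ →ₗ[R] H₀) (hd' : Function.Exact d' π')
    (e' : L' ≃ₗ[R] LinearMap.ker d') : IsSummand R L (L' × G₁) := by
  have h1 := isSummand_ker_prod π hπ π' hπ' (LinearEquiv.refl R V).isSummand
  let δ : G₁ →ₗ[R] LinearMap.ker π := d.codRestrict _ fun x => (hd _).2 ⟨x, rfl⟩
  have hδ : Function.Surjective δ := fun x => by
    obtain ⟨y, hy⟩ := (hd x).1 x.2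
    exact ⟨y, Subtype.ext hy⟩
  let δ' : H₁ →ₗ[R] LinearMap.ker π' := d'.codRestrict _ fun x => (hd' _).2 ⟨x, rfl⟩
  have hδ' : Function.Surjective δ' := fun x => by
    obtain ⟨y, hy⟩ := (hd' x).1 x.2
    exact ⟨y, Subtype.ext hy⟩
  have h2 := isSummand_ker_prod δ hδ (δ'.prodMap (LinearMap.id : G₀ →ₗ[R] G₀))
    (hδ'.prodMap Function.surjective_id) h1
  have e1 : L ≃ₗ[R] LinearMap.ker δ :=
    e.trans (LinearEquiv.ofEq _ _ (LinearMap.ker_codRestrict _ _ _).symm)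
  have e2 : LinearMap.ker (δ'.prodMap (LinearMap.id : G₀ →ₗ[R] G₀)) ≃ₗ[R] L' := by
    refine (LinearEquiv.ofBijective (((LinearMap.fst R H₁ G₀).domRestrict _).codRestrict
      (LinearMap.ker d') ?_) ⟨?_, ?_⟩).trans e'.symm
    · rintro ⟨⟨x, y⟩, hx⟩
      exact congrArg Subtype.val (Prod.ext_iff.1 hx).1
    · rintro ⟨⟨x, y⟩, hx⟩ ⟨⟨x', y'⟩, hx'⟩ h
      have hy : y = 0 := (Prod.ext_iff.1 hx).2
      have hy' : y' = 0 := (Prod.ext_iff.1 hx').2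
      have hxx : x = x' := congrArg Subtype.val h
      subst hy hy' hxx
      rfl
    · rintro ⟨x, hx⟩
      refine ⟨⟨(x, 0), ?_⟩, rfl⟩
      exact Prod.ext (Subtype.ext hx) rfl
  exact e1.isSummand.trans (h2.of_equiv R (e2.prodCongr (LinearEquiv.refl R G₁)))

end Syzygies

/-! ### Modules over truncated polynomial rings -/

section Truncated

variable {p : ℕ} {K : Type w} [Field K] {R : Type*} [CommRing R] [Algebra K R]

variable (K) in
/-- The element `t` of the `K`-algebra `R` identifies `R` with `K[T] / (T ^ p)`: its powers span
`R` (stated as an induction principle), its `p`-th power is zero, and the coefficient of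
`t ^ (p - 1)` is a well-defined functional. -/
structure IsTruncVar (p : ℕ) (t : R) : Prop where
  pow_eq_zero : t ^ p = 0
  induction {P : R → Prop} (add : ∀ r s, P r → P s → P (r + s))
    (smul_pow : ∀ (c : K) (n : ℕ), P (c • t ^ n)) (r : R) : P r
  finrank_eq : Module.finrank K R = p
  exists_coeff : ∃ φ : R →ₗ[K] K, ∀ n, φ (t ^ n) = if p - 1 = n then 1 else 0

section Resolution

variable {t : R}
variable {V : Type v} [AddCommGroup V] [Module K V] [Module R V] [IsScalarTower K R V]
variable {W : Type*} [AddCommGroup W] [Module K W] [Module R W] [IsScalarTower K R W]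

/-- A `K`-linear map that commutes with the action of a generator of `R` is `R`-linear. -/
def IsTruncVar.linear (ht : IsTruncVar K p t) (f : V →ₗ[K] W) (h : ∀ v, f (t • v) = t • f v) :
    V →ₗ[R] W where
  toFun := f
  map_add' := map_add f
  map_smul' r v := by
    rw [RingHom.id_apply]
    refine ht.induction (P := fun r => f (r • v) = r • f v) (fun r s hr hs => ?_)
      (fun c n => ?_) r
    · rw [add_smul, map_add, hr, hs, add_smul]
    · rw [smul_assoc, map_smul, smul_assoc]
      congr 1
      induction n with
      | zero => simp
      | succ n ih => rw [pow_succ', mul_smul, h, ih, mul_smul]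

variable (K V)

/-- The endomorphism `t ⊗ 1 - 1 ⊗ t` of `R ⊗ V`. -/
noncomputable def diffVar (t : R) : R ⊗[K] V →ₗ[R] R ⊗[K] V :=
  t • LinearMap.id - LinearMap.baseChange R (Algebra.lsmul K K V t)

theorem diffVar_tmul (t r : R) (v : V) :
    diffVar K V t (r ⊗ₜ v) = (t * r) ⊗ₜ v - r ⊗ₜ (t • v) := by
  simp [diffVar, TensorProduct.smul_tmul']

variable (R) in
/-- The action map `R ⊗ V → V`. -/
noncomputable def evalVar : R ⊗[K] V →ₗ[R] V :=
  LinearMap.liftBaseChange R (LinearMap.id : V →ₗ[K] V)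

theorem evalVar_tmul (r : R) (v : V) : evalVar K R V (r ⊗ₜ v) = r • v := by
  simp [evalVar]

theorem evalVar_surjective : Function.Surjective (evalVar K R V) := fun v =>
  ⟨1 ⊗ₜ v, by rw [evalVar_tmul, one_smul]⟩

/-- The map `v ↦ ∑ t ^ i ⊗ t ^ (p - 1 - i) v`, which identifies `V` with the kernel of `diffVar`. -/
noncomputable def kerDiffVar (p : ℕ) (t : R) : V →ₗ[K] R ⊗[K] V :=
  ∑ i ∈ Finset.range p, TensorProduct.mk K R V (t ^ i) ∘ₗ Algebra.lsmul K K V (t ^ (p - 1 - i))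

theorem kerDiffVar_apply (t : R) (v : V) : kerDiffVar K V p t v =
    ∑ i ∈ Finset.range p, (t ^ i) ⊗ₜ (t ^ (p - 1 - i) • v) := by
  simp only [kerDiffVar, LinearMap.sum_apply, LinearMap.comp_apply, TensorProduct.mk_apply,
    Algebra.lsmul_coe]

namespace IsTruncVar

variable {K}
variable (ht : IsTruncVar K p t)
include ht

/-- Modulo the range of `t ⊗ 1 - 1 ⊗ t`, each `z` equals `1 ⊗ evalVar z`. -/
theorem exact_diffVar_evalVar : Function.Exact (diffVar K V t) (evalVar K R V) := by
  rw [LinearMap.exact_iff]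
  apply le_antisymm
  · intro z hz
    have key : ∀ z : R ⊗[K] V, z - 1 ⊗ₜ (evalVar K R V z) ∈ LinearMap.range (diffVar K V t) := by
      intro z
      induction z with
      | zero => simp
      | add x y hx hy =>
        rw [map_add, TensorProduct.tmul_add, add_sub_add_comm]
        exact add_mem hx hy
      | tmul r v =>
        rw [evalVar_tmul]
        refine ht.induction (P := fun r => r ⊗ₜ[K] v - 1 ⊗ₜ[K] (r • v) ∈
          LinearMap.range (diffVar K V t)) (fun r s hr hs => ?_) (fun c n => ?_) r
        · rw [TensorProduct.add_tmul, add_smul, TensorProduct.tmul_add, add_sub_add_comm]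
          exact add_mem hr hs
        · have h0 : (c • t ^ n) ⊗ₜ[K] v - 1 ⊗ₜ[K] ((c • t ^ n) • v) =
              algebraMap K R c • ((t ^ n) ⊗ₜ[K] v - 1 ⊗ₜ[K] (t ^ n • v)) := by
            rw [smul_sub, TensorProduct.smul_tmul', TensorProduct.smul_tmul', smul_eq_mul,
              smul_eq_mul, ← Algebra.smul_def, ← Algebra.smul_def, smul_assoc,
              TensorProduct.tmul_smul, TensorProduct.smul_tmul' c (1 : R)]
          rw [h0]
          refine Submodule.smul_mem _ _ ?_
          clear h0
          induction n generalizing v with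
          | zero => simp
          | succ n ih =>
            have h1 := ih (t • v)
            have h2 : diffVar K V t ((t ^ n) ⊗ₜ v) ∈ LinearMap.range (diffVar K V t) := ⟨_, rfl⟩
            rw [diffVar_tmul, ← pow_succ'] at h2
            have h3 := add_mem h2 h1
            rwa [sub_add_sub_cancel, ← mul_smul, ← pow_succ] at h3
    have h1 := key z
    rwa [LinearMap.mem_ker.1 hz, TensorProduct.tmul_zero, sub_zero] at h1
  · rintro _ ⟨z, rfl⟩
    rw [LinearMap.mem_ker]
    induction z with
    | zero => simp
    | add x y hx hy => rw [map_add, map_add, hx, hy, add_zero]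
    | tmul r v =>
      rw [diffVar_tmul, map_sub, evalVar_tmul, evalVar_tmul, mul_comm, mul_smul, sub_self]

theorem kerDiffVar_smul (v : V) : kerDiffVar K V p t (t • v) = t • kerDiffVar K V p t v := by
  let f : ℕ → R ⊗[K] V := fun i => (t ^ i) ⊗ₜ (t ^ (p - i) • v)
  have h1 : ∑ i ∈ Finset.range p, f i = ∑ i ∈ Finset.range p, f (i + 1) := by
    have h2 := Finset.sum_range_succ f p
    have h3 := Finset.sum_range_succ' f p
    have h4 : f 0 = 0 := by simp [f, ht.pow_eq_zero]
    have h5 : f p = 0 := by simp [f, ht.pow_eq_zero]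
    rw [h5, add_zero] at h2
    rw [h4, add_zero] at h3
    rw [← h2, h3]
  rw [kerDiffVar_apply, kerDiffVar_apply, Finset.smul_sum]
  refine (Finset.sum_congr rfl fun i hi => ?_).trans
    (h1.trans (Finset.sum_congr rfl fun i hi => ?_))
  · rw [Finset.mem_range] at hi
    simp only [f]
    rw [← mul_smul, ← pow_succ, show p - 1 - i + 1 = p - i by omega]
  · rw [Finset.mem_range] at hi
    simp only [f]
    rw [TensorProduct.smul_tmul', smul_eq_mul, ← pow_succ', show p - 1 - i = p - (i + 1) by omega]

theorem diffVar_kerDiffVar (v : V) : diffVar K V t (kerDiffVar K V p t v) = 0 := by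
  have h1 := ht.kerDiffVar_smul V v
  rw [kerDiffVar_apply, kerDiffVar_apply, Finset.smul_sum] at h1
  rw [kerDiffVar_apply, map_sum]
  simp only [diffVar_tmul, Finset.sum_sub_distrib]
  rw [sub_eq_zero]
  refine Eq.trans ?_ (h1.symm.trans ?_)
  · exact Finset.sum_congr rfl fun i _ => by rw [TensorProduct.smul_tmul', smul_eq_mul]
  · exact Finset.sum_congr rfl fun i _ => by rw [smul_comm]

theorem kerDiffVar_injective [NeZero p] : Function.Injective (kerDiffVar K V p t) := by
  rw [injective_iff_map_eq_zero]
  intro v hv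
  obtain ⟨φ, hφ⟩ := ht.exists_coeff
  have h1 := congrArg (TensorProduct.lid K V ∘ φ.rTensor V) hv
  rw [kerDiffVar_apply] at h1
  simp only [Function.comp_apply, map_sum, LinearMap.rTensor_tmul, hφ,
    TensorProduct.lid_tmul, map_zero, ite_smul, one_smul, zero_smul] at h1
  have hp := NeZero.pos p
  rw [Finset.sum_eq_single (p - 1)] at h1
  · simpa using h1
  · intro i _ hi
    rw [if_neg (Ne.symm hi)]
  · intro h
    exact absurd (Finset.mem_range.2 (by omega)) h

theorem finite [NeZero p] : Module.Finite K R :=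
  Module.finite_of_finrank_pos (by rw [ht.finrank_eq]; exact NeZero.pos p)

/-- Periodicity: the second syzygy of `V` over `K[T] / (T ^ p)` is `V`. -/
theorem nonempty_equiv_ker_diffVar [NeZero p] [Module.Finite K V] :
    Nonempty (V ≃ₗ[R] LinearMap.ker (diffVar K V t)) := by
  have := ht.finite
  let s : V →ₗ[R] LinearMap.ker (diffVar K V t) :=
    (ht.linear (kerDiffVar K V p t) (ht.kerDiffVar_smul V)).codRestrict _ (ht.diffVar_kerDiffVar V)
  have hs : Function.Injective s := fun x y hxy =>
    ht.kerDiffVar_injective V (congrArg Subtype.val hxy)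
  have h1 := LinearMap.finrank_range_add_finrank_ker ((diffVar K V t).restrictScalars K)
  have h2 := LinearMap.finrank_range_add_finrank_ker ((evalVar K R V).restrictScalars K)
  have h3 : LinearMap.ker ((evalVar K R V).restrictScalars K) =
      LinearMap.range ((diffVar K V t).restrictScalars K) := by
    ext z
    exact ht.exact_diffVar_evalVar V z
  have h4 : LinearMap.range ((evalVar K R V).restrictScalars K) = ⊤ :=
    LinearMap.range_eq_top.2 (evalVar_surjective K V)
  rw [h3, h4, finrank_top] at h2
  have h5 : Module.finrank K V = Module.finrank K (LinearMap.ker (diffVar K V t)) := by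
    change _ = Module.finrank K (LinearMap.ker ((diffVar K V t).restrictScalars K))
    omega
  have h6 := LinearMap.injective_iff_surjective_of_finrank_eq_finrank (K := K) (V := V)
    (V₂ := LinearMap.ker (diffVar K V t)) h5 (f := s.restrictScalars K)
  have hs' : Function.Surjective (s.restrictScalars K) := h6.1 hs
  exact ⟨LinearEquiv.ofBijective s ⟨hs, hs'⟩⟩

end IsTruncVar

end Resolution

/-! ### Jordan blocks -/

section JordanBlocks

variable {t : R} (ht : IsTruncVar K p t)

theorem isIndecomposable_quotient_of_isLocalRing [IsLocalRing R] (I : Ideal R) (hI : I ≠ ⊤) :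
    IsIndecomposable R (R ⧸ I) := by
  have : Nontrivial (R ⧸ I) := Ideal.Quotient.nontrivial_iff.2 hI
  apply isIndecomposable_of_isLocalRing_end
  refine IsLocalRing.of_surjective' (R := R) (Module.toModuleEnd R (R ⧸ I)) fun φ => ?_
  obtain ⟨r, hr⟩ := Ideal.Quotient.mk_surjective (φ 1)
  refine ⟨r, ?_⟩
  ext
  change r • (1 : R ⧸ I) = φ 1
  rw [← hr, Algebra.smul_def, mul_one]
  rfl

namespace IsTruncVar
include ht

theorem span_pow_ne_top [NeZero p] {i : ℕ} (hi : 1 ≤ i) : Ideal.span {t ^ i} ≠ ⊤ := by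
  intro h
  rw [Ideal.span_singleton_eq_top, isUnit_pow_iff (by omega)] at h
  have h1 := h.pow p
  rw [ht.pow_eq_zero, isUnit_zero_iff] at h1
  have h2 := ht.finrank_eq
  have := subsingleton_of_zero_eq_one h1
  rw [Module.finrank_zero_of_subsingleton] at h2
  exact NeZero.ne p h2.symm

theorem isIndecomposable_block [NeZero p] [IsLocalRing R] {i : ℕ} (hi : 1 ≤ i) :
    IsIndecomposable R (R ⧸ Ideal.span {t ^ i}) :=
  isIndecomposable_quotient_of_isLocalRing _ (ht.span_pow_ne_top hi)

theorem pow_ne_zero [NeZero p] {i : ℕ} (hi : i < p) : t ^ i ≠ 0 := by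
  intro h
  have h1 : t ^ (p - 1) = 0 := by
    rw [show p - 1 = i + (p - 1 - i) by omega, pow_add, h, zero_mul]
  obtain ⟨φ, hφ⟩ := ht.exists_coeff
  have h2 := hφ (p - 1)
  rw [h1, map_zero, if_pos rfl] at h2
  exact zero_ne_one h2

/-- The Jordan blocks of size less than `p` are not projective, as they are not faithful. -/
theorem not_projective_block [NeZero p] [IsLocalRing R] {i : ℕ} (hi : 1 ≤ i) (hip : i < p) :
    ¬ Module.Projective R (R ⧸ Ideal.span {t ^ i}) := by
  intro h
  have hnt : Nontrivial (R ⧸ Ideal.span {t ^ i}) :=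
    Ideal.Quotient.nontrivial_iff.2 (ht.span_pow_ne_top hi)
  have hfree : Module.Free R (R ⧸ Ideal.span {t ^ i}) := Module.free_of_flat_of_isLocalRing
  have hfaith : FaithfulSMul R (R ⧸ Ideal.span {t ^ i}) := inferInstance
  refine ht.pow_ne_zero hip (hfaith.eq_of_smul_eq_smul (α := R ⧸ Ideal.span {t ^ i}) fun x => ?_)
  rw [zero_smul]
  obtain ⟨x, rfl⟩ := Ideal.Quotient.mk_surjective x
  rw [Algebra.smul_def, Ideal.Quotient.algebraMap_eq, ← map_mul, Ideal.Quotient.eq_zero_iff_mem]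
  exact Ideal.mul_mem_right _ _ (Ideal.mem_span_singleton_self _)

theorem nonempty_block_equiv : Nonempty ((R ⧸ Ideal.span {t ^ p}) ≃ₗ[R] R) := by
  refine ⟨Submodule.quotEquivOfEqBot _ ?_⟩
  rw [Ideal.span_singleton_eq_bot]
  exact ht.pow_eq_zero

theorem finrank_block_self : Module.finrank K (R ⧸ Ideal.span {t ^ p}) = p := by
  obtain ⟨e⟩ := ht.nonempty_block_equiv
  rw [(e.restrictScalars K).finrank_eq, ht.finrank_eq]

section Mult

variable [NeZero p] [IsLocalRing R]
variable {V : Type v} [AddCommGroup V] [Module K V] [Module R V] [IsScalarTower K R V]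
  [Module.Finite K V]
variable {W : Type u} [AddCommGroup W] [Module K W] [Module R W] [IsScalarTower K R W]
  [Module.Finite K W]

theorem summandMult_block_eq_zero [Module.Projective R V] {i : ℕ} (hi : 1 ≤ i) (hip : i < p) :
    summandMult R (R ⧸ Ideal.span {t ^ i}) V = 0 := by
  have := ht.finite
  have := (ht.isIndecomposable_block hi).1
  by_contra h
  exact ht.not_projective_block hi hip (projective_of_isSummand
    ((summandMult_pos_iff K).1 (Nat.pos_of_ne_zero h)))

theorem mul_summandMult_block_le :
    p * summandMult R (R ⧸ Ideal.span {t ^ p}) V ≤ Module.finrank K V := by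
  have := ht.finite
  have := (ht.isIndecomposable_block (NeZero.one_le (n := p))).1
  have h := summandMult_mul_finrank_le K (R := R) (X := R ⧸ Ideal.span {t ^ p}) (Y := V)
  rwa [ht.finrank_block_self, mul_comm] at h

theorem mul_summandMult_block_of_projective [Module.Projective R V] :
    p * summandMult R (R ⧸ Ideal.span {t ^ p}) V = Module.finrank K V := by
  have := ht.finite
  have := (ht.isIndecomposable_block (NeZero.one_le (n := p))).1
  refine le_antisymm ht.mul_summandMult_block_le ?_
  have : Module.Finite R V := Module.Finite.of_restrictScalars_finite K R V
  have hfree : Module.Free R V := Module.free_of_flat_of_isLocalRing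
  obtain ⟨e⟩ := ht.nonempty_block_equiv
  have e1 : (Fin (Module.finrank R V) → (R ⧸ Ideal.span {t ^ p})) ≃ₗ[R] V :=
    (LinearEquiv.piCongrRight fun _ => e).trans (Module.finBasis R V).equivFun.symm
  have h1 := le_summandMult K e1.isSummand
  have h2 : Module.finrank K V = Module.finrank R V * p := by
    rw [← (e1.restrictScalars K).finrank_eq, Module.finrank_pi_fintype, Finset.sum_const,
      Finset.card_univ, Fintype.card_fin, smul_eq_mul, ht.finrank_block_self]
  rw [h2, mul_comm]
  exact Nat.mul_le_mul_left p h1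

theorem summandMult_block_prod {i : ℕ} (hi : 1 ≤ i) :
    summandMult R (R ⧸ Ideal.span {t ^ i}) (V × W) =
      summandMult R (R ⧸ Ideal.span {t ^ i}) V + summandMult R (R ⧸ Ideal.span {t ^ i}) W := by
  have := ht.finite
  exact summandMult_prod K (ht.isIndecomposable_block hi)

omit ht in
theorem summandMult_block_le_of_isSummand (ht : IsTruncVar K p t) {i : ℕ} (hi : 1 ≤ i)
    (h : IsSummand R V W) :
    summandMult R (R ⧸ Ideal.span {t ^ i}) V ≤ summandMult R (R ⧸ Ideal.span {t ^ i}) W := by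
  have := ht.finite
  have := (ht.isIndecomposable_block hi).1
  exact summandMult_le_of_isSummand K h

/-- The dimension of the non-projective part is monotone. -/
theorem finrank_sub_le_of_isSummand (h : IsSummand R V W) :
    Module.finrank K V - p * summandMult R (R ⧸ Ideal.span {t ^ p}) V ≤
      Module.finrank K W - p * summandMult R (R ⧸ Ideal.span {t ^ p}) W := by
  obtain ⟨Z, ⟨e⟩⟩ := h.exists_equiv
  have h1 := ht.summandMult_block_prod (V := V) (W := Z) (NeZero.one_le (n := p))
  rw [summandMult_congr R _ e, h1, (e.restrictScalars K).finrank_eq, Module.finrank_prod]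
  have h2 := ht.mul_summandMult_block_le (V := V)
  have h3 := ht.mul_summandMult_block_le (V := Z)
  rw [mul_add]
  omega

theorem finrank_sub_prod_projective [Module.Projective R W] :
    Module.finrank K (V × W) - p * summandMult R (R ⧸ Ideal.span {t ^ p}) (V × W) =
      Module.finrank K V - p * summandMult R (R ⧸ Ideal.span {t ^ p}) V := by
  rw [ht.summandMult_block_prod (NeZero.one_le (n := p)), Module.finrank_prod, mul_add,
    ht.mul_summandMult_block_of_projective (V := W)]
  omega

end Mult

/-- The non-projective part of the second syzygy of `V` over `K[T] / (T ^ p)` has the same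
multiplicities of Jordan blocks, and the same dimension, as that of `V`. -/
theorem summandMult_secondSyzygy [NeZero p] [IsLocalRing R]
    {V : Type v} [AddCommGroup V] [Module K V] [Module R V] [IsScalarTower K R V]
    [Module.Finite K V]
    {L : Type v} [AddCommGroup L] [Module K L] [Module R L] [IsScalarTower K R L]
    [Module.Finite K L]
    {G₀ : Type v} [AddCommGroup G₀] [Module R G₀]
    {G₁ : Type v} [AddCommGroup G₁] [Module K G₁] [Module R G₁] [IsScalarTower K R G₁]
    [Module.Finite K G₁] [Module.Projective R G₀] [Module.Projective R G₁]
    (π : G₀ →ₗ[R] V) (hπ : Function.Surjective π) (d : G₁ →ₗ[R] G₀) (hd : Function.Exact d π)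
    (e : L ≃ₗ[R] LinearMap.ker d) :
    (∀ i, 1 ≤ i → i < p → summandMult R (R ⧸ Ideal.span {t ^ i}) L =
      summandMult R (R ⧸ Ideal.span {t ^ i}) V) ∧
    Module.finrank K L - p * summandMult R (R ⧸ Ideal.span {t ^ p}) L =
      Module.finrank K V - p * summandMult R (R ⧸ Ideal.span {t ^ p}) V := by
  have := ht.finite
  obtain ⟨e'⟩ := ht.nonempty_equiv_ker_diffVar V
  have h1 : IsSummand R L (V × G₁) := isSummand_secondSyzygy π hπ d hd e (evalVar K R V)
    (evalVar_surjective K V) (diffVar K V t) (ht.exact_diffVar_evalVar V) e'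
  have h2 : IsSummand R V (L × (R ⊗[K] V)) := isSummand_secondSyzygy (evalVar K R V)
    (evalVar_surjective K V) (diffVar K V t) (ht.exact_diffVar_evalVar V) e' π hπ d hd e
  refine ⟨fun i hi hip => le_antisymm ?_ ?_, le_antisymm ?_ ?_⟩
  · refine (summandMult_block_le_of_isSummand ht hi h1).trans ?_
    rw [ht.summandMult_block_prod hi, ht.summandMult_block_eq_zero (V := G₁) hi hip, add_zero]
  · refine (summandMult_block_le_of_isSummand ht hi h2).trans ?_
    rw [ht.summandMult_block_prod hi, ht.summandMult_block_eq_zero (V := R ⊗[K] V) hi hip, add_zero]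
  · exact (ht.finrank_sub_le_of_isSummand h1).trans_eq ht.finrank_sub_prod_projective
  · exact (ht.finrank_sub_le_of_isSummand h2).trans_eq ht.finrank_sub_prod_projective

end IsTruncVar

end JordanBlocks

end Truncated

section TruncPoly

open Polynomial

variable (p : ℕ) (K : Type w) [Field K]

/-- The class of the variable in `K[T] / (T ^ p)`. -/
noncomputable abbrev truncVar : TruncPoly p K := Ideal.Quotient.mk _ X

theorem isTruncVar_truncVar [NeZero p] : IsTruncVar K p (truncVar p K) where
  pow_eq_zero := by
    rw [← map_pow, Ideal.Quotient.eq_zero_iff_mem]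
    exact Ideal.mem_span_singleton_self _
  induction {P} hadd hpow r := by
    obtain ⟨f, rfl⟩ := Ideal.Quotient.mk_surjective r
    induction f using Polynomial.induction_on' with
    | add f g hf hg => rw [map_add]; exact hadd _ _ hf hg
    | monomial n c =>
      have : Ideal.Quotient.mk (Ideal.span {(X : K[X]) ^ p}) (monomial n c) =
          c • truncVar p K ^ n := by
        rw [← map_pow, ← smul_X_eq_monomial]
        rfl
      rw [this]
      exact hpow c n
  finrank_eq := by rw [finrank_quotient_span_eq_natDegree, natDegree_X_pow]
  exists_coeff := by
    refine ⟨((Ideal.span {(X : K[X]) ^ p}).restrictScalars K).liftQ (lcoeff K (p - 1))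
      fun a ha => ?_, fun n => ?_⟩
    · have hp := NeZero.pos p
      obtain ⟨b, rfl⟩ := Ideal.mem_span_singleton.1 ha
      rw [LinearMap.mem_ker, lcoeff_apply, coeff_X_pow_mul', if_neg (by omega)]
    · rw [← map_pow]
      change (X ^ n : K[X]).coeff (p - 1) = _
      rw [coeff_X_pow]

/-- The residue map `T ↦ 0`. -/
noncomputable def truncResidue [NeZero p] : TruncPoly p K →+* K :=
  Ideal.Quotient.lift _ (evalRingHom (0 : K)) fun a ha => by
    obtain ⟨b, rfl⟩ := Ideal.mem_span_singleton.1 ha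
    simp [NeZero.ne p]

instance [NeZero p] : IsLocalRing (TruncPoly p K) := by
  have : IsLocalHom (truncResidue p K) := by
    refine ⟨fun a ha => ?_⟩
    obtain ⟨f, rfl⟩ := Ideal.Quotient.mk_surjective a
    have h0 : f.eval 0 ≠ 0 := IsUnit.ne_zero ha
    have hcop : IsCoprime f (X ^ p : K[X]) := by
      refine IsCoprime.pow_right ?_
      rw [isCoprime_comm, (irreducible_X (R := K)).coprime_iff_not_dvd, X_dvd_iff]
      rwa [← coeff_zero_eq_eval_zero] at h0
    obtain ⟨a, b, hab⟩ := hcop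
    refine IsUnit.of_mul_eq_one (Ideal.Quotient.mk _ a) ?_
    rw [← map_mul, ← map_one (Ideal.Quotient.mk _), Ideal.Quotient.mk_eq_mk_iff_sub_mem,
      Ideal.mem_span_singleton]
    exact ⟨-b, by linear_combination hab⟩
  exact RingHom.domain_isLocalRing (truncResidue p K)

end TruncPoly

/-! ### Pull-back along a `π`-point -/

namespace PiPoint

section Functor

variable {p : ℕ} {K : Type w} {k A : Type u} [Field k] [Ring A] [HopfAlgebra k A]
  [Field K] [Algebra k K] (α : PiPoint p K k A)

noncomputable instance (M : FDMod k A) : Module K (α.Pull M) :=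
  inferInstanceAs (Module K (K ⊗[k] M))

instance (M : FDMod k A) : Module.Finite K (α.Pull M) :=
  inferInstanceAs (Module.Finite K (K ⊗[k] M))

theorem smul_pull (M : FDMod k A) (r : TruncPoly p K) (x : α.Pull M) :
    r • x = M.extAction K (α.toAlgHom r) x := rfl

instance (M : FDMod k A) : IsScalarTower K (TruncPoly p K) (α.Pull M) where
  smul_assoc c r x := by
    rw [smul_pull, map_smul, map_smul]
    rfl

theorem finrank_pull (M : FDMod k A) : Module.finrank K (α.Pull M) = Module.finrank k M :=
  Module.finrank_baseChange

theorem pullMap_apply {M N : FDMod k A} (f : M →ₗ[A] N) (x : α.Pull M) :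
    α.pullMap f x = (f.restrictScalars k).lTensor K x := rfl

theorem pullMap_add {M N : FDMod k A} (f g : M →ₗ[A] N) :
    α.pullMap (f + g) = α.pullMap f + α.pullMap g := by
  ext x
  rw [LinearMap.add_apply, pullMap_apply, pullMap_apply, pullMap_apply]
  exact LinearMap.congr_fun (LinearMap.lTensor_add K (f.restrictScalars k) (g.restrictScalars k)) x

theorem pullMap_zero (M N : FDMod k A) : α.pullMap (0 : M →ₗ[A] N) = 0 := by
  ext x
  exact LinearMap.congr_fun (LinearMap.lTensor_zero K) x

theorem pullMap_id (M : FDMod k A) : α.pullMap (LinearMap.id : M →ₗ[A] M) = LinearMap.id := by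
  ext x
  exact LinearMap.congr_fun (LinearMap.lTensor_id K M) x

theorem pullMap_comp {L M N : FDMod k A} (g : M →ₗ[A] N) (f : L →ₗ[A] M) :
    α.pullMap (g ∘ₗ f) = α.pullMap g ∘ₗ α.pullMap f := by
  ext x
  exact LinearMap.congr_fun (LinearMap.lTensor_comp K (g.restrictScalars k)
    (f.restrictScalars k)) x

theorem pullMap_injective {M N : FDMod k A} {f : M →ₗ[A] N} (hf : Function.Injective f) :
    Function.Injective (α.pullMap f) :=
  Module.Flat.lTensor_preserves_injective_linearMap (M := K) (f.restrictScalars k) hf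

theorem pullMap_surjective {M N : FDMod k A} {f : M →ₗ[A] N} (hf : Function.Surjective f) :
    Function.Surjective (α.pullMap f) :=
  LinearMap.lTensor_surjective K (g := f.restrictScalars k) hf

theorem pullMap_exact {L M N : FDMod k A} {f : L →ₗ[A] M} {g : M →ₗ[A] N}
    (h : Function.Exact f g) : Function.Exact (α.pullMap f) (α.pullMap g) :=
  Module.Flat.lTensor_exact K (f := f.restrictScalars k) (g := g.restrictScalars k) h

/-- The pull-back functor preserves kernels. -/
noncomputable def pullKerEquiv {L M N : FDMod k A} {f : L →ₗ[A] M} {g : M →ₗ[A] N}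
    (hf : Function.Injective f) (h : Function.Exact f g) :
    α.Pull L ≃ₗ[TruncPoly p K] LinearMap.ker (α.pullMap g) :=
  (LinearEquiv.ofInjective _ (α.pullMap_injective hf)).trans
    (LinearEquiv.ofEq _ _ (α.pullMap_exact h).linearMap_ker_eq.symm)

/-- The pull-back functor preserves direct sums. -/
noncomputable def pullProdEquiv {X Y Z : FDMod k A} (e : Z ≃ₗ[A] X × Y) :
    α.Pull Z ≃ₗ[TruncPoly p K] α.Pull X × α.Pull Y :=
  LinearEquiv.ofLinearMap
    ((α.pullMap (LinearMap.fst A X Y ∘ₗ e.toLinearMap : Z →ₗ[A] X)).prod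
      (α.pullMap (LinearMap.snd A X Y ∘ₗ e.toLinearMap : Z →ₗ[A] Y)))
    ((α.pullMap (e.symm.toLinearMap ∘ₗ LinearMap.inl A X Y : X →ₗ[A] Z)).coprod
      (α.pullMap (e.symm.toLinearMap ∘ₗ LinearMap.inr A X Y : Y →ₗ[A] Z)))
    (by
      have h : ∀ {M N : FDMod k A} (f : M →ₗ[A] Z) (g : Z →ₗ[A] N) (x : α.Pull M),
          α.pullMap g (α.pullMap f x) = α.pullMap (g ∘ₗ f) x := fun f g x => by
        rw [pullMap_comp]; rfl
      have h1 : (LinearMap.fst A X Y ∘ₗ e.toLinearMap) ∘ₗ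
          (e.symm.toLinearMap ∘ₗ LinearMap.inl A X Y) = LinearMap.id := by ext; simp
      have h2 : (LinearMap.snd A X Y ∘ₗ e.toLinearMap) ∘ₗ
          (e.symm.toLinearMap ∘ₗ LinearMap.inl A X Y) = 0 := by ext; simp
      have h3 : (LinearMap.fst A X Y ∘ₗ e.toLinearMap) ∘ₗ
          (e.symm.toLinearMap ∘ₗ LinearMap.inr A X Y) = 0 := by ext; simp
      have h4 : (LinearMap.snd A X Y ∘ₗ e.toLinearMap) ∘ₗ
          (e.symm.toLinearMap ∘ₗ LinearMap.inr A X Y) = LinearMap.id := by ext; simp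
      refine LinearMap.ext fun ⟨x, y⟩ => ?_
      refine Prod.ext ?_ ?_
      · change α.pullMap _ (α.pullMap _ x + α.pullMap _ y) = x
        rw [map_add, h, h, h1, h3, pullMap_id, pullMap_zero]
        exact add_zero x
      · change α.pullMap _ (α.pullMap _ x + α.pullMap _ y) = y
        rw [map_add, h, h, h2, h4, pullMap_id, pullMap_zero]
        exact zero_add y)
    (by
      refine LinearMap.ext fun x => ?_
      have h : (e.symm.toLinearMap ∘ₗ LinearMap.inl A X Y) ∘ₗ (LinearMap.fst A X Y ∘ₗ e.toLinearMap)
          + (e.symm.toLinearMap ∘ₗ LinearMap.inr A X Y) ∘ₗ (LinearMap.snd A X Y ∘ₗ e.toLinearMap)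
          = LinearMap.id := by
        ext z
        simp [← map_add]
      have h1 := LinearMap.congr_fun (congrArg α.pullMap h) x
      rw [pullMap_add, pullMap_comp, pullMap_comp, pullMap_id] at h1
      exact h1)

end Functor

section Projective

variable {p : ℕ} [NeZero p] {K : Type w} {k A : Type u} [Field k] [Ring A] [HopfAlgebra k A]
  [Field K] [Algebra k K] (α : PiPoint p K k A)

instance finite_pull (M : FDMod k A) : Module.Finite (TruncPoly p K) (α.Pull M) :=
  Module.Finite.of_restrictScalars_finite K _ _

theorem extAction_self [Module.Finite k A] (a b : K ⊗[k] A) :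
    (FDMod.of k A A).extAction K a b = a * b := by
  induction a with
  | zero => rw [map_zero, zero_mul]; rfl
  | add a a' h h' => rw [map_add, LinearMap.add_apply, h, h', add_mul]
  | tmul c a =>
    induction b with
    | zero => rw [map_zero, mul_zero]
    | add b b' h h' => rw [map_add, h, h', mul_add]
    | tmul d b =>
      rw [Algebra.TensorProduct.tmul_mul_tmul]
      exact (FDMod.of k A A).ext_smul_tmul K c d a b

theorem projective_pull_self [Module.Finite k A] :
    Module.Projective (TruncPoly p K) (α.Pull (FDMod.of k A A)) := by
  have := α.flat
  let e : Pullback α.toAlgHom.toRingHom (K ⊗[k] A) ≃ₗ[TruncPoly p K] α.Pull (FDMod.of k A A) :=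
    { toFun := fun x => x
      invFun := fun x => x
      map_add' := fun _ _ => rfl
      map_smul' := fun r x => (extAction_self (α.toAlgHom r) x).symm
      left_inv := fun _ => rfl
      right_inv := fun _ => rfl }
  have : Module.Flat (TruncPoly p K) (α.Pull (FDMod.of k A A)) := Module.Flat.of_linearEquiv e.symm
  have : Module.Free (TruncPoly p K) (α.Pull (FDMod.of k A A)) :=
    Module.free_of_flat_of_isLocalRing
  infer_instance

theorem projective_pull_free [Module.Finite k A] (n : ℕ) :
    Module.Projective (TruncPoly p K) (α.Pull (FDMod.of k A (Fin n → A))) := by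
  induction n with
  | zero =>
    have : Subsingleton (α.Pull (FDMod.of k A (Fin 0 → A))) :=
      inferInstanceAs (Subsingleton (K ⊗[k] (Fin 0 → A)))
    infer_instance
  | succ n ih =>
    have := α.projective_pull_self
    exact Module.Projective.of_equiv (α.pullProdEquiv (X := FDMod.of k A A)
      (Y := FDMod.of k A (Fin n → A)) (Z := FDMod.of k A (Fin (n + 1) → A))
      (Fin.consLinearEquiv A fun _ => A).symm).symm

theorem projective_pull [Module.Finite k A] (P : FDMod k A) [hP : Module.Projective A P] :
    Module.Projective (TruncPoly p K) (α.Pull P) := by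
  obtain ⟨n, π, hπ⟩ := exists_free_surjective k A P
  obtain ⟨s, hs⟩ := Module.projective_lifting_property π LinearMap.id hπ
  have := α.projective_pull_free n
  exact Module.Projective.of_split (α.pullMap (N := FDMod.of k A (Fin n → A)) s)
    (α.pullMap (M := FDMod.of k A (Fin n → A)) π) (α.pullMap_id_comp _ _ hs)

end Projective

section Twist

variable {p : ℕ} {K : Type w} {k A : Type u} [Field k] [Ring A] [HopfAlgebra k A]
  [Field K] [Algebra k K] (α : PiPoint p K k A)

theorem extAction_twist (σ : A ≃ₐ[k] A) (N : FDMod k A) (a : K ⊗[k] A) (x : K ⊗[k] N) :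
    (N.twist σ).extAction K a ((N.toTwist σ).toLinearMap.lTensor K x) =
      (N.toTwist σ).toLinearMap.lTensor K
        (N.extAction K (Algebra.TensorProduct.map (AlgHom.id K K) (σ : A →ₐ[k] A) a) x) := by
  induction a with
  | zero => simp
  | add a a' h h' => simp only [map_add, LinearMap.add_apply, h, h']
  | tmul c a =>
    induction x with
    | zero => simp
    | add b b' h h' => simp only [map_add, h, h']
    | tmul d b =>
      have h1 := N.ext_smul_tmul K c d (σ a) b
      have h2 := (N.twist σ).ext_smul_tmul K c d a (N.toTwist σ b)
      have h1' : N.extAction K (c ⊗ₜ[k] σ a) (d ⊗ₜ[k] b) = (c * d) ⊗ₜ[k] (σ a • b) := h1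
      have h2' : (N.twist σ).extAction K (c ⊗ₜ[k] a) (d ⊗ₜ[k] N.toTwist σ b) =
        (c * d) ⊗ₜ[k] (a • N.toTwist σ b) := h2
      rw [LinearMap.lTensor_tmul, Algebra.TensorProduct.map_tmul]
      refine h2'.trans ?_
      rw [FDMod.smul_toTwist]
      exact ((congrArg ((N.toTwist σ).toLinearMap.lTensor K) h1').trans
        (LinearMap.lTensor_tmul _ _ _ _)).symm

/-- The pull-back along a `π`-point does not see the twist by a character, as characters of
unipotent groups are trivial. -/
theorem nonempty_pull_twist_equiv (σ : A ≃ₐ[k] A) (χ : A →ₐ[k] k)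
    (hσ : ∀ a, σ a = characterTwist χ a) (N : FDMod k A) :
    Nonempty (α.Pull (N.twist σ) ≃ₗ[TruncPoly p K] α.Pull N) := by
  obtain ⟨B, hB, -, hu, hα⟩ := α.exists_subgroup
  have hσ' : (σ : A →ₐ[k] A) = characterTwist χ := AlgHom.ext hσ
  let e : K ⊗[k] N ≃ₗ[k] K ⊗[k] N.twist σ := (N.toTwist σ).lTensor K
  refine ⟨LinearEquiv.symm
    { toFun := fun x => e x
      invFun := fun x => e.symm x
      map_add' := fun x y => map_add e x y
      map_smul' := fun r x => ?_
      left_inv := e.symm_apply_apply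
      right_inv := e.apply_symm_apply }⟩
  have h1 := extAction_twist σ N (α.toAlgHom r) x
  have h2 : α.toAlgHom r ∈ B := hα ⟨r, rfl⟩
  rw [hσ', baseChange_characterTwist_eq_self χ hB hu _ h2] at h1
  exact h1.symm

end Twist

section Invariants

variable {p : ℕ} [NeZero p] {K : Type w} {k A : Type u} [Field k] [Ring A] [HopfAlgebra k A]
  [Field K] [Algebra k K] (α : PiPoint p K k A)

theorem mul_jordanMult_le (M : FDMod k A) : p * α.jordanMult p M ≤ Module.finrank k M := by
  rw [← α.finrank_pull]
  exact (isTruncVar_truncVar p K).mul_summandMult_block_le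

theorem jordanMult_of_equiv_prod {X Y Z : FDMod k A} {i : ℕ} (hi : 1 ≤ i)
    (e : α.Pull Z ≃ₗ[TruncPoly p K] α.Pull X × α.Pull Y) :
    α.jordanMult i Z = α.jordanMult i X + α.jordanMult i Y :=
  (summandMult_congr _ _ e).trans ((isTruncVar_truncVar p K).summandMult_block_prod hi)

theorem isSumAdditive_jordanMult {i : ℕ} (hi : 1 ≤ i) : IsSumAdditive (α.jordanMult i) :=
  fun _ _ _ ⟨e⟩ => α.jordanMult_of_equiv_prod hi (α.pullProdEquiv e)

variable [Module.Finite k A]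

theorem jordanMult_eq_zero_of_projective {P : FDMod k A} (hP : Module.Projective A P) {i : ℕ}
    (hi : 1 ≤ i) (hip : i < p) : α.jordanMult i P = 0 := by
  have := α.projective_pull P
  exact (isTruncVar_truncVar p K).summandMult_block_eq_zero hi hip

theorem mul_jordanMult_of_projective {P : FDMod k A} (hP : Module.Projective A P) :
    p * α.jordanMult p P = Module.finrank k P := by
  have := α.projective_pull P
  rw [← α.finrank_pull]
  exact (isTruncVar_truncVar p K).mul_summandMult_block_of_projective

/-- The first and the last term of an almost split sequence pull back to modules with the same
non-projective Jordan blocks: the first term is the twisted second syzygy of the last one, the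
pull-back ignores the twist, and second syzygies over `K[T] / (T ^ p)` are the identity, up to
projective summands. -/
theorem jordanMult_initial_eq [Coalgebra.IsCocomm k A] {N E M : FDMod k A}
    (hM : IsIndecomposable A M) (hproj : ¬ Module.Projective A M) {f : N →ₗ[A] E} {g : E →ₗ[A] M}
    (h : IsAlmostSplitSeq f g) :
    (∀ i, 1 ≤ i → i < p → α.jordanMult i N = α.jordanMult i M) ∧
      Module.finrank k N - p * α.jordanMult p N = Module.finrank k M - p * α.jordanMult p M := by
  obtain ⟨F, χ, hχ⟩ := exists_frobeniusForm k A
  obtain ⟨n, m, π, d, hπ, hd⟩ := exists_free_presentation k A M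
  let F₀ := FDMod.of k A (Fin n → A)
  let F₁ := FDMod.of k A (Fin m → A)
  let L := FDMod.of k A (LinearMap.ker d)
  obtain ⟨Z, hZ, ⟨e⟩⟩ := F.exists_equiv_prod_projective d hM hproj h π hπ hd
  obtain ⟨e'⟩ := α.nonempty_pull_twist_equiv F.nakayama χ hχ L
  have := α.projective_pull_free n
  have := α.projective_pull_free m
  -- Pull-back turns the presentation of `M` into one of its pull-back, with second syzygy `L`.
  have hker : Function.Exact (LinearMap.ker d).subtype d := LinearMap.exact_subtype_ker_map d
  obtain ⟨h1, h2⟩ := (isTruncVar_truncVar p K).summandMult_secondSyzygy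
    (α.pullMap (M := F₀) π) (α.pullMap_surjective hπ) (α.pullMap (M := F₁) (N := F₀) d)
    (α.pullMap_exact hd)
    (α.pullKerEquiv (L := L) (M := F₁) (N := F₀) (LinearMap.ker d).injective_subtype hker)
  have h3 : ∀ i, 1 ≤ i → α.jordanMult i L = α.jordanMult i N + α.jordanMult i Z := fun i hi =>
    α.jordanMult_of_equiv_prod hi (e'.symm.trans (α.pullProdEquiv e))
  have h4 : Module.finrank k L = Module.finrank k N + Module.finrank k Z := by
    rw [((L.toTwist F.nakayama).trans (e.restrictScalars k)).finrank_eq, Module.finrank_prod]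
  constructor
  · intro i hi hip
    have h5 := h3 i hi
    rw [α.jordanMult_eq_zero_of_projective hZ hi hip, add_zero] at h5
    exact h5.symm.trans (h1 i hi hip)
  · have h5 := h2
    rw [α.finrank_pull, α.finrank_pull] at h5
    have h6 := α.mul_jordanMult_of_projective hZ
    have h7 : Module.finrank k L - p * α.jordanMult p L =
      Module.finrank k M - p * α.jordanMult p M := h5
    rw [← h7, h4, h3 p (NeZero.one_le), mul_add, h6]
    omega

end Invariants

end PiPoint

/-! ### Arrows, translation and projective summands in terms of almost split sequences -/

section Quiver

variable {k A : Type u} [Field k] [Ring A] [Algebra k A]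

theorem arVal_cls {M : StableInd k A} {N E : FDMod k A} {f : N →ₗ[A] E} {g : E →ₗ[A] M.1}
    (h : IsAlmostSplitSeq f g) (x : StableVertex k A) :
    arVal x M.cls = (vertexMult x E, vertexMult x E) := by
  have hset : {n : ℕ | ∃ (X Y : StableInd k A) (N E : FDMod k A) (f : N →ₗ[A] E)
      (g : E →ₗ[A] Y.1), X.cls = x ∧ Y.cls = M.cls ∧ IsAlmostSplitSeq f g ∧
        IsSummand A (Fin n → X.1) E} =
      {n : ℕ | IsSummand A (Fin n → (Quotient.out x : StableInd k A).1) E} := by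
    ext n
    constructor
    · rintro ⟨X, Y, N', E', f', g', rfl, hY, h', hn⟩
      obtain ⟨e⟩ := StableInd.cls_eq_iff.1 hY
      obtain ⟨⟨e'⟩, -⟩ := h'.nonempty_equiv h e
      obtain ⟨e''⟩ := StableInd.cls_eq_iff.1 (StableInd.cls_out X.cls)
      exact ((isSummand_fin_congr e'' n).2 hn).of_equiv A e'
    · exact fun hn => ⟨_, M, N, E, f, g, StableInd.cls_out x, rfl, h, hn⟩
  unfold arVal vertexMult summandMult
  rw [hset]

theorem arTau_cls {M N : StableInd k A} {E : FDMod k A} {f : N.1 →ₗ[A] E} {g : E →ₗ[A] M.1}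
    (h : IsAlmostSplitSeq f g) : arTau M.cls = N.cls := by
  have h1 : IsARTranslate (arTau M.cls) M.cls :=
    Classical.epsilon_spec (p := fun x => IsARTranslate x M.cls)
      ⟨N.cls, N, M, E, f, g, rfl, rfl, h⟩
  obtain ⟨X, Y, E', f', g', hX, hY, h'⟩ := h1
  obtain ⟨e⟩ := StableInd.cls_eq_iff.1 hY
  rw [← hX]
  exact StableInd.cls_eq_iff.2 (h'.nonempty_equiv h e).2

/-- A sum over the predecessors within a component is a sum over all vertices, as a component
contains the predecessors of its vertices. -/
theorem finsum_preds_val (Θ : ARComponent k A) (y : Θ.Vertex) {E : FDMod k A}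
    (hE : ∀ x, arVal x y.1 = (vertexMult x E, vertexMult x E)) (F : StableVertex k A → ℕ) :
    ∑ᶠ x ∈ preds Θ.val y, F x.1 * (Θ.val x y).1 = ∑ᶠ x, F x * vertexMult x E := by
  classical
  have hval : ∀ x : Θ.Vertex, Θ.val x y = (vertexMult x.1 E, vertexMult x.1 E) := fun x => hE x.1
  have h1 : ∀ x : Θ.Vertex, ∑ᶠ _ : x ∈ preds Θ.val y, F x.1 * (Θ.val x y).1 =
      F x.1 * vertexMult x.1 E := by
    intro x
    by_cases hx : x ∈ preds Θ.val y
    · rw [finsum_eq_if, if_pos hx, hval]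
    · rw [finsum_eq_if, if_neg hx]
      have h0 : vertexMult x.1 E = 0 := by
        by_contra h
        have := Nat.pos_of_ne_zero h
        exact hx ⟨by rwa [hval], by rwa [hval]⟩
      rw [h0, mul_zero]
  rw [finsum_congr h1]
  refine (finsum_set_coe_eq_finsum_mem (f := fun x => F x * vertexMult x E)
    {x : StableVertex k A | Quot.mk ARStep x = Θ}).trans (finsum_congr fun x => ?_)
  by_cases hx : Quot.mk ARStep x = Θ
  · rw [finsum_eq_if, if_pos (show x ∈ {x | Quot.mk ARStep x = Θ} from hx)]
  · rw [finsum_eq_if, if_neg (show x ∉ {x | Quot.mk ARStep x = Θ} from hx)]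
    have h0 : vertexMult x E = 0 := by
      by_contra h
      have := Nat.pos_of_ne_zero h
      have hstep : ARStep x y.1 := Or.inl ⟨by rwa [hE], by rwa [hE]⟩
      exact hx ((Quot.sound hstep).trans y.2)
    rw [h0, mul_zero]

theorem isSumAdditive_finrank : IsSumAdditive fun M : FDMod k A => Module.finrank k M :=
  fun X Y Z ⟨e⟩ => by
    change Module.finrank k Z = _
    rw [(e.restrictScalars k).finrank_eq, Module.finrank_prod]

theorem finrank_out_cls (M : StableInd k A) :
    Module.finrank k (Quotient.out M.cls : StableInd k A).1 = Module.finrank k M.1 :=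
  isSumAdditive_finrank.congr (StableInd.cls_eq_iff.1 (StableInd.cls_out M.cls)).some

theorem IsAlmostSplitSeq.finrank_eq_add {N E M : FDMod k A} {f : N →ₗ[A] E} {g : E →ₗ[A] M}
    (h : IsAlmostSplitSeq f g) :
    Module.finrank k E = Module.finrank k M + Module.finrank k N := by
  have h1 := LinearMap.finrank_range_add_finrank_ker (g.restrictScalars k)
  rw [(LinearMap.range_eq_top (f := g.restrictScalars k)).2 h.surjective, finrank_top] at h1
  rw [← h1, (h.kerEquiv.restrictScalars k).finrank_eq]
  rfl

/-- If the non-projective indecomposable summands account for the whole dimension of `E`, then `E`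
has no nonzero projective summand. -/
theorem subsingleton_of_finrank_eq_finsum {E P : FDMod k A}
    (hE : Module.finrank k E = ∑ᶠ x : StableVertex k A,
      Module.finrank k (Quotient.out x : StableInd k A).1 * vertexMult x E)
    (hP : Module.Projective A P) (h : IsSummand A P E) : Subsingleton P := by
  obtain ⟨Q, ⟨e⟩⟩ := h.exists_equiv
  let Q' : FDMod k A := FDMod.of k A Q
  have hmult : ∀ x, vertexMult x E = vertexMult x Q' := fun x => by
    rw [vertexMult_congr x (E' := FDMod.of k A (P × Q')) e, vertexMult_prod,
      vertexMult_eq_zero_of_projective x hP, zero_add]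
  obtain ⟨P', -, -, -, h1⟩ := exists_projective_summand_finsum Q'
  have h2 := h1 _ (fun x => Module.finrank k (Quotient.out x : StableInd k A).1)
    isSumAdditive_finrank finrank_out_cls
  have h3 : Module.finrank k E = Module.finrank k P + Module.finrank k Q' :=
    isSumAdditive_finrank P Q' E ⟨e⟩
  simp only [hmult] at hE
  have h4 : Module.finrank k P = 0 := by omega
  exact Module.finrank_zero_iff.1 h4

end Quiver

/-- The almost split sequence terminating in a vertex of a component, its translate, and the
projective summand of its middle term, which measures the failure of additivity. -/
theorem exists_almostSplit_vertex {k A : Type u} [Field k] [Ring A] [HopfAlgebra k A]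
    [Coalgebra.IsCocomm k A] [Module.Finite k A] (Θ : ARComponent k A) (y : Θ.Vertex) :
    ∃ (M N : StableInd k A) (E P : FDMod k A) (f : N.1 →ₗ[A] E) (g : E →ₗ[A] M.1),
      Θ.Mem M ∧ IsAlmostSplitSeq f g ∧ y.1 = M.cls ∧ (Θ.tau y).1 = N.cls ∧
      Module.Projective A P ∧ IsSummand A P E ∧
      ∀ (a : FDMod k A → ℕ) (F : StableVertex k A → ℕ), IsSumAdditive a →
        (∀ M : StableInd k A, F M.cls = a M.1) →
          a E = a P + ∑ᶠ x, F x * vertexMult x E ∧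
          a E = a P + ∑ᶠ x ∈ preds Θ.val y, F x.1 * (Θ.val x y).1 := by
  obtain ⟨x, hx⟩ := y
  obtain ⟨M, rfl⟩ : ∃ M : StableInd k A, M.cls = x := ⟨_, StableInd.cls_out x⟩
  obtain ⟨F, -⟩ := exists_frobeniusForm k A
  obtain ⟨n, m, π, d, hπ, hd⟩ := exists_free_presentation k A M.1
  obtain ⟨E', g', hg', -⟩ := F.exists_isRightAlmostSplit d M.2.1 π hπ hd
  obtain ⟨N, E, f, g, h⟩ := exists_isAlmostSplitSeq g' hg' M.2.2
  obtain ⟨P, hP, hPE, -, hsum⟩ := exists_projective_summand_finsum E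
  let N' : StableInd k A := ⟨N, h.isIndecomposable, F.not_projective_of_isAlmostSplitSeq h⟩
  refine ⟨M, N', E, P, f, g, hx, h, rfl, arTau_cls (N := N') h, hP, hPE, fun a F ha hF => ?_⟩
  rw [finsum_preds_val Θ ⟨M.cls, hx⟩ (arVal_cls h) F]
  exact ⟨hsum a F ha hF, hsum a F ha hF⟩

/-! ### Additive functions on split components -/

namespace PiPoint

variable {p : ℕ} [NeZero p] {K : Type w} {k A : Type u} [Field k] [Ring A] [HopfAlgebra k A]
  [Field K] [Algebra k K] (α : PiPoint p K k A)

theorem jordanMult_eq_add_of_split {N E M : FDMod k A} {f : N →ₗ[A] E} {g : E →ₗ[A] M}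
    (h : IsAlmostSplitSeq f g)
    (hs : ∃ s : α.Pull M →ₗ[TruncPoly p K] α.Pull E, α.pullMap g ∘ₗ s = LinearMap.id) {i : ℕ}
    (hi : 1 ≤ i) : α.jordanMult i E = α.jordanMult i M + α.jordanMult i N := by
  obtain ⟨s, hs⟩ := hs
  exact α.jordanMult_of_equiv_prod hi ((splitEquiv s (α.pullMap g) hs).trans
    ((LinearEquiv.refl _ _).prodCongr (α.pullKerEquiv h.injective h.exact).symm))

theorem isSumAdditive_nonprojective :
    IsSumAdditive fun M : FDMod k A => Module.finrank k M - p * α.jordanMult p M :=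
  fun X Y Z h => by
    have h1 := isSumAdditive_finrank X Y Z h
    have h2 := α.isSumAdditive_jordanMult (NeZero.one_le (n := p)) X Y Z h
    have h3 := α.mul_jordanMult_le X
    have h4 := α.mul_jordanMult_le Y
    simp only [h2, mul_add] at h1 ⊢
    omega

end PiPoint

end FinGrpAR

theorem mainTheorem2 {k A : Type u} [Field k] [IsAlgClosed k] (p : ℕ) [Fact p.Prime] [CharP k p]
    [Ring A] [HopfAlgebra k A] [Coalgebra.IsCocomm k A] [Module.Finite k A]
    {K : Type w} [Field K] [Algebra k K] (α : FinGrpAR.PiPoint p K k A)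
    (Θ : FinGrpAR.ARComponent k A) (hΘ : α.IsSplitOn Θ) :
    (∀ i : ℕ, 1 ≤ i → i ≤ p - 1 →
      FinGrpAR.IsAdditive Θ.val Θ.tau (α.jordanMultOn Θ i) ∧
        α.jordanMultOn Θ i ∘ Θ.tau = α.jordanMultOn Θ i) ∧
    ((∀ x, p * α.jordanMultOn Θ p x ≤ Θ.dim x) ∧
      FinGrpAR.IsAdditive Θ.val Θ.tau (fun x => Θ.dim x - p * α.jordanMultOn Θ p x) ∧
        (fun x => Θ.dim x - p * α.jordanMultOn Θ p x) ∘ Θ.tau =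
          fun x => Θ.dim x - p * α.jordanMultOn Θ p x) ∧
    (FinGrpAR.IsSubadditive Θ.val Θ.tau (α.jordanMultOn Θ p) ∧
      (FinGrpAR.IsAdditive Θ.val Θ.tau (α.jordanMultOn Θ p) ↔ Θ.IsRegular)) := by
  have hp1 : 1 ≤ p := (Fact.out : p.Prime).one_le
  -- The functions of the theorem, extended to all vertices of the stable quiver.
  let J : ℕ → FinGrpAR.StableVertex k A → ℕ := fun i =>
    Quotient.lift (s := FinGrpAR.stableIndSetoid k A) (fun M => α.jordanMult i M.1)
      (fun _ _ h => Nonempty.elim h fun e => α.jordanMult_congr i e)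
  let D : FinGrpAR.StableVertex k A → ℕ :=
    Quotient.lift (s := FinGrpAR.stableIndSetoid k A) (fun M => Module.finrank k M.1)
      (fun _ _ h => Nonempty.elim h fun e => (e.restrictScalars k).finrank_eq)
  refine ⟨fun i hi hip => ⟨fun y => ?_, funext fun y => ?_⟩,
    ⟨fun y => ?_, fun y => ?_, funext fun y => ?_⟩, fun y => ?_, fun hadd => ?_, fun hreg y => ?_⟩
  · obtain ⟨M, N, E, P, f, g, hM, h, hy, hτ, hP, -, hsum⟩ :=
      FinGrpAR.exists_almostSplit_vertex Θ y
    have h1 := (hsum _ (J i) (α.isSumAdditive_jordanMult hi) fun _ => rfl).2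
    rw [α.jordanMult_eq_zero_of_projective hP hi (by omega), zero_add,
      α.jordanMult_eq_add_of_split h (hΘ M hM N.1 E f g h) hi] at h1
    change J i y.1 + J i (Θ.tau y).1 = _
    rw [hy, hτ]
    exact h1
  · obtain ⟨M, N, E, P, f, g, hM, h, hy, hτ, -⟩ := FinGrpAR.exists_almostSplit_vertex Θ y
    change J i (Θ.tau y).1 = J i y.1
    rw [hy, hτ]
    exact (α.jordanMult_initial_eq M.2.1 M.2.2 h).1 i hi (by omega)
  · obtain ⟨M, N, E, P, f, g, hM, h, hy, -⟩ := FinGrpAR.exists_almostSplit_vertex Θ y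
    change p * J p y.1 ≤ D y.1
    rw [hy]
    exact α.mul_jordanMult_le M.1
  · obtain ⟨M, N, E, P, f, g, hM, h, hy, hτ, hP, -, hsum⟩ :=
      FinGrpAR.exists_almostSplit_vertex Θ y
    have h1 := (hsum _ (fun x => D x - p * J p x) α.isSumAdditive_nonprojective fun _ => rfl).2
    rw [α.mul_jordanMult_of_projective hP, Nat.sub_self, zero_add, h.finrank_eq_add,
      α.jordanMult_eq_add_of_split h (hΘ M hM N.1 E f g h) hp1, mul_add] at h1
    have h2 := α.mul_jordanMult_le M.1
    have h3 := α.mul_jordanMult_le N.1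
    change (D y.1 - p * J p y.1) + (D (Θ.tau y).1 - p * J p (Θ.tau y).1) = _
    rw [hy, hτ]
    refine Eq.trans ?_ h1
    change Module.finrank k M.1 - p * α.jordanMult p M.1 +
      (Module.finrank k N.1 - p * α.jordanMult p N.1) = _
    omega
  · obtain ⟨M, N, E, P, f, g, hM, h, hy, hτ, -⟩ := FinGrpAR.exists_almostSplit_vertex Θ y
    change D (Θ.tau y).1 - p * J p (Θ.tau y).1 = D y.1 - p * J p y.1
    rw [hy, hτ]
    exact (α.jordanMult_initial_eq M.2.1 M.2.2 h).2
  · obtain ⟨M, N, E, P, f, g, hM, h, hy, hτ, hP, -, hsum⟩ :=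
      FinGrpAR.exists_almostSplit_vertex Θ y
    have h1 := (hsum _ (J p) (α.isSumAdditive_jordanMult hp1) fun _ => rfl).2
    rw [α.jordanMult_eq_add_of_split h (hΘ M hM N.1 E f g h) hp1] at h1
    change _ ≤ J p y.1 + J p (Θ.tau y).1
    rw [hy, hτ]
    exact (Nat.le_add_left _ _).trans_eq h1.symm
  · intro M' hM' N' E' f' g' h' P' hP' hPE'
    obtain ⟨y, hyM⟩ : ∃ y : Θ.Vertex, y.1 = M'.cls := ⟨⟨M'.cls, hM'⟩, rfl⟩
    obtain ⟨M, N, E, P, f, g, hM, h, hy, hτ, hP, -, hsum⟩ :=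
      FinGrpAR.exists_almostSplit_vertex Θ y
    obtain ⟨e⟩ := FinGrpAR.StableInd.cls_eq_iff.1 (hyM.symm.trans hy)
    obtain ⟨⟨e'⟩, -⟩ := h'.nonempty_equiv h e
    have h1 := (hsum _ (J p) (α.isSumAdditive_jordanMult hp1) fun _ => rfl).2
    rw [α.jordanMult_eq_add_of_split h (hΘ M hM N.1 E f g h) hp1] at h1
    have h2 : J p y.1 + J p (Θ.tau y).1 = _ := hadd y
    rw [hy, hτ] at h2
    -- Additivity at `y` means that `α_p` vanishes on the projective summand `P`, so `P = 0` and the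
    -- non-projective summands account for the whole dimension of `E`.
    have h3 : α.jordanMult p P = 0 := Nat.add_eq_right.1 (h1.symm.trans h2)
    have h4 := α.mul_jordanMult_of_projective hP
    have h5 := (hsum _ (fun x => Module.finrank k (Quotient.out x : FinGrpAR.StableInd k A).1)
      FinGrpAR.isSumAdditive_finrank FinGrpAR.finrank_out_cls).1
    rw [← h4, h3, mul_zero, zero_add] at h5
    exact FinGrpAR.subsingleton_of_finrank_eq_finsum h5 hP' (hPE'.of_equiv A e')
  · obtain ⟨M, N, E, P, f, g, hM, h, hy, hτ, hP, hPE, hsum⟩ :=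
      FinGrpAR.exists_almostSplit_vertex Θ y
    have := hreg M hM N.1 E f g h P hP hPE
    have h1 := (hsum _ (J p) (α.isSumAdditive_jordanMult hp1) fun _ => rfl).2
    rw [(α.isSumAdditive_jordanMult hp1).eq_zero P, zero_add,
      α.jordanMult_eq_add_of_split h (hΘ M hM N.1 E f g h) hp1] at h1
    change J p y.1 + J p (Θ.tau y).1 = _
    rw [hy, hτ]
    exact h1
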